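/- Let $X$ be a complex affine surface, i.e. a nonempty reduced complex affine variety all of whose irreducible components have dimension $2$, with coordinate ring $\mathcal O_X=\Omega^0(X)$ and module of Kähler differentials $\Omega^1(X)=\Omega^1_{\mathcal O_X/\mathbb C}$. Assume that $X$ is locally a complete intersection (every point has an affine open neighbourhood isomorphic to a closed subscheme of some $\mathbb A^n$ defined by $n-2$ equations). Let $f:X\to\mathbb C$ be a morphism that is dominant on every irreducible component of $X$. (If $X$ is irreducible, this just says that $f$ is dominant.) Let $\mathrm{Sing}(f)\subseteq X$ be the set of points at which $X$ is singular or $df$ vanishes. Put $$H^1(f)=\frac{\Omega^1(X)}{d\Omega^0(X)+\Omega^0(X)\,df},$$ a $\mathbb C[f]$-module, and for $y\in\mathbb C$ let $$H^1(f^{-1}(y))=\Omega^1(f^{-1}(y))/d\Omega^0(f^{-1}(y)),$$ where the fibre $f^{-1}(y)$ carries its reduced structure. Set $h^1(y)=\dim_{\mathbb C}H^1(f^{-1}(y))$. Then the rank $h_f$ of the $\mathbb C[f]$-module $H^1(f)$ is finite, and for every $y_0\in\mathbb C$ such that $f^{-1}(y_0)\cap\mathrm{Sing}(f)$ is finite,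 $$\dim_{\mathbb C} H^1(f^{-1}(y_0))\le h_f .$$ Moreover, the function $h^1$ is lower semicontinuous at every such $y_0$, i.e. $h^1(y_0)\le\liminf_{y\to y_0}h^1(y)$. -/

import Mathlib

open scoped KaehlerDifferential

/-! A complex affine variety `X` is given by its coordinate ring `A`, a reduced `ℂ`-algebra of
finite type. Its points are the `ℂ`-algebra homomorphisms `A →ₐ[ℂ] ℂ`, a morphism `X → ℂ` is an
element `f` of `A`, with value `x f` at the point `x`, and the regular `1`-forms on `X` are the
elements of `Ω[A⁄ℂ]`. -/

namespace TruncatedDeRham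

noncomputable section

universe u

/-- `X` is a (nonempty, reduced) affine surface, i.e. an affine variety all of whose irreducible
components have dimension `2`. -/
structure IsAffineSurface (A : Type u) [CommRing A] [Algebra ℂ A] : Prop where
  nontrivial : Nontrivial A
  finiteType : Algebra.FiniteType ℂ A
  isReduced : IsReduced A
  equidimensional : ∀ p ∈ minimalPrimes A, ringKrullDim (A ⧸ p) = 2

/-- `f : X → ℂ` is dominant on every irreducible component of `X`: for every such component `Z`,
the pullback `ℂ[t] → 𝒪(Z)`, `t ↦ f|Z`, is injective. -/
def IsDominant {A : Type u} [CommRing A] [Algebra ℂ A] (f : A) : Prop :=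
  ∀ p ∈ minimalPrimes A, Transcendental ℂ (Ideal.Quotient.mk p f)

/-- `X`, of pure dimension `d`, is locally a complete intersection: every point has a principal
affine open neighbourhood which is isomorphic to a closed subscheme of some affine space `𝔸ⁿ`
defined by `c = n - d` equations. -/
def IsLocallyCompleteIntersection (A : Type u) [CommRing A] [Algebra ℂ A] (d : ℕ) : Prop :=
  ∀ x : A →ₐ[ℂ] ℂ, ∃ g : A, x g ≠ 0 ∧
    ∃ (n c : ℕ) (r : Fin c → MvPolynomial (Fin n) ℂ), n = c + d ∧
      Nonempty (Localization.Away g ≃ₐ[ℂ] MvPolynomial (Fin n) ℂ ⧸ Ideal.span (Set.range r))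

/-- `X` is smooth at the point `x`: the local ring of `X` at `x` is regular. -/
def IsSmoothPoint {A : Type u} [CommRing A] [Algebra ℂ A] (x : A →ₐ[ℂ] ℂ) : Prop :=
  haveI : (RingHom.ker x).IsPrime := RingHom.ker_isPrime x
  IsRegularLocalRing (Localization.AtPrime (RingHom.ker x))

/-- `Sing(f)`: the points at which `X` is singular or `df` vanishes, the latter meaning that
the class of `df` in `Ω¹(X) / 𝔪ₓ Ω¹(X)` is zero. -/
def sing {A : Type u} [CommRing A] [Algebra ℂ A] (f : A) : Set (A →ₐ[ℂ] ℂ) :=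
  {x | ¬ IsSmoothPoint x ∨
    KaehlerDifferential.D ℂ A f ∈ RingHom.ker x • (⊤ : Submodule A (Ω[A⁄ℂ]))}

/-- The set of points of the fibre `f⁻¹(y)`. -/
def fiber {A : Type u} [CommRing A] [Algebra ℂ A] (f : A) (y : ℂ) : Set (A →ₐ[ℂ] ℂ) :=
  {x | x f = y}

/-- The coordinate ring of the fibre `f⁻¹(y)`, as a reduced affine variety. -/
abbrev FiberRing {A : Type u} [CommRing A] [Algebra ℂ A] (f : A) (y : ℂ) : Type u :=
  A ⧸ (Ideal.span {f - algebraMap ℂ A y}).radical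

/-- The first truncated De Rham cohomology group `H¹(C) = Ω¹(C) / dΩ⁰(C)` of the affine variety
with coordinate ring `B`. -/
abbrev H1 (B : Type u) [CommRing B] [Algebra ℂ B] : Type u :=
  Ω[B⁄ℂ] ⧸ LinearMap.range (KaehlerDifferential.D ℂ B).toLinearMap

theorem exists_D_eq {A : Type u} [CommRing A] [Algebra ℂ A] (f : A) {s : A}
    (hs : s ∈ Algebra.adjoin ℂ {f}) :
    ∃ b : A, KaehlerDifferential.D ℂ A s = b • KaehlerDifferential.D ℂ A f := by
  induction hs using Algebra.adjoin_induction with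
  | mem x hx => exact ⟨1, by rw [Set.mem_singleton_iff.1 hx, one_smul]⟩
  | algebraMap r => exact ⟨0, by simp⟩
  | add x y _ _ hx hy =>
    obtain ⟨a, ha⟩ := hx
    obtain ⟨b, hb⟩ := hy
    exact ⟨a + b, by rw [map_add, ha, hb, add_smul]⟩
  | mul x y _ _ hx hy =>
    obtain ⟨a, ha⟩ := hx
    obtain ⟨b, hb⟩ := hy
    exact ⟨x * b + y * a, by rw [Derivation.leibniz, ha, hb, add_smul, mul_smul, mul_smul]⟩

/-- The `ℂ[f]`-submodule `dΩ⁰(X) + Ω⁰(X) df` of `Ω¹(X)`. -/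
def relExact {A : Type u} [CommRing A] [Algebra ℂ A] (f : A) :
    Submodule (Algebra.adjoin ℂ {f}) (Ω[A⁄ℂ]) where
  carrier := {ω | ∃ a b : A,
    ω = KaehlerDifferential.D ℂ A a + b • KaehlerDifferential.D ℂ A f}
  zero_mem' := ⟨0, 0, by simp⟩
  add_mem' := by
    rintro _ _ ⟨a, b, rfl⟩ ⟨a', b', rfl⟩
    exact ⟨a + a', b + b', by rw [map_add, add_smul]; abel⟩
  smul_mem' := by
    rintro ⟨s, hs⟩ _ ⟨a, b, rfl⟩
    obtain ⟨e, he⟩ := exists_D_eq f hs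
    refine ⟨s * a, s * b - a * e, ?_⟩
    change s • (KaehlerDifferential.D ℂ A a + b • KaehlerDifferential.D ℂ A f) = _
    rw [Derivation.leibniz, he, smul_add, sub_smul, mul_smul, mul_smul]
    abel

/-- The first truncated relative cohomology group `H¹(f) = Ω¹(X) / (dΩ⁰(X) + Ω⁰(X) df)`,
a `ℂ[f]`-module. -/
abbrev RelH1 {A : Type u} [CommRing A] [Algebra ℂ A] (f : A) : Type u :=
  Ω[A⁄ℂ] ⧸ relExact f

/-- The function `h¹(y) = dim H¹(f⁻¹(y))`, with values in `ℕ ∪ {∞}`. -/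
def h1 {A : Type u} [CommRing A] [Algebra ℂ A] (f : A) (y : ℂ) : ℕ∞ :=
  Cardinal.toENat (Module.rank ℂ (H1 (FiberRing f y)))

end

end TruncatedDeRham

/-! Both assertions follow from two inequalities: `h1 f y₀ ≤ h_f` at the values `y₀` under
consideration, and `h_f ≤ h1 f y` for all but finitely many `y`.

Upper bound (`IsAffineSurface.rank_H1_fiberRing_le`). Lift a basis of `H¹(f⁻¹(y))` to forms `ω i` on
`X`, and suppose that `∑ p i(f) ω i` is relatively exact. If `(X - y) ^ n` divides every `p i`, with
quotients `q i`, then `(f - y) ^ n` kills the class of `∑ q i(f) ω i` in `H¹(f)`. Such a torsion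
class need not vanish, but it is divisible by every power of `f - y`
(`IsAffineSurface.exists_sub_mem_relExact_of_pow`), so it dies on the fibre. Hence `q i` vanishes at
`y`, and the divisibility improves without end. For the divisibility of torsion, let `(f - y) ω = da
+ b df`. Then `a` is locally constant on the fibre, so it is a root modulo `f - y` of a separable
polynomial; Newton's iteration moves it to a root modulo a high power of `f - y`, whose differential
is divisible by that power modulo `df`. It remains to cancel one factor `f - y` in `Ω¹ / Ω⁰ df`
(`IsAffineSurface.exists_smul_D_eq`). In local equations the relation to be divided is one between
the gradients of the equations and of `f`. These are independent at the points of the fibre off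
`Sing(f)`, so the coefficients vanish there. Macaulay's unmixedness theorem excludes embedded and
isolated points, so the fibre is reduced and the coefficients are divisible by `f - y`.

Finite rank (`rank_relH1_lt_aleph0`). The generic fibre is a reduced curve over `ℂ(t)`, finite and
free over a polynomial ring in a coordinate `x`. A multiple of `d/dx` extends to a derivation `δ`.
The degree of `a` is bounded in terms of that of `δ a` (`natDegree_repr_le_of_derivation`), by
comparing pole orders at infinity in `tr(δ(aᵐ)) = Δ · (tr aᵐ)'`. A dimension count along the degree
filtration then gives a finite-dimensional cokernel.

Generic lower bound (`exists_linearIndependent_restrictFiber`). The same degree bound holds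
uniformly on almost all fibres. If a combination of independent classes is exact on a fibre, its
primitive can be chosen in a finitely generated module that does not depend on `y`. Since the
torsion modulo a fixed finitely generated module is killed by powers of one polynomial
(`Frame.boundedTorsion`, a weak generic freeness), away from the zeros of that polynomial the
combination must be trivial. -/

/-! ### Associated primes and depth, phrased through ideals -/

namespace TruncatedDeRham

open Ideal

section Depth

variable {R : Type*} [CommRing R]

/-- `p` is a prime of the form `I : u`. -/
def IsColonPrime (I p : Ideal R) : Prop :=
  p.IsPrime ∧ ∃ u : R, ∀ r : R, r ∈ p ↔ r * u ∈ I

/-- A maximal member of the family of ideals `I : (c * a)` with `c * a ∉ I` is prime. The multiplier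
`c` is kept in the conclusion, together with `I : a ≤ p`, because later arguments need a prime that
controls a given element `a`. -/
theorem exists_isColonPrime [IsNoetherianRing R] (I : Ideal R) {a : R} (ha : a ∉ I) :
    ∃ (p : Ideal R) (c : R), p.IsPrime ∧ (∀ r : R, r ∈ p ↔ r * (c * a) ∈ I) ∧
      ∀ r : R, r * a ∈ I → r ∈ p := by
  let col : R → Ideal R := fun c => Submodule.comap (LinearMap.mulRight R (c * a)) I
  have hcol : ∀ c r, r ∈ col c ↔ r * (c * a) ∈ I := fun c r => Iff.rfl
  let S : Set (Ideal R) := {J | ∃ c : R, c * a ∉ I ∧ J = col c}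
  have hS : S.Nonempty := ⟨col 1, 1, by simpa using ha, rfl⟩
  obtain ⟨p, ⟨c, hc, rfl⟩, hmax⟩ := set_has_maximal_iff_noetherian.2 ‹_› S hS
  refine ⟨col c, c, ⟨?_, ?_⟩, hcol c, ?_⟩
  · intro h
    exact hc (by simpa using (hcol c 1).1 (h ▸ Submodule.mem_top))
  · intro x y hxy
    by_contra! h
    have hx : x * c * a ∉ I := fun hx => h.1 ((hcol c x).2 (by rwa [← mul_assoc]))
    refine hmax (col (x * c)) ⟨x * c, hx, rfl⟩ (lt_of_le_of_ne ?_ ?_)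
    · intro r hr
      have := I.mul_mem_left x ((hcol c r).1 hr)
      exact (hcol _ r).2 (by convert this using 1; ring)
    · intro h'
      refine h.2 (h' ▸ (hcol _ y).2 ?_)
      convert (hcol c _).1 hxy using 1
      ring
  · intro r hr
    exact (hcol c r).2 (by convert I.mul_mem_left c hr using 1; ring)

theorem finite_setOf_isColonPrime [IsNoetherianRing R] (I : Ideal R) :
    {p | IsColonPrime I p}.Finite := by
  refine (associatedPrimes.finite R (R ⧸ I)).subset ?_
  rintro p ⟨hp, u, hu⟩
  refine ⟨hp, Ideal.Quotient.mk I u, ?_⟩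
  have : (⊥ : Submodule R (R ⧸ I)).colon {Ideal.Quotient.mk I u} = p := by
    ext r
    rw [Submodule.mem_colon_singleton, hu, Submodule.mem_bot, Algebra.smul_def,
      Ideal.Quotient.algebraMap_eq, ← map_mul, Ideal.Quotient.eq_zero_iff_mem]
  rw [this, hp.radical]

/-- `x` is a nonzerodivisor modulo `I`. -/
def RegularMod (I : Ideal R) (x : R) : Prop := ∀ u : R, x * u ∈ I → u ∈ I

/-- Zero divisors modulo `I` are exactly the elements of the colon primes of `I`. -/
theorem regularMod_iff [IsNoetherianRing R] {I : Ideal R} {x : R} :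
    RegularMod I x ↔ ∀ p, IsColonPrime I p → x ∉ p := by
  refine ⟨?_, fun h u hu => ?_⟩
  · rintro h p ⟨hp, u, hu⟩ hx
    refine hp.one_notMem ((hu 1).2 ?_)
    rw [one_mul]
    exact h u ((hu x).1 hx)
  · by_contra hu'
    obtain ⟨p, c, hp, hc, hle⟩ := exists_isColonPrime I hu'
    exact h p ⟨hp, _, hc⟩ (hle x hu)

/-- In a regular sequence `y, x` modulo `I` the only obstruction to the order `x, y` is that `x`
itself may be a zero divisor modulo `I`. -/
theorem RegularMod.swap {I : Ideal R} {x y : R} (hy : RegularMod I y)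
    (hxy : RegularMod (I ⊔ span {y}) x) : RegularMod (I ⊔ span {x}) y ∨ ¬ RegularMod I x := by
  by_cases hx : RegularMod I x
  swap
  · exact Or.inr hx
  refine Or.inl fun u hu => ?_
  obtain ⟨i, hi, w, hw, hiw⟩ := Submodule.mem_sup.1 hu
  obtain ⟨v, rfl⟩ := mem_span_singleton'.1 hw
  have hv : v ∈ I ⊔ span {y} := by
    refine hxy v ?_
    have : x * v = -i + u * y := by linear_combination hiw
    rw [this]
    exact add_mem (mem_sup_left (neg_mem hi)) (mem_sup_right (mem_span_singleton'.2 ⟨u, rfl⟩))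
  obtain ⟨j, hj, w', hw', hjw⟩ := Submodule.mem_sup.1 hv
  obtain ⟨v', rfl⟩ := mem_span_singleton'.1 hw'
  have : u - v' * x ∈ I := by
    refine hy _ ?_
    have : y * (u - v' * x) = i + x * j := by linear_combination (-1) * hiw - x * hjw
    rw [this]
    exact add_mem hi (I.mul_mem_left _ hj)
  have h2 : u = (u - v' * x) + v' * x := by ring
  rw [h2]
  exact add_mem (mem_sup_left this) (mem_sup_right (mem_span_singleton'.2 ⟨v', rfl⟩))

variable [IsLocalRing R]

open IsLocalRing

/-- There is a regular sequence modulo `I`, of length `k`, in the maximal ideal. -/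
def DepthGE : ℕ → Ideal R → Prop
  | 0, _ => True
  | k + 1, I => ∃ x ∈ maximalIdeal R, RegularMod I x ∧ DepthGE k (I ⊔ span {x})

/-- Prime avoidance over the finitely many colon primes of the ideals in `s`, none of which is the
maximal ideal. -/
theorem exists_regularMod_of_finset [IsNoetherianRing R] (s : Finset (Ideal R))
    (h : ∀ I ∈ s, ¬ IsColonPrime I (maximalIdeal R)) :
    ∃ z ∈ maximalIdeal R, ∀ I ∈ s, RegularMod I z := by
  classical
  let t : Finset (Ideal R) := s.biUnion fun I => (finite_setOf_isColonPrime I).toFinset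
  have ht : ∀ p ∈ t, p.IsPrime := by
    intro p hp
    obtain ⟨I, -, hI⟩ := Finset.mem_biUnion.1 hp
    exact ((Set.Finite.mem_toFinset _).1 hI).1
  by_contra! hcon
  have hsub : (maximalIdeal R : Set R) ⊆ ⋃ p ∈ (t : Set (Ideal R)), ((id p : Ideal R) : Set R) := by
    intro z hz
    obtain ⟨I, hI, hz'⟩ := hcon z hz
    rw [regularMod_iff] at hz'
    push Not at hz'
    obtain ⟨p, hp, hzp⟩ := hz'
    exact Set.mem_biUnion (Finset.mem_biUnion.2 ⟨I, hI, (Set.Finite.mem_toFinset _).2 hp⟩) hzp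
  obtain ⟨p, hp, hle⟩ := (Ideal.subset_union_prime ⊤ ⊤ fun p hp _ _ => ht p hp).1 hsub
  have := (maximalIdeal.isMaximal R).eq_of_le (ht p hp).ne_top hle
  obtain ⟨I, hIs, hI⟩ := Finset.mem_biUnion.1 hp
  have hI' : IsColonPrime I p := (finite_setOf_isColonPrime I).mem_toFinset.1 hI
  exact h I hIs (this ▸ hI')

/-- Depth zero of `R / (I, x)` does not depend on the regular element `x`: if `u` spans a copy of
the residue field modulo `(I, x)`, then `y u ≡ x v` modulo `I`, and `v` does the same modulo `(I,
y)`. -/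
theorem IsColonPrime.exchange {I : Ideal R} {x y : R} (hx : RegularMod I x) (hy : RegularMod I y)
    (hym : y ∈ maximalIdeal R) (h : IsColonPrime (I ⊔ span {x}) (maximalIdeal R)) :
    IsColonPrime (I ⊔ span {y}) (maximalIdeal R) := by
  obtain ⟨hp, u, hu⟩ := h
  obtain ⟨i, hi, w, hw, hiw⟩ := Submodule.mem_sup.1 ((hu y).1 hym)
  obtain ⟨v, rfl⟩ := mem_span_singleton'.1 hw
  have hv : v ∉ I ⊔ span {y} := by
    intro hv
    obtain ⟨j, hj, w', hw', hjw⟩ := Submodule.mem_sup.1 hv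
    obtain ⟨v', rfl⟩ := mem_span_singleton'.1 hw'
    have h1 : u - v' * x ∈ I := by
      refine hy _ ?_
      have : y * (u - v' * x) = i + x * j := by linear_combination (-1) * hiw - x * hjw
      rw [this]
      exact add_mem hi (I.mul_mem_left _ hj)
    refine hp.one_notMem ((hu 1).2 ?_)
    have h2 : 1 * u = (u - v' * x) + v' * x := by ring
    rw [h2]
    exact add_mem (mem_sup_left h1) (mem_sup_right (mem_span_singleton'.2 ⟨v', rfl⟩))
  refine ⟨hp, v, fun r => ⟨fun hr => ?_, fun hr => ?_⟩⟩
  · obtain ⟨i', hi', w', hw', hiw'⟩ := Submodule.mem_sup.1 ((hu r).1 hr)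
    obtain ⟨v', rfl⟩ := mem_span_singleton'.1 hw'
    have h1 : r * v - v' * y ∈ I := by
      refine hx _ ?_
      have : x * (r * v - v' * y) = y * i' - r * i := by linear_combination r * hiw - y * hiw'
      rw [this]
      exact sub_mem (I.mul_mem_left _ hi') (I.mul_mem_left _ hi)
    have h2 : r * v = (r * v - v' * y) + v' * y := by ring
    rw [h2]
    exact add_mem (mem_sup_left h1) (mem_sup_right (mem_span_singleton'.2 ⟨v', rfl⟩))
  · by_contra hr'
    have : IsUnit r := by simpa using hr'
    exact hv ((Ideal.unit_mul_mem_iff_mem _ this).1 hr)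

theorem DepthGE.not_isColonPrime {I : Ideal R} {k : ℕ} (h : DepthGE (k + 1) I) :
    ¬ IsColonPrime I (maximalIdeal R) := by
  rintro ⟨hp, u, hu⟩
  obtain ⟨x, hx, hreg, -⟩ := h
  refine hp.one_notMem ((hu 1).2 ?_)
  rw [one_mul]
  exact hreg u ((hu x).1 hx)

/-- `DepthGE` asks for some regular sequence; this makes the first element arbitrary, which is what
allows prescribed elements to be used. -/
theorem DepthGE.of_regularMod [IsNoetherianRing R] {k : ℕ} : ∀ {I : Ideal R} {x : R},
    DepthGE (k + 1) I → x ∈ maximalIdeal R → RegularMod I x → DepthGE k (I ⊔ span {x}) := by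
  induction k with
  | zero => intros; trivial
  | succ k ih =>
    intro I x hI hx hreg
    have hI0 := hI.not_isColonPrime
    obtain ⟨y, hy, hyreg, hyd⟩ := hI
    have hIy := hyd.not_isColonPrime
    have hIx : ¬ IsColonPrime (I ⊔ span {x}) (maximalIdeal R) :=
      fun h => hIy (h.exchange hreg hyreg hy)
    classical
    -- A common nonzerodivisor `z` connects `y` to `x`: the depth of `(I, y)` passes to `(I, y, z)`,
    -- hence to `(I, z)`, hence to `(I, z, x)`, where `z` is still regular modulo `(I, x)`.
    obtain ⟨z, hz, hzr⟩ := exists_regularMod_of_finset {I, I ⊔ span {x}, I ⊔ span {y}}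
      (by simp [hI0, hIy, hIx])
    have hzI := hzr I (by simp)
    have hzx := hzr (I ⊔ span {x}) (by simp)
    have hzy := hzr (I ⊔ span {y}) (by simp)
    have hd : DepthGE k (I ⊔ span {y} ⊔ span {z}) := ih hyd hz hzy
    have hyz : RegularMod (I ⊔ span {z}) y := (hyreg.swap hzy).resolve_right (not_not.2 hzI)
    have hxz : RegularMod (I ⊔ span {z}) x := (hreg.swap hzx).resolve_right (not_not.2 hzI)
    rw [sup_right_comm] at hd
    have := ih (I := I ⊔ span {z}) ⟨y, hy, hyz, hd⟩ hx hxz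
    rw [sup_right_comm] at this
    exact ⟨z, hz, hzx, this⟩

/-- In depth at least `k` all associated primes have coheight at least `k`. -/
theorem DepthGE.le_ringKrullDim [IsNoetherianRing R] {k : ℕ} : ∀ {I p : Ideal R},
    DepthGE k I → IsColonPrime I p → (k : WithBot ℕ∞) ≤ ringKrullDim (R ⧸ p) := by
  induction k with
  | zero =>
    intro I p _ hp
    have := Ideal.Quotient.nontrivial_iff.2 hp.1.ne_top
    simpa using ringKrullDim_nonneg_of_nontrivial
  | succ k ih =>
    rintro I p ⟨x, hx, hreg, hd⟩ hp
    have hxp : x ∉ p := regularMod_iff.1 hreg p hp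
    obtain ⟨hpp, u, hu⟩ := hp
    let N : Ideal R := Submodule.colon I (p : Set R)
    have hN : ∀ v, v ∈ N ↔ ∀ r ∈ p, v * r ∈ I := fun v => Submodule.mem_colon
    have huI : u ∉ I := fun h => hpp.one_notMem ((hu 1).2 (by simpa using h))
    -- If `I : p` were contained in `I + (x)`, regularity of `x` would give `I : p ≤ I + x (I : p)`,
    -- and Nakayama's lemma would put `u` in `I`.
    have : ∃ v ∈ N, v ∉ I ⊔ span {x} := by
      by_contra! hcon
      have hle : N ≤ I ⊔ span {x} • N := by
        intro v hv
        obtain ⟨i, hi, w, hw, hiw⟩ := Submodule.mem_sup.1 (hcon v hv)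
        obtain ⟨v', rfl⟩ := mem_span_singleton'.1 hw
        rw [← hiw]
        refine add_mem (mem_sup_left hi) (mem_sup_right ?_)
        rw [mul_comm]
        refine Ideal.mul_mem_mul (mem_span_singleton_self x) ((hN _).2 fun r hr => hreg _ ?_)
        have h1 : x * (v' * r) = v * r - r * i := by linear_combination r * hiw
        rw [h1]
        exact sub_mem ((hN v).1 hv r hr) (I.mul_mem_left _ hi)
      have := Submodule.le_of_le_smul_of_le_jacobson_bot (IsNoetherian.noetherian N)
        (I := span {x}) ?_ hle
      · exact huI (this ((hN u).2 fun r hr => by rw [mul_comm]; exact (hu r).1 hr))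
      · rw [IsLocalRing.jacobson_eq_maximalIdeal ⊥ bot_ne_top, span_singleton_le_iff_mem]
        exact hx
    obtain ⟨v, hvN, hv⟩ := this
    -- The prime `q` contains both `p` and `x`, while `x ∉ p`, so the dimension of `R / p` exceeds
    -- that of `R / q`.
    obtain ⟨q, c, hq, hqc, hqle⟩ := exists_isColonPrime (I ⊔ span {x}) hv
    have hpq : p ≤ q := fun r hr => hqle r (by
      rw [mul_comm]
      exact mem_sup_left ((hN v).1 hvN r hr))
    have hxq : x ∈ q := hqle x (mem_sup_right (mem_span_singleton'.2 ⟨v, mul_comm _ _⟩))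
    have hdim := ih hd ⟨hq, _, hqc⟩
    have hstep : ringKrullDim (R ⧸ q) + 1 ≤ ringKrullDim (R ⧸ p) := by
      refine ringKrullDim_succ_le_of_surjective (Ideal.Quotient.factor hpq)
        (Ideal.Quotient.factor_surjective hpq) (r := Ideal.Quotient.mk p x) ?_ ?_
      · exact mem_nonZeroDivisors_of_ne_zero (by
          rwa [Ne, Ideal.Quotient.eq_zero_iff_mem])
      · simpa [Ideal.Quotient.eq_zero_iff_mem] using hxq
    push_cast
    exact (add_le_add_left hdim 1).trans hstep

/-- Elements cutting the dimension down as much as possible form a regular sequence when the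
depth is as large as possible. -/
theorem DepthGE.quotient_of_ringKrullDim_le [IsNoetherianRing R] (k : ℕ) (x : ℕ → R)
    (hx : ∀ i, x i ∈ maximalIdeal R) : ∀ (c : ℕ) (I : Ideal R), DepthGE (k + c) I →
    ringKrullDim (R ⧸ (I ⊔ span (x '' Set.Iio c))) ≤ k →
    DepthGE k (I ⊔ span (x '' Set.Iio c)) := by
  classical
  intro c
  induction c generalizing x with
  | zero => intro I h _; simpa using h
  | succ c ih =>
    intro I h hdim
    have hset : x '' Set.Iio (c + 1) = {x 0} ∪ (fun i => x (i + 1)) '' Set.Iio c := by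
      ext r
      constructor
      · rintro ⟨i, hi, rfl⟩
        rcases i with _ | i
        · exact Or.inl rfl
        · exact Or.inr ⟨i, by simpa using hi, rfl⟩
      · rintro (rfl | ⟨i, hi, rfl⟩)
        · exact ⟨0, by simp, rfl⟩
        · exact ⟨i + 1, by simpa using hi, rfl⟩
    have hI : I ⊔ span (x '' Set.Iio (c + 1)) =
        I ⊔ span {x 0} ⊔ span ((fun i => x (i + 1)) '' Set.Iio c) := by
      rw [hset, span_union, sup_assoc]
    rw [hI] at hdim ⊢
    refine ih (fun i => x (i + 1)) (fun i => hx _) _ (DepthGE.of_regularMod h (hx 0) ?_) hdim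
    -- If `x 0` lay in a colon prime `p` of `I`, the remaining `c` elements would have to cut `R /
    -- p`, of dimension at least `k + c + 1`, down to dimension at most `k`.
    rw [regularMod_iff]
    intro p hp hxp
    have h1 := h.le_ringKrullDim hp
    have hIp : I ⊔ span {x 0} ≤ p := by
      obtain ⟨hpp, u, hu⟩ := hp
      refine sup_le (fun r hr => (hu r).2 (I.mul_mem_right _ hr)) ?_
      rwa [span_singleton_le_iff_mem]
    have := hp.1
    let J : Ideal R := I ⊔ span {x 0} ⊔ span ((fun i => x (i + 1)) '' Set.Iio c)
    let s : Finset (R ⧸ p) := (Finset.range c).image fun i => Ideal.Quotient.mk p (x (i + 1))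
    have hs : (s : Set (R ⧸ p)) ⊆ Ring.jacobson (R ⧸ p) := by
      have : IsLocalRing (R ⧸ p) := .of_surjective' _ Ideal.Quotient.mk_surjective
      rw [← Ideal.jacobson_bot, IsLocalRing.jacobson_eq_maximalIdeal ⊥ bot_ne_top]
      intro r hr
      obtain ⟨i, -, rfl⟩ := Finset.mem_image.1 hr
      have : IsLocalHom (Ideal.Quotient.mk p) := .of_surjective _ Ideal.Quotient.mk_surjective
      exact (IsLocalRing.mem_maximalIdeal _).2 fun hu =>
        ((IsLocalRing.mem_maximalIdeal _).1 (hx (i + 1))) (isUnit_of_map_unit _ _ hu)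
    have h2 := ringKrullDim_le_ringKrullDim_quotient_add_card s hs
    have h3 : ringKrullDim ((R ⧸ p) ⧸ span (s : Set (R ⧸ p))) ≤ ringKrullDim (R ⧸ J) := by
      refine ringKrullDim_le_of_surjective (Ideal.Quotient.lift J
        ((Ideal.Quotient.mk (span (s : Set (R ⧸ p)))).comp (Ideal.Quotient.mk p)) ?_) ?_
      · have : J ≤ RingHom.ker ((Ideal.Quotient.mk (span (s : Set (R ⧸ p)))).comp
            (Ideal.Quotient.mk p)) := by
          refine sup_le (hIp.trans fun r hr => ?_) (span_le.2 ?_)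
          · simp [RingHom.mem_ker, Ideal.Quotient.eq_zero_iff_mem.2 hr]
          · rintro _ ⟨i, hi, rfl⟩
            simp only [SetLike.mem_coe, RingHom.mem_ker, RingHom.comp_apply]
            rw [Ideal.Quotient.eq_zero_iff_mem]
            refine subset_span ?_
            exact Finset.mem_coe.2 (Finset.mem_image.2 ⟨i, by simpa using hi, rfl⟩)
        exact fun a ha => this ha
      · refine Ideal.Quotient.lift_surjective_of_surjective _ _ ?_
        exact Ideal.Quotient.mk_surjective.comp Ideal.Quotient.mk_surjective
    have hcard : s.card ≤ c := by simpa using (Finset.card_image_le (s := Finset.range c)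
      (f := fun i => Ideal.Quotient.mk p (x (i + 1))))
    have h4 : ringKrullDim (R ⧸ p) ≤ (k : WithBot ℕ∞) + c :=
      h2.trans (add_le_add (h3.trans hdim) (by exact_mod_cast hcard))
    have h5 := h1.trans h4
    have h6 : ((k + (c + 1) : ℕ) : WithBot ℕ∞) ≤ ((k + c : ℕ) : WithBot ℕ∞) := by
      push_cast at h5 ⊢
      exact h5
    have h7 : k + (c + 1) ≤ k + c := by exact_mod_cast h6
    omega

end Depth

end TruncatedDeRham

/-! ### Depth of affine space and unmixedness for complete intersection curves -/

namespace TruncatedDeRham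

open Ideal MvPolynomial IsLocalRing

theorem ringKrullDim_quotient_map_le {P : Type*} [CommRing P] (S : Submonoid P) (R : Type*)
    [CommRing R] [Algebra P R] [IsLocalization S R] (J : Ideal P) :
    ringKrullDim (R ⧸ J.map (algebraMap P R)) ≤ ringKrullDim (P ⧸ J) := by
  let φ := algebraMap P R
  let θ : (P ⧸ J) →+* (R ⧸ J.map φ) := Ideal.quotientMap (J.map φ) φ le_comap_map
  refine Order.krullDim_le_of_strictMono (PrimeSpectrum.comap θ) ?_
  refine Monotone.strictMono_of_injective (fun a b h => Ideal.comap_mono h) ?_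
  have h1 : Function.Injective (PrimeSpectrum.comap φ ∘
      PrimeSpectrum.comap (Ideal.Quotient.mk (J.map φ))) :=
    (PrimeSpectrum.localization_comap_injective R S).comp
      (PrimeSpectrum.comap_injective_of_surjective _ Ideal.Quotient.mk_surjective)
  have h2 : PrimeSpectrum.comap φ ∘ PrimeSpectrum.comap (Ideal.Quotient.mk (J.map φ)) =
      PrimeSpectrum.comap (Ideal.Quotient.mk J) ∘ PrimeSpectrum.comap θ := by
    ext q r
    simp [θ, PrimeSpectrum.comap]
  rw [h2] at h1
  exact h1.of_comp

section PolynomialDepth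

variable {k : Type*} [Field k] {n : ℕ}

/-- The kernel of the substitution of the first `i` coordinates of `c`. -/
theorem ker_partialEval_succ (c : Fin n → k) (i : ℕ) (hi : i < n) :
    RingHom.ker (aeval (R := k) fun j : Fin n =>
        if (j : ℕ) < i + 1 then (C (c j) : MvPolynomial (Fin n) k) else X j) =
      RingHom.ker (aeval (R := k) fun j : Fin n =>
        if (j : ℕ) < i then (C (c j) : MvPolynomial (Fin n) k) else X j) ⊔
      span {X ⟨i, hi⟩ - C (c ⟨i, hi⟩)} := by
  set φ := aeval (R := k) fun j : Fin n =>
        if (j : ℕ) < i then (C (c j) : MvPolynomial (Fin n) k) else X j with hφ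
  set φ' := aeval (R := k) fun j : Fin n =>
        if (j : ℕ) < i + 1 then (C (c j) : MvPolynomial (Fin n) k) else X j with hφ'
  let ψ := aeval (R := k) fun j : Fin n =>
        if (j : ℕ) = i then (C (c j) : MvPolynomial (Fin n) k) else X j
  have hcomp : ∀ p, φ' p = ψ (φ p) := by
    intro p
    have : φ' = ψ.comp φ := by
      ext1 j
      simp only [φ, φ', ψ, AlgHom.comp_apply, aeval_X]
      by_cases h1 : (j : ℕ) < i
      · simp [h1, h1.trans (Nat.lt_succ_self i), ← algebraMap_eq]
      · by_cases h2 : (j : ℕ) = i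
        · simp [h2]
        · simp [h1, h2, show ¬ (j : ℕ) < i + 1 by omega]
    rw [this, AlgHom.comp_apply]
  have hidem : ∀ p, φ (φ p) = φ p := by
    intro p
    have : φ.comp φ = φ := by
      ext1 j
      simp only [φ, AlgHom.comp_apply, aeval_X]
      by_cases h1 : (j : ℕ) < i
      · simp [h1, ← algebraMap_eq]
      · simp [h1]
    rw [← AlgHom.comp_apply, this]
  have hψ : ∀ p, p - ψ p ∈ span {X ⟨i, hi⟩ - C (c ⟨i, hi⟩)} := by
    intro p
    let I : Ideal (MvPolynomial (Fin n) k) := span {X ⟨i, hi⟩ - C (c ⟨i, hi⟩)}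
    have : (Ideal.Quotient.mkₐ k I).comp ψ = Ideal.Quotient.mkₐ k I := by
      ext1 j
      simp only [ψ, AlgHom.comp_apply, aeval_X]
      split_ifs with h
      · obtain rfl : j = ⟨i, hi⟩ := Fin.ext h
        simp only [Ideal.Quotient.mkₐ_eq_mk]
        rw [Ideal.Quotient.eq, ← neg_mem_iff, neg_sub]
        exact mem_span_singleton_self _
      · rfl
    rw [← Ideal.Quotient.eq_zero_iff_mem (I := I), map_sub, sub_eq_zero]
    exact (DFunLike.congr_fun this p).symm
  refine le_antisymm (fun p hp => ?_) (sup_le (fun p hp => ?_) ?_)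
  · have h0 : ψ (φ p) = 0 := by rw [← hcomp]; exact hp
    have : p = (p - φ p) + (φ p - ψ (φ p)) := by rw [h0]; ring
    rw [this]
    refine add_mem (mem_sup_left ?_) (mem_sup_right (hψ _))
    rw [RingHom.mem_ker, map_sub, hidem, sub_self]
  · rw [RingHom.mem_ker] at hp ⊢
    rw [hcomp, hp, map_zero]
  · rw [span_singleton_le_iff_mem, RingHom.mem_ker]
    simp [φ', ← algebraMap_eq]

variable {R : Type*} [CommRing R] [Algebra (MvPolynomial (Fin n) k) R] [IsLocalRing R]

/-- The elements `X i - c i` form a regular sequence: the ideal generated by the first `i` of them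
is the kernel of a substitution with values in a domain, hence prime, and it does not contain the
next one. -/
theorem depthGE_localization_mvPolynomial (c : Fin n → k)
    [hM : (RingHom.ker (aeval (R := k) c)).IsPrime]
    [IsLocalization.AtPrime R (RingHom.ker (aeval (R := k) c))] :
    DepthGE n (⊥ : Ideal R) := by
  let K : ℕ → Ideal (MvPolynomial (Fin n) k) := fun i =>
    RingHom.ker (aeval (R := k) fun j : Fin n =>
        if (j : ℕ) < i then (C (c j) : MvPolynomial (Fin n) k) else X j)
  let M := RingHom.ker (aeval (R := k) c)
  have hprime : ∀ i, (K i).IsPrime := fun i => RingHom.ker_isPrime _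
  have hKM : ∀ i, K i ≤ M := by
    intro i p hp
    have : (aeval (R := k) c).comp (aeval (R := k) fun j : Fin n =>
        if (j : ℕ) < i then (C (c j) : MvPolynomial (Fin n) k) else X j) = aeval c := by
      ext1 j
      simp only [AlgHom.comp_apply, aeval_X]
      split_ifs <;> simp
    change aeval c p = 0
    rw [← this, AlgHom.comp_apply, show (aeval (R := k) fun j : Fin n =>
        if (j : ℕ) < i then (C (c j) : MvPolynomial (Fin n) k) else X j) p = 0 from hp, map_zero]
  have hdisj : ∀ i, Disjoint (M.primeCompl : Set (MvPolynomial (Fin n) k)) (K i) := by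
    intro i
    rw [Set.disjoint_left]
    exact fun p hp hp' => hp (hKM i hp')
  have key : ∀ m i, i + m = n → DepthGE m ((K i).map (algebraMap _ R)) := by
    intro m
    induction m with
    | zero => intros; trivial
    | succ m ih =>
      intro i him
      have hi : i < n := by omega
      refine ⟨algebraMap (MvPolynomial (Fin n) k) R (X ⟨i, hi⟩ - C (c ⟨i, hi⟩)), ?_, ?_, ?_⟩
      · rw [← IsLocalization.AtPrime.map_eq_maximalIdeal M R]
        refine mem_map_of_mem _ ?_
        change aeval c _ = 0
        simp
      · have hp : ((K i).map (algebraMap _ R)).IsPrime :=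
          IsLocalization.isPrime_of_isPrime_disjoint M.primeCompl R (K i) (hprime i) (hdisj i)
        intro u hu
        refine (hp.mem_or_mem hu).resolve_left fun h => ?_
        have : X ⟨i, hi⟩ - C (c ⟨i, hi⟩) ∈ K i := by
          rw [← IsLocalization.under_map_of_isPrime_disjoint M.primeCompl R (hprime i) (hdisj i)]
          exact h
        have h0 : (X ⟨i, hi⟩ - C (c ⟨i, hi⟩) : MvPolynomial (Fin n) k) = 0 := by
          have := (RingHom.mem_ker).1 this
          simpa [← algebraMap_eq] using this
        have := congrArg (eval fun _ => c ⟨i, hi⟩ + 1) h0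
        simp at this
      · have := ih (i + 1) (by omega)
        have hK : K (i + 1) = K i ⊔ span {X ⟨i, hi⟩ - C (c ⟨i, hi⟩)} := ker_partialEval_succ c i hi
        rwa [hK, Ideal.map_sup, map_span, Set.image_singleton] at this
  have h0 : K 0 = ⊥ := by
    rw [eq_bot_iff]
    intro p hp
    have : (aeval (R := k) fun j : Fin n =>
        if (j : ℕ) < 0 then (C (c j) : MvPolynomial (Fin n) k) else X j) p = p := by
      simp
    exact this.symm.trans hp
  have := key n 0 (by omega)
  rwa [h0, Ideal.map_bot] at this

/-- Macaulay's unmixedness theorem for curves in affine space that are complete intersections. -/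
theorem not_isColonPrime_of_span_range {m : ℕ} (hmn : m + 1 = n) (c : Fin n → k)
    (y : Fin m → MvPolynomial (Fin n) k) (hy : ∀ i, aeval c (y i) = 0)
    (hdim : ringKrullDim (MvPolynomial (Fin n) k ⧸ span (Set.range y)) ≤ 1) :
    ¬ IsColonPrime (span (Set.range y)) (RingHom.ker (aeval (R := k) c)) := by
  have hM : (RingHom.ker (aeval (R := k) c)).IsPrime := RingHom.ker_isPrime _
  set M := RingHom.ker (aeval (R := k) c) with hMdef
  set J := span (Set.range y) with hJ
  let R := Localization.AtPrime M
  let φ := algebraMap (MvPolynomial (Fin n) k) R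
  let x : ℕ → R := fun i => if h : i < m then φ (y ⟨i, h⟩) else 0
  have hx : ∀ i, x i ∈ maximalIdeal R := by
    intro i
    by_cases h : i < m
    · simp only [x, h, dif_pos]
      rw [← IsLocalization.AtPrime.map_eq_maximalIdeal M R]
      exact mem_map_of_mem _ (hy _)
    · simp [x, h]
  have hspan : (⊥ : Ideal R) ⊔ span (x '' Set.Iio m) = J.map φ := by
    rw [bot_sup_eq, hJ, map_span]
    congr 1
    ext r
    constructor
    · rintro ⟨i, hi, rfl⟩
      have hi : i < m := hi
      exact ⟨y ⟨i, hi⟩, ⟨_, rfl⟩, by simp [x, hi]⟩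
    · rintro ⟨_, ⟨i, rfl⟩, rfl⟩
      exact ⟨i, i.2, by simp [x]⟩
  have hdim' : ringKrullDim (R ⧸ J.map φ) ≤ (1 : ℕ) := by
    refine le_trans ?_ (hdim.trans (by simp))
    exact ringKrullDim_quotient_map_le M.primeCompl R J
  have hd : DepthGE 1 (J.map φ) := by
    have := DepthGE.quotient_of_ringKrullDim_le 1 x hx m ⊥ (by
      rw [add_comm, hmn]; exact depthGE_localization_mvPolynomial c) (by rwa [hspan])
    rwa [hspan] at this
  -- In the local ring `u` is killed by the maximal ideal modulo `J`; a nonzerodivisor in the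
  -- maximal ideal then forces `u` into `J` locally, that is, up to a factor `t` not vanishing at
  -- the point.
  rintro ⟨-, u, hu⟩
  obtain ⟨z, hz, hreg, -⟩ := hd
  have hzu : z * φ u ∈ J.map φ := by
    rw [← IsLocalization.AtPrime.map_eq_maximalIdeal M R] at hz
    have hle : M.map φ ≤ Submodule.comap (LinearMap.mulRight R (φ u)) (J.map φ) := by
      refine map_le_iff_le_comap.2 fun r hr => ?_
      change φ r * φ u ∈ J.map φ
      rw [← map_mul]
      exact mem_map_of_mem _ ((hu r).1 hr)
    exact hle hz
  obtain ⟨t, ht, htu⟩ :=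
    (IsLocalization.algebraMap_mem_map_algebraMap_iff M.primeCompl R J u).1 (hreg _ hzu)
  exact ht ((hu t).2 htu)

end PolynomialDepth

end TruncatedDeRham

/-! ### Points of an affine variety and the scheme structure of the fibres -/

namespace TruncatedDeRham

open Ideal IsLocalRing

section RegularLocal

variable {R : Type*} [CommRing R]

/-- Modulo `g` the maximal ideal is generated by `t`, so by Krull's intersection theorem an element
outside `(g)` is a unit times a power of `t` modulo `g`. If it were nilpotent modulo `g`, so would
be `t`, and the maximal ideal would be minimal over `(g)`, against Krull's height theorem. -/
theorem isRadical_span_singleton_of_maximalIdeal_eq [IsLocalRing R] [IsNoetherianRing R]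
    {g t : R} (hdim : 1 < ringKrullDim R) (ht : maximalIdeal R = span {g, t}) : (span {g}).IsRadical := by
  have hg : g ∈ maximalIdeal R := ht ▸ subset_span (by simp)
  have htm : t ∈ maximalIdeal R := ht ▸ subset_span (by simp)
  intro b ⟨k, hk⟩
  by_contra hb
  have key : ∀ j : ℕ, ∀ r : R, r ∈ maximalIdeal R ^ j → ∃ a, r - a * t ^ j ∈ span {g} := by
    intro j
    induction j with
    | zero => exact fun r _ => ⟨r, by simp⟩
    | succ j ih =>
      intro r hr
      rw [pow_succ] at hr
      refine Submodule.mul_induction_on hr (fun m hm n hn => ?_) (fun x y hx hy => ?_)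
      · obtain ⟨a, ha⟩ := ih m hm
        obtain ⟨c, d, hcd⟩ := mem_span_pair.1 (ht ▸ hn)
        obtain ⟨e, he⟩ := mem_span_singleton'.1 ha
        refine ⟨a * d, mem_span_singleton'.2 ⟨e * n + a * t ^ j * c, ?_⟩⟩
        linear_combination n * he + a * t ^ j * hcd
      · obtain ⟨a, ha⟩ := hx
        obtain ⟨a', ha'⟩ := hy
        refine ⟨a + a', ?_⟩
        convert add_mem ha ha' using 1
        ring
  have hmem : ∃ j, b ∉ span {g} ⊔ maximalIdeal R ^ j := by
    by_contra! hcon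
    have hT : IsLocalRing (R ⧸ span {g}) := by
      have : Nontrivial (R ⧸ span {g}) := Ideal.Quotient.nontrivial_iff.2
        (ne_top_of_le_ne_top (maximalIdeal.isMaximal R).ne_top
          ((span_singleton_le_iff_mem _).2 hg))
      exact .of_surjective' _ Ideal.Quotient.mk_surjective
    have hne : (maximalIdeal R).map (Ideal.Quotient.mk (span {g})) ≠ ⊤ := by
      intro h
      have := congrArg (Ideal.comap (Ideal.Quotient.mk (span {g}))) h
      rw [comap_map_of_surjective' _ Ideal.Quotient.mk_surjective, comap_top, mk_ker,
        sup_eq_left.2 ((span_singleton_le_iff_mem _).2 hg)] at this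
      exact (maximalIdeal.isMaximal R).ne_top this
    have h0 := Ideal.iInf_pow_eq_bot_of_isLocalRing _ hne
    have : Ideal.Quotient.mk (span {g}) b ∈
        ⨅ i, (maximalIdeal R).map (Ideal.Quotient.mk (span {g})) ^ i := by
      rw [Submodule.mem_iInf]
      intro i
      rw [← Ideal.map_pow]
      obtain ⟨c, hc, d, hd, hcd⟩ := Submodule.mem_sup.1 (hcon i)
      rw [← hcd, map_add, Ideal.Quotient.eq_zero_iff_mem.2 hc, zero_add]
      exact mem_map_of_mem _ hd
    rw [h0, Submodule.mem_bot, Ideal.Quotient.eq_zero_iff_mem] at this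
    exact hb this
  classical
  let j := Nat.find hmem
  have hj : b ∉ span {g} ⊔ maximalIdeal R ^ j := Nat.find_spec hmem
  have hj0 : j ≠ 0 := by
    intro h
    rw [h] at hj
    exact hj (by simp)
  obtain ⟨i, hi⟩ := Nat.exists_eq_succ_of_ne_zero hj0
  have hi' : b ∈ span {g} ⊔ maximalIdeal R ^ i := by
    by_contra h
    have := Nat.find_min' hmem h
    omega
  obtain ⟨c, hc, d, hd, hcd⟩ := Submodule.mem_sup.1 hi'
  obtain ⟨a, ha⟩ := key i d hd
  have hau : IsUnit a := by
    by_contra hau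
    have ham : a ∈ maximalIdeal R := hau
    refine hj ?_
    have : b = (c + (d - a * t ^ i)) + a * t ^ i := by rw [← hcd]; ring
    rw [this]
    refine add_mem (mem_sup_left (add_mem hc ha)) (mem_sup_right ?_)
    rw [hi, Nat.succ_eq_add_one, pow_succ']
    exact Ideal.mul_mem_mul ham (Ideal.pow_mem_pow htm i)
  have hat : a * t ^ i ∈ (span {g}).radical := by
    have : a * t ^ i = b - (c + (d - a * t ^ i)) := by rw [← hcd]; ring
    rw [this]
    exact sub_mem ⟨k, hk⟩ (le_radical (add_mem hc ha))
  have hti : t ∈ (span {g}).radical := by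
    obtain ⟨l, hl⟩ := (Ideal.unit_mul_mem_iff_mem _ hau).1 hat
    exact ⟨i * l, by rwa [pow_mul]⟩
  have hmin : maximalIdeal R ∈ (span {g}).minimalPrimes := by
    refine ⟨⟨inferInstance, (span_singleton_le_iff_mem _).2 hg⟩, fun q hq _ => ?_⟩
    rw [ht, span_le]
    rintro r (rfl | rfl)
    · exact hq.2 (mem_span_singleton_self _)
    · exact (hq.1.radical_le_iff.2 hq.2) hti
  have h1 := Ideal.height_le_one_of_isPrincipal_of_mem_minimalPrimes _ _ hmin
  rw [← IsLocalRing.maximalIdeal_height_eq_ringKrullDim] at hdim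
  exact absurd hdim (not_lt.2 (by exact_mod_cast h1))

/-- Since `g ∉ 𝔪²`, one of its coefficients with respect to a pair of generators of `𝔪` is a unit,
so `g` can replace that generator. The clause `t = 0` covers dimension at most `1`, where `g` alone
generates `𝔪`. -/
theorem exists_maximalIdeal_eq_span_pair [IsRegularLocalRing R] (hdim : ringKrullDim R ≤ 2) {g : R}
    (hg : g ∈ maximalIdeal R) (hg2 : g ∉ maximalIdeal R ^ 2) :
    ∃ t, maximalIdeal R = span {g, t} ∧ (ringKrullDim R ≤ 1 → t = 0) := by
  classical
  have hreg := IsRegularLocalRing.spanFinrank_maximalIdeal (R := R)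
  obtain ⟨s, hs, hspan⟩ :=
    (IsNoetherian.noetherian (maximalIdeal R)).exists_span_finset_card_eq_spanFinrank
  rw [← hs] at hreg
  have hcard : s.card ≤ 2 := by exact_mod_cast hreg.trans_le hdim
  have hpair : ∃ t₁ t₂, maximalIdeal R = span {t₁, t₂} ∧ (ringKrullDim R ≤ 1 → t₂ = 0) := by
    interval_cases h : s.card
    · rw [Finset.card_eq_zero] at h
      exact ⟨0, 0, by rw [← hspan, h]; simp, fun _ => rfl⟩
    · obtain ⟨t, rfl⟩ := Finset.card_eq_one.1 h
      exact ⟨t, 0, by rw [← hspan, Set.pair_comm, span_insert_zero]; simp [Ideal.span],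
        fun _ => rfl⟩
    · obtain ⟨t₁, t₂, -, rfl⟩ := Finset.card_eq_two.1 h
      refine ⟨t₁, t₂, by rw [← hspan]; simp [Ideal.span], fun h1 => ?_⟩
      rw [← hreg] at h1
      exact absurd h1 (by norm_num)
  obtain ⟨t₁, t₂, hm, ht⟩ := hpair
  have ht₁ : t₁ ∈ maximalIdeal R := hm ▸ subset_span (by simp)
  have ht₂ : t₂ ∈ maximalIdeal R := hm ▸ subset_span (by simp)
  obtain ⟨a, b, hab⟩ := mem_span_pair.1 (hm ▸ hg)
  by_cases ha : IsUnit a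
  · obtain ⟨u, rfl⟩ := ha
    refine ⟨t₂, le_antisymm ?_ ?_, ht⟩
    · rw [hm, span_le]
      rintro r (rfl | rfl)
      · refine mem_span_pair.2 ⟨(u⁻¹ : Rˣ), -(u⁻¹ : Rˣ) * b, ?_⟩
        rw [← hab]
        linear_combination r * u.inv_mul
      · exact subset_span (by simp)
    · rw [span_le]
      rintro r (rfl | rfl)
      exacts [hg, ht₂]
  · have hb : IsUnit b := by
      by_contra hb
      refine hg2 (hab ▸ ?_)
      rw [pow_two]
      exact add_mem (Ideal.mul_mem_mul ha ht₁) (Ideal.mul_mem_mul hb ht₂)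
    obtain ⟨u, rfl⟩ := hb
    have hm' : maximalIdeal R = span {g, t₁} := by
      refine le_antisymm ?_ ?_
      · rw [hm, span_le]
        rintro r (rfl | rfl)
        · exact subset_span (by simp)
        · refine mem_span_pair.2 ⟨(u⁻¹ : Rˣ), -(u⁻¹ : Rˣ) * a, ?_⟩
          rw [← hab]
          linear_combination r * u.inv_mul
      · rw [span_le]
        rintro r (rfl | rfl)
        exacts [hg, ht₁]
    by_cases h1 : ringKrullDim R ≤ 1
    · exfalso
      refine hg2 ?_
      rw [← hab, ht h1, mul_zero, add_zero, pow_two]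
      exact Ideal.mul_mem_mul ha ht₁
    · exact ⟨t₁, hm', fun h => absurd h h1⟩

/-- In a regular local ring of dimension at most `2`, an element of `𝔪 ∖ 𝔪²` generates a radical
ideal. -/
theorem isRadical_span_singleton_of_notMem_sq [IsRegularLocalRing R]
    (hdim : ringKrullDim R ≤ 2) {g : R} (hg : g ∈ maximalIdeal R)
    (hg2 : g ∉ maximalIdeal R ^ 2) : (span {g}).IsRadical := by
  obtain ⟨t, hm, ht⟩ := exists_maximalIdeal_eq_span_pair hdim hg hg2
  by_cases h1 : ringKrullDim R ≤ 1
  · rw [ht h1, Set.pair_comm, span_insert_zero] at hm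
    rw [← hm]
    exact (maximalIdeal.isMaximal R).isPrime.isRadical
  · exact isRadical_span_singleton_of_maximalIdeal_eq (not_le.1 h1) hm

end RegularLocal

/-! ### Closed points and dimension -/

section Points

universe u

variable {A : Type u} [CommRing A] [Algebra ℂ A]

theorem exists_point_of_isMaximal [Algebra.FiniteType ℂ A] (m : Ideal A) [hm : m.IsMaximal] :
    ∃ x : A →ₐ[ℂ] ℂ, RingHom.ker x = m := by
  let _ := Ideal.Quotient.field m
  have : Algebra.FiniteType ℂ (A ⧸ m) :=
    .of_surjective (Ideal.Quotient.mkₐ ℂ m) Ideal.Quotient.mk_surjective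
  have : Module.Finite ℂ (A ⧸ m) := finite_of_finite_type_of_isJacobsonRing ℂ (A ⧸ m)
  let e : ℂ ≃ₐ[ℂ] A ⧸ m := AlgEquiv.ofBijective (Algebra.ofId ℂ (A ⧸ m))
    IsAlgClosed.algebraMap_bijective_of_isIntegral
  refine ⟨e.symm.toAlgHom.comp (Ideal.Quotient.mkₐ ℂ m), ?_⟩
  ext a
  simp [RingHom.mem_ker, Ideal.Quotient.eq_zero_iff_mem]

theorem isMaximal_ker_point (x : A →ₐ[ℂ] ℂ) : (RingHom.ker x).IsMaximal :=
  RingHom.ker_isMaximal_of_surjective _ fun c => ⟨algebraMap ℂ A c, by simp⟩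

/-- A non-maximal prime is the intersection of the points of its zero set outside any given
finite set. -/
theorem exists_point_notMem_of_not_isMaximal [Algebra.FiniteType ℂ A] {p : Ideal A} [hp : p.IsPrime]
    (hpm : ¬ p.IsMaximal) {Z : Set (A →ₐ[ℂ] ℂ)} (hZ : Z.Finite) {b : A} (hb : b ∉ p) :
    ∃ x : A →ₐ[ℂ] ℂ, p ≤ RingHom.ker x ∧ x b ≠ 0 ∧ x ∉ Z := by
  classical
  have hex : ∀ z : A →ₐ[ℂ] ℂ, ∃ a : A, z a = 0 ∧ a ∉ p := by
    intro z
    by_contra! h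
    have hz := isMaximal_ker_point z
    exact hpm (hz.eq_of_le hp.ne_top (fun a ha => h a ha) ▸ hz)
  choose a ha0 hap using hex
  -- The function `h` vanishes on `Z` and is not in `p`, so a point over `p` with `b * h` nonzero,
  -- which exists by the Jacobson property, avoids `Z`.
  let h : A := ∏ z ∈ hZ.toFinset, a z
  have hh : h ∉ p := by
    intro hmem
    obtain ⟨z, -, hz⟩ := hp.prod_mem_iff.1 hmem
    exact hap z hz
  have hbh : b * h ∉ p := fun hmem => (hp.mem_or_mem hmem).elim hb hh
  have hJ : IsJacobsonRing A := isJacobsonRing_of_finiteType (A := ℂ)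
  have hpj : p.jacobson = p := hJ.out hp.isRadical
  rw [← hpj, Ideal.jacobson, Submodule.mem_sInf] at hbh
  push Not at hbh
  obtain ⟨m, ⟨hpm', hm⟩, hbm⟩ := hbh
  obtain ⟨x, rfl⟩ := exists_point_of_isMaximal m
  have hx : x b * x h ≠ 0 := by
    rw [← map_mul]
    exact hbm
  refine ⟨x, hpm', left_ne_zero_of_mul hx, fun hxZ => right_ne_zero_of_mul hx ?_⟩
  rw [map_prod]
  exact Finset.prod_eq_zero (hZ.mem_toFinset.2 hxZ) (ha0 x)

theorem ringKrullDim_le_of_minimalPrimes {B : Type*} [CommRing B] {d : ℕ}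
    (h : ∀ p ∈ minimalPrimes B, ringKrullDim (B ⧸ p) ≤ d) : ringKrullDim B ≤ d := by
  refine iSup_le fun l => ?_
  have := l.head.2
  obtain ⟨p, hp, hle⟩ := Ideal.exists_minimalPrimes_le (I := ⊥) (J := l.head.asIdeal) bot_le
  refine le_trans ?_ (h p hp)
  have hl : ∀ i, p ≤ (l i).asIdeal := fun i => hle.trans (l.monotone (Fin.zero_le i))
  rw [ringKrullDim_quotient]
  let l' : LTSeries (PrimeSpectrum.zeroLocus (p : Set B)) :=
    { length := l.length
      toFun := fun i => ⟨l i, hl i⟩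
      step := fun i => l.step i }
  exact Order.LTSeries.length_le_krullDim l'

theorem aeval_notMem_minimalPrimes {f : A} (hf : IsDominant f) {q : Polynomial ℂ} (hq : q ≠ 0)
    {p : Ideal A} (hp : p ∈ minimalPrimes A) : Polynomial.aeval f q ∉ p := by
  intro h
  refine hf p hp ⟨q, hq, ?_⟩
  rw [← Ideal.Quotient.mkₐ_eq_mk ℂ, Polynomial.aeval_algHom_apply, Ideal.Quotient.mkₐ_eq_mk,
    Ideal.Quotient.eq_zero_iff_mem]
  exact h

theorem aeval_mem_nonZeroDivisors [IsReduced A] {f : A} (hf : IsDominant f) {q : Polynomial ℂ}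
    (hq : q ≠ 0) : Polynomial.aeval f q ∈ nonZeroDivisors A := by
  rw [mem_nonZeroDivisors_iff_right]
  intro a ha
  have : a ∈ sInf (minimalPrimes A) := by
    rw [Submodule.mem_sInf]
    intro p hp
    have := hp.1.1
    have h0 : a * Polynomial.aeval f q ∈ p := ha ▸ zero_mem _
    exact (hp.1.1.mem_or_mem h0).resolve_right (aeval_notMem_minimalPrimes hf hq hp)
  have h2 : sInf (minimalPrimes A) = nilradical A := Ideal.sInf_minimalPrimes (I := ⊥)
  rw [h2, nilradical_eq_zero] at this
  exact this

theorem sub_algebraMap_mem_nonZeroDivisors [IsReduced A] {f : A} (hf : IsDominant f) (y : ℂ) :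
    f - algebraMap ℂ A y ∈ nonZeroDivisors A := by
  have := aeval_mem_nonZeroDivisors hf (Polynomial.X_sub_C_ne_zero y)
  simpa using this

theorem ringKrullDim_quotient_span_le {B : Type*} [CommRing B] {d : ℕ} (hdim : ringKrullDim B ≤ (d + 1 : ℕ)) {g : B}
    (hg : g ∈ nonZeroDivisors B) : ringKrullDim (B ⧸ span {g}) ≤ d := by
  have h := (ringKrullDim_quotient_succ_le_of_nonZeroDivisor hg).trans hdim
  push_cast at h
  exact ENat.WithBot.add_le_add_one_right_iff.1 h

end Points

end TruncatedDeRham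

/-! ### Local presentations and the absence of embedded points -/

namespace TruncatedDeRham

open Ideal IsLocalRing

open scoped KaehlerDifferential

theorem ringKrullDim_quotient_eq_of_ker_eq {P T : Type*} [CommRing P] [CommRing T] (φ : P →+* T)
    (hφ : Function.Surjective φ) {I : Ideal P} (hI : I = RingHom.ker φ) :
    ringKrullDim (P ⧸ I) = ringKrullDim T := by
  subst hI
  exact ringKrullDim_eq_of_ringEquiv (RingHom.quotientKerEquivOfSurjective hφ)

theorem exists_pow_mul_eq_algebraMap {A Q : Type*} [CommRing A] [CommRing Q] [Algebra A Q] (w : A)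
    [IsLocalization.Away w Q] (q : Q) : ∃ (k : ℕ) (a : A),
    algebraMap A Q w ^ k * q = algebraMap A Q a := by
  obtain ⟨⟨a, ⟨_, k, rfl⟩⟩, h⟩ := IsLocalization.surj (Submonoid.powers w) q
  exact ⟨k, a, by rw [← h]; simp [mul_comm]⟩

theorem algebraMap_mem_span_iff {A Q : Type*} [CommRing A] [CommRing Q] [Algebra A Q] {w : A}
    [IsLocalization.Away w Q] {g a : A} :
    algebraMap A Q a ∈ span {algebraMap A Q g} ↔ ∃ k : ℕ, w ^ k * a ∈ span {g} := by
  have := IsLocalization.algebraMap_mem_map_algebraMap_iff (Submonoid.powers w) Q (span {g}) a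
  rw [map_span, Set.image_singleton] at this
  rw [this]
  constructor
  · rintro ⟨_, ⟨k, rfl⟩, h⟩
    exact ⟨k, h⟩
  · rintro ⟨k, h⟩
    exact ⟨_, ⟨k, rfl⟩, h⟩

section LocalPresentation

universe u

variable {A : Type u} [CommRing A] [Algebra ℂ A]

/-- An elimination form of the hypothesis: the quotient of the polynomial ring is itself made a
localization `Q` of `A`, so that only the two maps `A → Q` and `π` remain, without an isomorphism
between them. -/
theorem IsLocallyCompleteIntersection.elim {d : ℕ} (h : IsLocallyCompleteIntersection A d)
    (x₀ : A →ₐ[ℂ] ℂ) {motive : Prop}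
    (H : ∀ (w : A), x₀ w ≠ 0 → ∀ (c : ℕ) (r : Fin c → MvPolynomial (Fin (c + d)) ℂ)
      (Q : Type) [CommRing Q] [Algebra ℂ Q] [Algebra A Q] [IsScalarTower ℂ A Q]
      [IsLocalization.Away w Q] (π : MvPolynomial (Fin (c + d)) ℂ →ₐ[ℂ] Q),
      Function.Surjective π → RingHom.ker π = span (Set.range r) → motive) : motive := by
  obtain ⟨w, hw, n, c, r, rfl, ⟨e⟩⟩ := h x₀
  let Q := MvPolynomial (Fin (c + d)) ℂ ⧸ span (Set.range r)
  let _ : Algebra A Q := ((e : Localization.Away w →+* Q).comp (algebraMap A _)).toAlgebra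
  have hst : IsScalarTower ℂ A Q := .of_algebraMap_eq fun z => by
    change _ = e (algebraMap A (Localization.Away w) (algebraMap ℂ A z))
    rw [← IsScalarTower.algebraMap_apply ℂ A (Localization.Away w), e.commutes]
  let e' : Localization.Away w ≃ₐ[A] Q := AlgEquiv.ofRingEquiv (f := e.toRingEquiv) fun a => rfl
  have hloc : IsLocalization.Away w Q := IsLocalization.isLocalization_of_algEquiv _ e'
  exact H w hw c r Q (Ideal.Quotient.mkₐ ℂ _) Ideal.Quotient.mk_surjective
    (Ideal.Quotient.mkₐ_ker ℂ _)

variable {w : A} {Q : Type*} [CommRing Q] [Algebra ℂ Q] [Algebra A Q] [IsScalarTower ℂ A Q]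
  [IsLocalization.Away w Q]

theorem exists_point_localization (x₀ : A →ₐ[ℂ] ℂ) (hw : x₀ w ≠ 0) :
    ∃ z : Q →ₐ[ℂ] ℂ, ∀ a, z (algebraMap A Q a) = x₀ a := by
  have hu : ∀ y : Submonoid.powers w, IsUnit (x₀ y) := by
    rintro ⟨_, k, rfl⟩
    simp [hw]
  exact ⟨IsLocalization.liftAlgHom (M := Submonoid.powers w) hu, fun a =>
    IsLocalization.lift_eq (M := Submonoid.powers w) (g := (x₀ : A →+* ℂ)) hu a⟩

variable {c : ℕ} {r : Fin c → MvPolynomial (Fin (c + 2)) ℂ}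
  {π : MvPolynomial (Fin (c + 2)) ℂ →ₐ[ℂ] Q}

/-- On a surface that is locally a complete intersection, a curve given by one equation has no
embedded points. -/
theorem not_isColonPrime_ker_point (hπ : Function.Surjective π)
    (hker : RingHom.ker π = span (Set.range r)) (x₀ : A →ₐ[ℂ] ℂ) (hw : x₀ w ≠ 0) {g : A}
    (hg : x₀ g = 0) (hdim : ringKrullDim (A ⧸ span {g}) ≤ 1) :
    ¬ IsColonPrime (span {g}) (RingHom.ker x₀) := by
  obtain ⟨z, hz⟩ := exists_point_localization (w := w) (Q := Q) x₀ hw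
  obtain ⟨G, hG⟩ := hπ (algebraMap A Q g)
  let pt : Fin (c + 2) → ℂ := fun j => z (π (MvPolynomial.X j))
  have hpt : ∀ p, MvPolynomial.aeval pt p = z (π p) := by
    intro p
    have : MvPolynomial.aeval pt = z.comp π := by
      ext j
      simp [pt]
    rw [this, AlgHom.comp_apply]
  -- The equation of the curve joins the `c` equations of the surface: `c + 1` equations in `c + 2`
  -- variables, as the unmixedness theorem requires.
  let y : Fin (c + 1) → MvPolynomial (Fin (c + 2)) ℂ := Fin.cons G r
  have hspan : span (Set.range y) =
      RingHom.ker ((Ideal.Quotient.mk (span {algebraMap A Q g})).comp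
        (π : MvPolynomial (Fin (c + 2)) ℂ →+* Q)) := by
    rw [Fin.range_cons, span_insert, ← hker]
    ext p
    rw [RingHom.mem_ker, RingHom.comp_apply, Ideal.Quotient.eq_zero_iff_mem]
    constructor
    · intro hp
      obtain ⟨a, ha, b, hb, rfl⟩ := Submodule.mem_sup.1 hp
      obtain ⟨a', rfl⟩ := mem_span_singleton'.1 ha
      have hb' : π b = 0 := hb
      simpa [hb', hG] using Ideal.mul_mem_left _ _ (mem_span_singleton_self _)
    · intro hp
      obtain ⟨q, hq⟩ := mem_span_singleton'.1 hp
      obtain ⟨q', rfl⟩ := hπ q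
      have hq : π q' * algebraMap A Q g = π p := hq
      have : p = q' * G + (p - q' * G) := by ring
      rw [this]
      refine add_mem (mem_sup_left (mem_span_singleton'.2 ⟨q', rfl⟩)) (mem_sup_right ?_)
      rw [RingHom.mem_ker, map_sub, map_mul, hG, hq, sub_self]
  have hmem : ∀ p, p ∈ span (Set.range y) ↔ π p ∈ span {algebraMap A Q g} := by
    intro p
    rw [hspan, RingHom.mem_ker, RingHom.comp_apply, Ideal.Quotient.eq_zero_iff_mem]
    rfl
  have hdim' : ringKrullDim (MvPolynomial (Fin (c + 2)) ℂ ⧸ span (Set.range y)) ≤ 1 := by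
    have h1 := ringKrullDim_quotient_map_le (Submonoid.powers w) Q (span {g})
    rw [map_span, Set.image_singleton] at h1
    have hsurj : Function.Surjective
        ((Ideal.Quotient.mk (span {algebraMap A Q g})).comp
          (π : MvPolynomial (Fin (c + 2)) ℂ →+* Q)) := by
      rw [RingHom.coe_comp]
      exact Ideal.Quotient.mk_surjective.comp (by simpa using hπ)
    rw [ringKrullDim_quotient_eq_of_ker_eq _ hsurj hspan]
    exact h1.trans hdim
  have hnot := not_isColonPrime_of_span_range (m := c + 1) (n := c + 2) rfl pt y (by
    intro i
    rw [hpt]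
    have hi : π (y i) ∈ span {algebraMap A Q g} := (hmem _).1 (subset_span ⟨i, rfl⟩)
    obtain ⟨q, hq⟩ := mem_span_singleton'.1 hi
    rw [← hq, map_mul, hz, hg, mul_zero]) hdim'
  rintro ⟨-, u, hu⟩
  obtain ⟨U, hU⟩ := hπ (algebraMap A Q u)
  refine hnot ⟨RingHom.ker_isPrime _, U, fun p => ?_⟩
  -- The colon conditions in the polynomial ring and in `A` are compared after clearing powers of
  -- `w`, which are harmless because `w` does not vanish at `x₀`.
  obtain ⟨k, a, ha⟩ := exists_pow_mul_eq_algebraMap w (π p)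
  have hwu : IsUnit (algebraMap A Q w ^ k) :=
    (IsLocalization.Away.algebraMap_isUnit w).pow k
  have h1 : p ∈ RingHom.ker (MvPolynomial.aeval (R := ℂ) pt) ↔ x₀ a = 0 := by
    rw [RingHom.mem_ker, hpt, ← hz, ← ha, map_mul, map_pow, hz, mul_eq_zero]
    simp [hw]
  have h2 : p * U ∈ span (Set.range y) ↔ ∃ j : ℕ, w ^ j * (a * u) ∈ span {g} := by
    rw [hmem, map_mul, hU, ← algebraMap_mem_span_iff (Q := Q), map_mul, ← ha, mul_assoc,
      Ideal.unit_mul_mem_iff_mem _ hwu]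
  rw [h1, h2]
  constructor
  · intro h
    exact ⟨0, by simpa using (hu a).1 h⟩
  · rintro ⟨j, hj⟩
    have : w ^ j * a ∈ RingHom.ker x₀ := (hu _).2 (by rwa [mul_assoc])
    rw [RingHom.mem_ker, map_mul, map_pow, mul_eq_zero] at this
    exact this.resolve_left (pow_ne_zero _ hw)

end LocalPresentation

end TruncatedDeRham

/-! ### Regular parameters off `Sing(f)` and differentials of a presented algebra -/

namespace TruncatedDeRham

open Ideal IsLocalRing

open scoped KaehlerDifferential

section Smooth

universe u

variable {A : Type u} [CommRing A] [Algebra ℂ A]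

theorem D_mem_smul_of_mem_sq {m : Ideal A} {a : A} (ha : a ∈ m ^ 2) :
    KaehlerDifferential.D ℂ A a ∈ m • (⊤ : Submodule A (Ω[A⁄ℂ])) := by
  rw [pow_two] at ha
  refine Submodule.mul_induction_on ha (fun b hb c hc => ?_) (fun b c hb hc => ?_)
  · rw [Derivation.leibniz]
    exact add_mem (Submodule.smul_mem_smul hb trivial) (Submodule.smul_mem_smul hc trivial)
  · rw [map_add]
    exact add_mem hb hc

theorem D_sub_algebraMap (f : A) (y : ℂ) :
    KaehlerDifferential.D ℂ A (f - algebraMap ℂ A y) = KaehlerDifferential.D ℂ A f := by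
  simp

/-- At a point off `Sing(f)` the local ring of `X` is regular with `f - y` part of a system of
parameters. -/
theorem notMem_sq_of_notMem_sing {f : A} {x : A →ₐ[ℂ] ℂ} (hx : x ∉ sing f)
    [(RingHom.ker x).IsPrime] :
    algebraMap A (Localization.AtPrime (RingHom.ker x)) (f - algebraMap ℂ A (x f)) ∉
      maximalIdeal (Localization.AtPrime (RingHom.ker x)) ^ 2 := by
  set m := RingHom.ker x with hm
  set g := f - algebraMap ℂ A (x f) with hg
  intro hmem
  rw [← IsLocalization.AtPrime.map_eq_maximalIdeal m, ← Ideal.map_pow,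
    IsLocalization.algebraMap_mem_map_algebraMap_iff m.primeCompl] at hmem
  obtain ⟨v, hv, hvg⟩ := hmem
  have hxv : x v ≠ 0 := hv
  refine hx (Or.inr ?_)
  have hgm : g ∈ m := by simp [hm, hg, RingHom.mem_ker]
  -- Differentiating `v * g ∈ m ^ 2` gives `v • df ∈ m Ω`, since `g ∈ m`; then `v` may be replaced
  -- by its nonzero value at `x`.
  have h1 := D_mem_smul_of_mem_sq hvg
  rw [Derivation.leibniz, D_sub_algebraMap] at h1
  have h2 : v • KaehlerDifferential.D ℂ A f ∈ m • (⊤ : Submodule A (Ω[A⁄ℂ])) := by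
    have := sub_mem h1 (Submodule.smul_mem_smul hgm
      (Submodule.mem_top (x := KaehlerDifferential.D ℂ A v)))
    simpa using this
  have hvm : v - algebraMap ℂ A (x v) ∈ m := by simp [hm, RingHom.mem_ker]
  have h3 : algebraMap ℂ A (x v) • KaehlerDifferential.D ℂ A f ∈
      m • (⊤ : Submodule A (Ω[A⁄ℂ])) := by
    have := sub_mem h2 (Submodule.smul_mem_smul hvm
      (Submodule.mem_top (x := KaehlerDifferential.D ℂ A f)))
    rwa [← sub_smul, sub_sub_cancel] at this
  have h4 := Submodule.smul_mem _ (algebraMap ℂ A (x v)⁻¹) h3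
  rwa [smul_smul, ← map_mul, inv_mul_cancel₀ hxv, map_one, one_smul] at h4

theorem ringKrullDim_localization_ker_le {d : ℕ} (hdim : ringKrullDim A ≤ d) (x : A →ₐ[ℂ] ℂ)
    [(RingHom.ker x).IsPrime] :
    ringKrullDim (Localization.AtPrime (RingHom.ker x)) ≤ d := by
  rw [IsLocalization.AtPrime.ringKrullDim_eq_height (RingHom.ker x)]
  exact Ideal.height_le_ringKrullDim_of_isPrime.trans hdim

theorem algebraMap_mem_maximalIdeal {x : A →ₐ[ℂ] ℂ} [(RingHom.ker x).IsPrime] {a : A}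
    (ha : x a = 0) : algebraMap A (Localization.AtPrime (RingHom.ker x)) a ∈
      maximalIdeal (Localization.AtPrime (RingHom.ker x)) := by
  rw [← IsLocalization.AtPrime.map_eq_maximalIdeal (RingHom.ker x)]
  exact mem_map_of_mem _ ha

/-- Off `Sing(f)` the equation of the fibre generates a radical ideal in the regular local ring;
clearing a denominator `v` brings the membership back to `A`. -/
theorem exists_mul_mem_span_of_notMem_sing (hdim : ringKrullDim A ≤ 2) {f : A} {x : A →ₐ[ℂ] ℂ}
    (hx : x ∉ sing f) {b : A} (hb : b ∈ (span {f - algebraMap ℂ A (x f)}).radical) :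
    ∃ v, x v ≠ 0 ∧ v * b ∈ span {f - algebraMap ℂ A (x f)} := by
  have hprime : (RingHom.ker x).IsPrime := RingHom.ker_isPrime x
  have hreg : IsRegularLocalRing (Localization.AtPrime (RingHom.ker x)) := by
    by_contra h
    exact hx (Or.inl h)
  set g := f - algebraMap ℂ A (x f) with hg
  have hrad := isRadical_span_singleton_of_notMem_sq (ringKrullDim_localization_ker_le hdim x)
    (algebraMap_mem_maximalIdeal (a := g) (by simp [hg])) (notMem_sq_of_notMem_sing hx)
  have hmap : ∀ a, algebraMap A (Localization.AtPrime (RingHom.ker x)) a ∈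
      span {algebraMap A (Localization.AtPrime (RingHom.ker x)) g} ↔
      ∃ v ∈ (RingHom.ker x).primeCompl, v * a ∈ span {g} := by
    intro a
    rw [← IsLocalization.algebraMap_mem_map_algebraMap_iff _
      (Localization.AtPrime (RingHom.ker x)), map_span, Set.image_singleton]
  obtain ⟨k, hk⟩ := hb
  have : algebraMap A (Localization.AtPrime (RingHom.ker x)) b ∈
      span {algebraMap A (Localization.AtPrime (RingHom.ker x)) g} :=
    hrad ⟨k, by rw [← map_pow]; exact (hmap _).2 ⟨1, Submonoid.one_mem _, by simpa using hk⟩⟩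
  obtain ⟨v, hv, hvb⟩ := (hmap b).1 this
  exact ⟨v, hv, hvb⟩

/-- The equation of the fibre together with one more element generates the maximal ideal of the
local ring; `t` is that element freed of its denominator. -/
theorem exists_parameter_of_notMem_sing (hdim : ringKrullDim A ≤ 2) {f : A} {x : A →ₐ[ℂ] ℂ}
    (hx : x ∉ sing f) : ∃ t, x t = 0 ∧ ∀ a, x a = 0 →
      ∃ v, x v ≠ 0 ∧ v * a ∈ span {f - algebraMap ℂ A (x f), t} := by
  have hprime : (RingHom.ker x).IsPrime := RingHom.ker_isPrime x
  have hreg : IsRegularLocalRing (Localization.AtPrime (RingHom.ker x)) := by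
    by_contra h
    exact hx (Or.inl h)
  set g := f - algebraMap ℂ A (x f) with hg
  obtain ⟨t, hm, -⟩ := exists_maximalIdeal_eq_span_pair (ringKrullDim_localization_ker_le hdim x)
    (algebraMap_mem_maximalIdeal (a := g) (by simp [hg])) (notMem_sq_of_notMem_sing hx)
  obtain ⟨t₀, s, rfl⟩ := IsLocalization.exists_mk'_eq (RingHom.ker x).primeCompl t
  have hst : maximalIdeal (Localization.AtPrime (RingHom.ker x)) =
      (span {g, t₀}).map (algebraMap A _) := by
    rw [hm, map_span, Set.image_pair, span_insert, span_insert]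
    congr 1
    have hu := IsLocalization.map_units (Localization.AtPrime (RingHom.ker x)) s
    have hspec := IsLocalization.mk'_spec (Localization.AtPrime (RingHom.ker x)) t₀ s
    refine le_antisymm ?_ ?_ <;> rw [span_singleton_le_span_singleton, ← hspec]
    · exact hu.mul_right_dvd.2 dvd_rfl
    · exact dvd_mul_right _ _
  refine ⟨t₀, ?_, fun a ha => ?_⟩
  · have : algebraMap A (Localization.AtPrime (RingHom.ker x)) t₀ ∈ maximalIdeal _ := by
      rw [hst]
      exact mem_map_of_mem _ (subset_span (by simp))
    exact (IsLocalization.AtPrime.to_map_mem_maximal_iff _ (RingHom.ker x) t₀).1 this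
  · have := algebraMap_mem_maximalIdeal ha
    rw [hst, IsLocalization.algebraMap_mem_map_algebraMap_iff (RingHom.ker x).primeCompl] at this
    obtain ⟨v, hv, h⟩ := this
    exact ⟨v, hv, h⟩

end Smooth

section Presentation

variable {Q : Type*} [CommRing Q] [Algebra ℂ Q] {n c : ℕ} {r : Fin c → MvPolynomial (Fin n) ℂ}
  {π : MvPolynomial (Fin n) ℂ →ₐ[ℂ] Q}

theorem D_map_eq_sum (p : MvPolynomial (Fin n) ℂ) :
    KaehlerDifferential.D ℂ Q (π p) = ∑ j, π (MvPolynomial.pderiv j p) •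
      KaehlerDifferential.D ℂ Q (π (MvPolynomial.X j)) := by
  induction p using MvPolynomial.induction_on with
  | C a =>
    rw [← MvPolynomial.algebraMap_eq, AlgHom.commutes]
    simp
  | add p q hp hq => simp only [map_add, hp, hq, add_smul, Finset.sum_add_distrib]
  | mul_X p i hp =>
    rw [map_mul, Derivation.leibniz, hp]
    simp only [Derivation.leibniz, MvPolynomial.pderiv_X, smul_eq_mul, map_add, map_mul, add_smul,
      Finset.sum_add_distrib, Finset.smul_sum, mul_smul]
    congr 1
    rw [Finset.sum_eq_single i]
    · simp
    · intro j _ hj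
      simp [Pi.single_eq_of_ne hj.symm]
    · simp

theorem exists_eq_sum_smul_D (hπ : Function.Surjective π) (ω : Ω[Q⁄ℂ]) :
    ∃ q : Fin n → Q, ω = ∑ j, q j • KaehlerDifferential.D ℂ Q (π (MvPolynomial.X j)) := by
  have : ω ∈ Submodule.span Q (Set.range fun j : Fin n =>
      KaehlerDifferential.D ℂ Q (π (MvPolynomial.X j))) := by
    have h : (⊤ : Submodule Q (Ω[Q⁄ℂ])) ≤ Submodule.span Q (Set.range fun j : Fin n =>
        KaehlerDifferential.D ℂ Q (π (MvPolynomial.X j))) := by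
      rw [← KaehlerDifferential.span_range_derivation, Submodule.span_le]
      rintro _ ⟨q, rfl⟩
      obtain ⟨p, rfl⟩ := hπ q
      rw [D_map_eq_sum]
      exact sum_mem fun j _ => Submodule.smul_mem _ _ (Submodule.subset_span ⟨j, rfl⟩)
    exact h trivial
  obtain ⟨q, hq⟩ := (Submodule.mem_span_range_iff_exists_fun Q).1 this
  exact ⟨q, hq.symm⟩

/-- The relations between the differentials of the coordinates are generated by the
differentials of the equations. -/
theorem exists_eq_sum_pderiv (hπ : Function.Surjective π)
    (hker : RingHom.ker π = span (Set.range r)) {q : Fin n → Q}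
    (hq : ∑ j, q j • KaehlerDifferential.D ℂ Q (π (MvPolynomial.X j)) = 0) :
    ∃ v : Fin c → Q, ∀ j, q j = ∑ i, v i * π (MvPolynomial.pderiv j (r i)) := by
  let grad : MvPolynomial (Fin n) ℂ →ₗ[ℂ] (Fin n → Q) :=
    LinearMap.pi fun j => π.toLinearMap ∘ₗ (MvPolynomial.pderiv j).toLinearMap
  have hgrad : ∀ p j, grad p j = π (MvPolynomial.pderiv j p) := fun p j => rfl
  have hmul : ∀ p p', grad (p * p') = π p • grad p' + π p' • grad p := by
    intro p p'
    ext j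
    simp [hgrad]
  -- The gradient of a representative is well defined modulo the gradients of the equations, and
  -- gives a derivation of `Q`. Its linear extension to `Ω[Q⁄ℂ]` sends `∑ q j dx j` to the class of
  -- `q`, which therefore vanishes.
  let N : Submodule Q (Fin n → Q) := Submodule.span Q (Set.range fun i => grad (r i))
  let δ : MvPolynomial (Fin n) ℂ →ₗ[ℂ] (Fin n → Q) ⧸ N := (N.mkQ.restrictScalars ℂ) ∘ₗ grad
  have hδ : ∀ p, π p = 0 → δ p = 0 := by
    intro p hp
    have hp' : p ∈ span (Set.range r) := hker ▸ hp
    obtain ⟨a, rfl⟩ := (Ideal.mem_span_range_iff_exists_fun).1 hp'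
    rw [map_sum]
    refine Finset.sum_eq_zero fun i _ => ?_
    change N.mkQ (grad (a i * r i)) = 0
    have hri : π (r i) = 0 := by
      have : r i ∈ RingHom.ker π := hker ▸ subset_span ⟨i, rfl⟩
      exact this
    rw [hmul, hri, zero_smul, add_zero, map_smul, Submodule.mkQ_apply,
      (Submodule.Quotient.mk_eq_zero N).2 (Submodule.subset_span ⟨i, rfl⟩), smul_zero]
  have hwd : ∀ p, δ (Function.surjInv hπ (π p)) = δ p := by
    intro p
    rw [← sub_eq_zero, ← map_sub]
    refine hδ _ ?_
    rw [map_sub, Function.surjInv_eq hπ, sub_self]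
  let d : Derivation ℂ Q ((Fin n → Q) ⧸ N) := Derivation.mk'
    { toFun := fun q => δ (Function.surjInv hπ q)
      map_add' := by
        intro a b
        obtain ⟨a, rfl⟩ := hπ a
        obtain ⟨b, rfl⟩ := hπ b
        rw [← map_add, hwd, hwd, hwd, map_add]
      map_smul' := by
        intro z a
        obtain ⟨a, rfl⟩ := hπ a
        rw [← map_smul, hwd, hwd, map_smul, RingHom.id_apply] }
    (by
      intro a b
      obtain ⟨a, rfl⟩ := hπ a
      obtain ⟨b, rfl⟩ := hπ b
      change δ (Function.surjInv hπ (π a * π b)) = π a • δ (Function.surjInv hπ (π b)) +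
        π b • δ (Function.surjInv hπ (π a))
      rw [← map_mul, hwd, hwd, hwd]
      change N.mkQ (grad (a * b)) = _
      rw [hmul, map_add, map_smul, map_smul]
      rfl)
  have hd : ∀ p, d (π p) = N.mkQ (grad p) := hwd
  have h0 := congrArg d.liftKaehlerDifferential hq
  rw [map_sum, map_zero] at h0
  simp only [map_smul, Derivation.liftKaehlerDifferential_comp_D, hd] at h0
  have hsum : ∑ j, q j • grad (MvPolynomial.X j) = q := by
    ext j
    simp [hgrad, MvPolynomial.pderiv_X, Pi.single_apply]
  simp only [← map_smul] at h0
  rw [← map_sum, hsum, Submodule.mkQ_apply, Submodule.Quotient.mk_eq_zero] at h0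
  obtain ⟨v, hv⟩ := (Submodule.mem_span_range_iff_exists_fun Q).1 h0
  refine ⟨v, fun j => ?_⟩
  rw [← hv]
  simp [hgrad]

end Presentation

end TruncatedDeRham

/-! ### Reducedness of the fibres and cancellation of `f - y` modulo `df` -/

namespace TruncatedDeRham

open Ideal IsLocalRing

open scoped KaehlerDifferential

section Fiber

universe u

variable {A : Type u} [CommRing A] [Algebra ℂ A]

theorem IsAffineSurface.ringKrullDim_le (hA : IsAffineSurface A) : ringKrullDim A ≤ 2 :=
  ringKrullDim_le_of_minimalPrimes (d := 2) fun p hp => (hA.equidimensional p hp).le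

theorem IsAffineSurface.ringKrullDim_quotient_le (hA : IsAffineSurface A) {f : A}
    (hf : IsDominant f) (y : ℂ) :
    ringKrullDim (A ⧸ span {f - algebraMap ℂ A y}) ≤ 1 := by
  have := hA.isReduced
  exact ringKrullDim_quotient_span_le (d := 1) hA.ringKrullDim_le
    (sub_algebraMap_mem_nonZeroDivisors hf y)

/-- A maximal ideal is a point, and near it the fibre is a complete intersection curve in affine
space, to which unmixedness applies. -/
theorem IsAffineSurface.not_isMaximal_of_isColonPrime (hA : IsAffineSurface A)
    (hlci : IsLocallyCompleteIntersection A 2) {f : A} (hf : IsDominant f) {y : ℂ} {p : Ideal A}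
    (hp : IsColonPrime (span {f - algebraMap ℂ A y}) p) : ¬ p.IsMaximal := by
  intro hm
  have := hA.finiteType
  obtain ⟨x, rfl⟩ := exists_point_of_isMaximal p
  refine hlci.elim x fun w hw c r Q _ _ _ _ _ π hπ hker => ?_
  refine not_isColonPrime_ker_point hπ hker x hw ?_ (hA.ringKrullDim_quotient_le hf y) hp
  obtain ⟨-, u, hu⟩ := hp
  exact (hu _).2 (Ideal.mul_mem_right _ _ (mem_span_singleton_self _))

theorem IsColonPrime.le {R : Type*} [CommRing R] {I p : Ideal R} (hp : IsColonPrime I p) : I ≤ p := by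
  obtain ⟨-, u, hu⟩ := hp
  exact fun a ha => (hu _).2 (Ideal.mul_mem_right _ _ ha)

/-- The scheme-theoretic fibre over `y` is reduced if it contains finitely many points of
`Sing(f)`. -/
theorem IsAffineSurface.isRadical_span (hA : IsAffineSurface A)
    (hlci : IsLocallyCompleteIntersection A 2) {f : A} (hf : IsDominant f) {y : ℂ}
    (hZ : (fiber f y ∩ sing f).Finite) : (span {f - algebraMap ℂ A y}).IsRadical := by
  have := hA.finiteType
  have : IsNoetherianRing A := Algebra.FiniteType.isNoetherianRing ℂ A
  intro a ha
  by_contra hna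
  obtain ⟨p, c, hp, hpc, hpa⟩ := exists_isColonPrime _ hna
  have hcol : IsColonPrime (span {f - algebraMap ℂ A y}) p := ⟨hp, _, hpc⟩
  -- Failure of reducedness would be carried by a non-maximal `p`, whose zero set meets the
  -- complement of the finite singular set; but there the fibre is reduced.
  obtain ⟨x, hpx, -, hxZ⟩ := exists_point_notMem_of_not_isMaximal
    (hA.not_isMaximal_of_isColonPrime hlci hf hcol) hZ hp.one_notMem
  have hxf : x f = y := by
    have : x (f - algebraMap ℂ A y) = 0 :=
      hpx (hcol.le (mem_span_singleton_self _))
    simpa [sub_eq_zero] using this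
  have hxs : x ∉ sing f := fun h => hxZ ⟨hxf, h⟩
  subst hxf
  obtain ⟨v, hv, hva⟩ := exists_mul_mem_span_of_notMem_sing hA.ringKrullDim_le hxs ha
  exact hv (hpx (hpa v hva))

/-- A function that vanishes on the fibre over `y` off the finite set of singularities is divisible
by `f - y`. -/
theorem IsAffineSurface.mem_span_of_forall (hA : IsAffineSurface A)
    (hlci : IsLocallyCompleteIntersection A 2) {f : A} (hf : IsDominant f) {y : ℂ}
    (hZ : (fiber f y ∩ sing f).Finite) {a : A} (ha : ∀ x ∈ fiber f y, x ∉ sing f → x a = 0) :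
    a ∈ span {f - algebraMap ℂ A y} := by
  have := hA.finiteType
  have : IsNoetherianRing A := Algebra.FiniteType.isNoetherianRing ℂ A
  by_contra hna
  obtain ⟨p, c, hp, hpc, -⟩ := exists_isColonPrime _ hna
  have hcol : IsColonPrime (span {f - algebraMap ℂ A y}) p := ⟨hp, _, hpc⟩
  -- Otherwise `(c * a) ^ 2` lies in the ideal of the fibre, which is radical, and then `1 ∈ p`.
  have hca : c * a ∉ p := by
    intro h
    have h2 := (hpc _).1 h
    have h1 : c * a ∈ span {f - algebraMap ℂ A y} :=
      hA.isRadical_span hlci hf hZ ⟨2, by rwa [pow_two]⟩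
    exact hp.one_notMem ((hpc 1).2 (by rwa [one_mul]))
  obtain ⟨x, hpx, hxa, hxZ⟩ := exists_point_notMem_of_not_isMaximal
    (hA.not_isMaximal_of_isColonPrime hlci hf hcol) hZ hca
  have hxf : x f = y := by
    have : x (f - algebraMap ℂ A y) = 0 :=
      hpx (hcol.le (mem_span_singleton_self _))
    simpa [sub_eq_zero] using this
  exact hxa (by rw [map_mul, ha x hxf fun h => hxZ ⟨hxf, h⟩, mul_zero])

section Jacobian

variable {w : A} {Q : Type*} [CommRing Q] [Algebra ℂ Q] [Algebra A Q] [IsScalarTower ℂ A Q]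
  [IsLocalization.Away w Q] {c : ℕ} {r : Fin c → MvPolynomial (Fin (c + 2)) ℂ}
  {π : MvPolynomial (Fin (c + 2)) ℂ →ₐ[ℂ] Q}

/-- At a point off `Sing(f)` the differentials of the local equations and of `f` are linearly
independent. -/
theorem jacobian_independent (hdim : ringKrullDim A ≤ 2) (hπ : Function.Surjective π)
    (hker : RingHom.ker π = span (Set.range r)) {f : A} {x : A →ₐ[ℂ] ℂ} (hx : x ∉ sing f)
    (hw : x w ≠ 0) {z : Q →ₐ[ℂ] ℂ} (hz : ∀ a, z (algebraMap A Q a) = x a)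
    {G : MvPolynomial (Fin (c + 2)) ℂ} (hG : π G = algebraMap A Q (f - algebraMap ℂ A (x f)))
    {β : ℂ} {ν : Fin c → ℂ} (h : ∀ j, β * z (π (MvPolynomial.pderiv j G)) +
      ∑ i, ν i * z (π (MvPolynomial.pderiv j (r i))) = 0) : β = 0 ∧ ν = 0 := by
  obtain ⟨t, ht, hpar⟩ := exists_parameter_of_notMem_sing hdim hx
  obtain ⟨T, hT⟩ := hπ (algebraMap A Q t)
  have hzG : z (π G) = 0 := by rw [hG, hz]; simp
  have hzT : z (π T) = 0 := by rw [hT, hz, ht]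
  let grad : MvPolynomial (Fin (c + 2)) ℂ → Fin (c + 2) → ℂ :=
    fun p j => z (π (MvPolynomial.pderiv j p))
  -- Adding the gradient of the second parameter `T` makes the Jacobian matrix square, so that
  -- independence of its rows follows from injectivity on column vectors.
  let M : Matrix (Fin (c + 2)) (Fin (c + 2)) ℂ :=
    Matrix.of (Fin.cons (grad G) (Fin.cons (grad T) fun i => grad (r i)))
  have hM : Function.Injective M.mulVec := by
    refine (injective_iff_map_eq_zero M.mulVecLin).2 fun τ hτ => ?_
    -- A vector killed by `M` is a tangent vector at the point along which `G`, `T` and all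
    -- equations have derivative zero. As `G` and `T` generate the maximal ideal locally, every
    -- function has derivative zero along it, in particular the coordinates.
    let δ : MvPolynomial (Fin (c + 2)) ℂ → ℂ := fun p => ∑ j, grad p j * τ j
    have hadd : ∀ p q, δ (p + q) = δ p + δ q := by
      intro p q
      simp only [δ, grad, map_add, add_mul, Finset.sum_add_distrib]
    have hmul : ∀ p q, δ (p * q) = z (π p) * δ q + z (π q) * δ p := by
      intro p q
      simp only [δ, grad, Derivation.leibniz, smul_eq_mul, map_add, map_mul, add_mul,
        Finset.sum_add_distrib, Finset.mul_sum]
      congr 1 <;> exact Finset.sum_congr rfl fun j _ => by ring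
    have hC : ∀ a : ℂ, δ (MvPolynomial.C a) = 0 := by
      intro a
      simp [δ, grad]
    have hδG : δ G = 0 := congrFun hτ 0
    have hδT : δ T = 0 := congrFun hτ (Fin.succ 0)
    have hδr : ∀ i, δ (r i) = 0 := fun i => congrFun hτ (Fin.succ (Fin.succ i))
    have hδker : ∀ p, π p = 0 → δ p = 0 := by
      intro p hp
      have hp' : p ∈ span (Set.range r) := hker ▸ hp
      refine Submodule.span_induction ?_ ?_ ?_ ?_ hp'
      · rintro _ ⟨i, rfl⟩
        exact hδr i
      · simpa using hC 0
      · intro p q _ _ hp hq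
        rw [hadd, hp, hq, add_zero]
      · intro a p hp hδp
        have : π p = 0 := by
          have hp : p ∈ RingHom.ker π := hker ▸ hp
          exact hp
        rw [smul_eq_mul, hmul, hδp, this]
        simp
    have hδ0 : ∀ p, z (π p) = 0 → δ p = 0 := by
      intro p hp
      obtain ⟨k, a, hka⟩ := exists_pow_mul_eq_algebraMap w (π p)
      have ha : x a = 0 := by rw [← hz, ← hka, map_mul, hp, mul_zero]
      obtain ⟨v, hv, hva⟩ := hpar a ha
      obtain ⟨α, γ, hαγ⟩ := mem_span_pair.1 hva
      obtain ⟨V, hV⟩ := hπ (algebraMap A Q (v * w ^ k))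
      obtain ⟨α', hα'⟩ := hπ (algebraMap A Q α)
      obtain ⟨γ', hγ'⟩ := hπ (algebraMap A Q γ)
      have h0 : π (V * p + (MvPolynomial.C (-1) * (α' * G) + MvPolynomial.C (-1) * (γ' * T))) =
          0 := by
        have hneg : π (MvPolynomial.C (-1)) = -1 := by
          simp
        rw [map_add, map_add, map_mul, map_mul, map_mul, map_mul, map_mul, hV, hα', hγ', hG, hT,
          hneg, map_mul, map_pow, mul_assoc, hka, ← map_mul, ← hαγ]
        simp only [map_add, map_mul]
        ring
      have := hδker _ h0
      rw [hadd, hadd, hmul, hmul, hmul, hmul, hmul, hC, hδG, hδT, hp, hzG, hzT, hV, hz] at this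
      simp only [map_mul, hzG, hzT] at this
      have hne : x (v * w ^ k) ≠ 0 := by simp [hv, hw]
      have h1 : x (v * w ^ k) * δ p = 0 := by simpa using this
      exact (mul_eq_zero.1 h1).resolve_left hne
    have hδ : ∀ p, δ p = 0 := by
      intro p
      have h1 := hδ0 (p + MvPolynomial.C (-z (π p))) (by
        rw [map_add, ← MvPolynomial.algebraMap_eq, AlgHom.commutes, map_add, AlgHom.commutes]
        simp)
      rwa [hadd, hC, add_zero] at h1
    ext j
    have := hδ (MvPolynomial.X j)
    simpa [δ, grad, MvPolynomial.pderiv_X, Pi.single_apply, apply_ite] using this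
  have hM' := Matrix.vecMul_injective_iff_isUnit.2 (Matrix.mulVec_injective_iff_isUnit.1 hM)
  have hvec : Matrix.vecMul (Fin.cons β (Fin.cons 0 ν)) M = Matrix.vecMul 0 M := by
    rw [Matrix.zero_vecMul]
    ext j
    have := h j
    simpa [Matrix.vecMul, dotProduct, Fin.sum_univ_succ, M, grad] using this
  have h0 := hM' hvec
  refine ⟨by simpa using congrFun h0 0, ?_⟩
  ext i
  simpa using congrFun h0 (Fin.succ (Fin.succ i))

end Jacobian

/-- Relative forms have no `(f - y)`-torsion. -/
theorem IsAffineSurface.exists_smul_D_eq (hA : IsAffineSurface A)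
    (hlci : IsLocallyCompleteIntersection A 2) {f : A} (hf : IsDominant f) {y : ℂ}
    (hZ : (fiber f y ∩ sing f).Finite) {η : Ω[A⁄ℂ]} {b : A}
    (h : (f - algebraMap ℂ A y) • η = b • KaehlerDifferential.D ℂ A f) :
    ∃ b' : A, η = b' • KaehlerDifferential.D ℂ A f := by
  have := hA.finiteType
  have := hA.isReduced
  set g := f - algebraMap ℂ A y with hg
  -- The multipliers that carry `η` into `A df`; the claim is local, since it suffices that `I` lies
  -- in no maximal ideal.
  let I : Ideal A := (Submodule.span A {KaehlerDifferential.D ℂ A f}).colon {η}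
  have hI : ∀ u, u ∈ I ↔ ∃ b' : A, b' • KaehlerDifferential.D ℂ A f = u • η := fun u => by
    rw [Submodule.mem_colon_singleton, Submodule.mem_span_singleton]
  suffices hItop : I = ⊤ by
    obtain ⟨b', hb'⟩ := (hI 1).1 (hItop ▸ Submodule.mem_top)
    exact ⟨b', by rw [hb', one_smul]⟩
  by_contra hne
  obtain ⟨m, hm, hIm⟩ := exists_le_maximal I hne
  obtain ⟨x₀, rfl⟩ := exists_point_of_isMaximal m
  refine hlci.elim x₀ fun w hw c r Q _ _ _ _ _ π hπ hker => ?_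
  have hwu : IsUnit (algebraMap A Q w) := IsLocalization.Away.algebraMap_isUnit w
  let φ := KaehlerDifferential.map ℂ ℂ A Q
  obtain ⟨ηc, hηc⟩ := exists_eq_sum_smul_D hπ (φ η)
  obtain ⟨G, hG⟩ := hπ (algebraMap A Q g)
  have hDG : KaehlerDifferential.D ℂ Q (π G) = φ (KaehlerDifferential.D ℂ A f) := by
    rw [hG, ← D_sub_algebraMap f y, KaehlerDifferential.map_D]
  have hrel : ∑ j, (algebraMap A Q g * ηc j - algebraMap A Q b * π (MvPolynomial.pderiv j G)) •
      KaehlerDifferential.D ℂ Q (π (MvPolynomial.X j)) = 0 := by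
    have h1 : algebraMap A Q g • φ η =
        algebraMap A Q b • KaehlerDifferential.D ℂ Q (π G) := by
      rw [hDG, algebraMap_smul, algebraMap_smul, ← map_smul, h, map_smul]
    rw [hηc, D_map_eq_sum] at h1
    simp only [sub_smul, Finset.sum_sub_distrib, mul_smul, ← Finset.smul_sum, h1, sub_self]
  obtain ⟨v, hv⟩ := exists_eq_sum_pderiv hπ hker hrel
  -- An element of `Q` that vanishes at the nonsingular points of the fibre is divisible by `g`. The
  -- numerator is multiplied by one further `w`, so that it vanishes also at the points of the fibre
  -- outside the chart.
  have hdiv : ∀ q : Q, (∀ z : Q →ₐ[ℂ] ℂ, ∀ x : A →ₐ[ℂ] ℂ, x f = y → x ∉ sing f →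
      x w ≠ 0 → (∀ a, z (algebraMap A Q a) = x a) → z q = 0) → ∃ q', q = q' * algebraMap A Q g := by
    intro q hq
    obtain ⟨k, a, hka⟩ := exists_pow_mul_eq_algebraMap w q
    have hwa : w * a ∈ span {g} := by
      refine hA.mem_span_of_forall hlci hf hZ fun x hxf hxs => ?_
      by_cases hxw : x w = 0
      · rw [map_mul, hxw, zero_mul]
      · obtain ⟨z, hz⟩ := exists_point_localization (w := w) (Q := Q) x hxw
        rw [map_mul, ← hz a, ← hka, map_mul, hq z x hxf hxs hxw hz, mul_zero, mul_zero]
    obtain ⟨e, he⟩ := mem_span_singleton'.1 hwa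
    have h1 : algebraMap A Q w ^ (k + 1) * q = algebraMap A Q e * algebraMap A Q g := by
      rw [← map_mul, he, map_mul, ← hka]
      ring
    obtain ⟨u, hu⟩ := (hwu.pow (k + 1)).exists_left_inv
    exact ⟨u * algebraMap A Q e, by rw [mul_assoc, ← h1, ← mul_assoc, hu, one_mul]⟩
  -- At such a point `g` vanishes, and `hv` becomes a linear relation between the independent
  -- gradients of `G` and of the equations.
  have hpt : ∀ z : Q →ₐ[ℂ] ℂ, ∀ x : A →ₐ[ℂ] ℂ, x f = y → x ∉ sing f → x w ≠ 0 →
      (∀ a, z (algebraMap A Q a) = x a) → z (algebraMap A Q b) = 0 ∧ (fun i => z (v i)) = 0 := by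
    intro z x hxf hxs hxw hz
    refine jacobian_independent hA.ringKrullDim_le hπ hker hxs hxw hz (G := G)
      (by rw [hG, hg, hxf]) fun j => ?_
    have := congrArg z (hv j)
    have hzg : z (algebraMap A Q g) = 0 := by rw [hz, hg]; simp [hxf]
    rw [map_sub, map_mul, map_mul, hzg, map_sum] at this
    simp only [map_mul] at this
    rw [← this]
    ring
  obtain ⟨b', hb'⟩ := hdiv (algebraMap A Q b) fun z x h1 h2 h3 h4 => (hpt z x h1 h2 h3 h4).1
  choose v' hv' using fun i => hdiv (v i) fun z x h1 h2 h3 h4 => congrFun (hpt z x h1 h2 h3 h4).2 i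
  have hreg : algebraMap A Q g ∈ nonZeroDivisors Q :=
    IsLocalization.map_nonZeroDivisors_le (Submonoid.powers w) Q
      ⟨g, sub_algebraMap_mem_nonZeroDivisors hf y, rfl⟩
  have hηj : ∀ j, ηc j = b' * π (MvPolynomial.pderiv j G) +
      ∑ i, v' i * π (MvPolynomial.pderiv j (r i)) := by
    intro j
    have h1 := hv j
    rw [← sub_eq_zero]
    refine (mem_nonZeroDivisors_iff_right.1 hreg) _ ?_
    rw [hb'] at h1
    have h2 : ∑ i, v i * π (MvPolynomial.pderiv j (r i)) =
        (∑ i, v' i * π (MvPolynomial.pderiv j (r i))) * algebraMap A Q g := by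
      rw [Finset.sum_mul]
      exact Finset.sum_congr rfl fun i _ => by rw [hv' i]; ring
    rw [h2] at h1
    linear_combination h1
  have hφη : φ η = b' • φ (KaehlerDifferential.D ℂ A f) := by
    have hri : ∀ i, ∑ j, π (MvPolynomial.pderiv j (r i)) •
        KaehlerDifferential.D ℂ Q (π (MvPolynomial.X j)) = 0 := by
      intro i
      have : r i ∈ RingHom.ker π := hker ▸ subset_span ⟨i, rfl⟩
      rw [← D_map_eq_sum, (this : π (r i) = 0), map_zero]
    rw [hηc, ← hDG, D_map_eq_sum]
    simp only [hηj, add_smul, Finset.sum_add_distrib, Finset.sum_smul, mul_smul]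
    rw [Finset.sum_comm, ← Finset.smul_sum]
    simp only [← Finset.smul_sum, hri, smul_zero, Finset.sum_const_zero, add_zero]
  -- Clearing denominators puts a power of `w` into `I`, although `w` does not vanish at `x₀`.
  obtain ⟨k, a, hka⟩ := exists_pow_mul_eq_algebraMap w b'
  have heq : φ (w ^ k • η) = φ (a • KaehlerDifferential.D ℂ A f) := by
    rw [map_smul, map_smul, hφη, ← algebraMap_smul Q (w ^ k), ← algebraMap_smul Q a, ← hka,
      smul_smul, map_pow]
  have : IsLocalizedModule (Submonoid.powers w) φ := inferInstance
  obtain ⟨⟨_, l, rfl⟩, hl⟩ := IsLocalizedModule.exists_of_eq (S := Submonoid.powers w) heq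
  have hmem : w ^ l * w ^ k ∈ I := (hI _).2 ⟨w ^ l * a, by
    rw [mul_smul, mul_smul]
    exact hl.symm⟩
  have hx0 : x₀ (w ^ l * w ^ k) = 0 := hIm hmem
  simp [hw] at hx0

end Fiber

end TruncatedDeRham

/-! ### Locally constant functions and torsion in `H¹(f)` -/

namespace TruncatedDeRham

open Ideal Polynomial

open scoped KaehlerDifferential TensorProduct

section Closed

/-- A function on a finitely generated extension field of characteristic zero with vanishing
differential is algebraic. -/
theorem isAlgebraic_of_D_eq_zero {k L : Type*} [Field k] [CharZero k] [Field L] [Algebra k L]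
    [Algebra.EssFiniteType k L] {a : L} (ha : KaehlerDifferential.D k L a = 0) :
    IsAlgebraic k a := by
  by_contra htr
  have hinj : Function.Injective (aeval a : k[X] →ₐ[k] L) :=
    (transcendental_iff_injective).1 htr
  let K := FractionRing k[X]
  let : Algebra k[X] L := (aeval a : k[X] →ₐ[k] L).toRingHom.toAlgebra
  have hmap : ∀ p : k[X], algebraMap k[X] L p = aeval a p := fun p => rfl
  have : IsScalarTower k k[X] L := .of_algebraMap_eq fun z => by rw [hmap]; simp
  let : Algebra K L := (IsFractionRing.lift (K := K) (g := algebraMap k[X] L) hinj).toAlgebra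
  have : IsScalarTower k[X] K L := .of_algebraMap_eq fun p =>
    (IsFractionRing.lift_algebraMap (K := K) (g := algebraMap k[X] L) hinj p).symm
  have : IsScalarTower k K L := .of_algebraMap_eq fun z => by
    rw [IsScalarTower.algebraMap_apply k k[X] L, IsScalarTower.algebraMap_apply k[X] K L,
      ← IsScalarTower.algebraMap_apply k k[X] K]
  have : CharZero K := algebraRat.charZero K
  have : Algebra.EssFiniteType K L := .of_comp k K L
  -- In characteristic zero `L` is formally smooth over `k(X)`, hence over `k[X]`. So `L ⊗
  -- Ω[k[X]⁄k]` injects into `Ω[L⁄k]`, and the generator `dX` cannot be sent to `da = 0`.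
  have : Algebra.FormallySmooth k[X] K := .of_isLocalization (nonZeroDivisors k[X])
  have : Algebra.FormallySmooth k[X] L := .comp k[X] K L
  have h0 : KaehlerDifferential.mapBaseChange k k[X] L (1 ⊗ₜ KaehlerDifferential.D k k[X] X) =
      0 := by
    rw [KaehlerDifferential.mapBaseChange_tmul, KaehlerDifferential.map_D, hmap, aeval_X, ha,
      smul_zero]
  obtain ⟨e, he⟩ := (Algebra.H1Cotangent.exact_δ_mapBaseChange k k[X] L _).1 h0
  have : Subsingleton (Algebra.H1Cotangent k[X] L) := inferInstance
  rw [Subsingleton.elim e 0, map_zero] at he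
  have h1 := congrArg ((TensorProduct.rid k[X] L) ∘
    (LinearMap.lTensor L (KaehlerDifferential.polynomialEquiv k).toLinearMap)) he
  simp at h1

/-- On each component the function is algebraic over `ℂ`, hence constant. The product of `X - c`
over the finite set of values has simple roots, and it annihilates `a` because `B` is reduced. -/
theorem exists_separable_aeval_eq_zero {B : Type*} [CommRing B] [Algebra ℂ B]
    [Algebra.FiniteType ℂ B] [IsReduced B] {a : B} (ha : KaehlerDifferential.D ℂ B a = 0) :
    ∃ P : ℂ[X], P.Separable ∧ aeval a P = 0 := by
  classical
  have : IsNoetherianRing B := Algebra.FiniteType.isNoetherianRing ℂ B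
  have hex : ∀ p ∈ minimalPrimes B, ∃ z : ℂ, a - algebraMap ℂ B z ∈ p := by
    intro p hp
    have := hp.1.1
    let L := FractionRing (B ⧸ p)
    have : Algebra.FiniteType ℂ (B ⧸ p) :=
      .of_surjective (Ideal.Quotient.mkₐ ℂ p) Ideal.Quotient.mk_surjective
    have : Algebra.EssFiniteType (B ⧸ p) L := .of_isLocalization L (nonZeroDivisors (B ⧸ p))
    have : Algebra.EssFiniteType ℂ L := .comp ℂ (B ⧸ p) L
    have hD : KaehlerDifferential.D ℂ L (algebraMap B L a) = 0 := by
      rw [← KaehlerDifferential.map_D ℂ ℂ, ha, map_zero]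
    have halg := isAlgebraic_of_D_eq_zero hD
    obtain ⟨z, hz⟩ := minpoly.mem_range_of_degree_eq_one ℂ (algebraMap B L a)
      (IsAlgClosed.degree_eq_one_of_irreducible ℂ (minpoly.irreducible halg.isIntegral))
    refine ⟨z, ?_⟩
    have hinj := IsFractionRing.injective (B ⧸ p) L
    rw [← Ideal.Quotient.eq_zero_iff_mem]
    refine hinj ?_
    rw [map_zero, ← Ideal.Quotient.algebraMap_eq, ← IsScalarTower.algebraMap_apply, map_sub,
      ← hz, ← IsScalarTower.algebraMap_apply, sub_self]
  choose! z hz using hex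
  have hfin := minimalPrimes.finite_of_isNoetherianRing B
  let s : Finset ℂ := hfin.toFinset.image z
  refine ⟨∏ c ∈ s, (X - C c), separable_prod_X_sub_C_iff'.2 (fun _ _ _ _ h => h), ?_⟩
  have : aeval a (∏ c ∈ s, (X - C c)) ∈ sInf (minimalPrimes B) := by
    rw [Submodule.mem_sInf]
    intro p hp
    rw [map_prod]
    have hzp : z p ∈ s := Finset.mem_image_of_mem _ (hfin.mem_toFinset.2 hp)
    rw [← Finset.mul_prod_erase _ _ hzp]
    exact Ideal.mul_mem_right _ _ (by simpa using hz p hp)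
  rw [minimalPrimes, Ideal.sInf_minimalPrimes] at this
  exact (mem_nilradical.1 this).eq_zero

end Closed

section Quotient

variable {k A : Type*} [CommRing k] [CommRing A] [Algebra k A]

/-- The conormal sequence. -/
theorem exists_sub_D_mem_smul_of_map_eq_zero (I : Ideal A) {ω : Ω[A⁄k]}
    (h : KaehlerDifferential.map k k A (A ⧸ I) ω = 0) :
    ∃ i ∈ I, ω - KaehlerDifferential.D k A i ∈ I • (⊤ : Submodule A (Ω[A⁄k])) := by
  have h0 : KaehlerDifferential.mapBaseChange k A (A ⧸ I) (1 ⊗ₜ ω) = 0 := by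
    rw [KaehlerDifferential.mapBaseChange_tmul, h, smul_zero]
  obtain ⟨e, he⟩ := (KaehlerDifferential.exact_kerCotangentToTensor_mapBaseChange k A (A ⧸ I)
    Ideal.Quotient.mk_surjective _).1 h0
  obtain ⟨⟨i, hi⟩, rfl⟩ := Ideal.toCotangent_surjective _ e
  have hiI : i ∈ I := by
    rw [RingHom.mem_ker, Ideal.Quotient.algebraMap_eq, Ideal.Quotient.eq_zero_iff_mem] at hi
    exact hi
  refine ⟨i, hiI, ?_⟩
  rw [KaehlerDifferential.kerCotangentToTensor_toCotangent] at he
  have h1 : (1 : A ⧸ I) ⊗ₜ[A] (ω - KaehlerDifferential.D k A i) = 0 := by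
    rw [TensorProduct.tmul_sub, he, sub_self]
  have h2 := congrArg (TensorProduct.quotTensorEquivQuotSMul (Ω[A⁄k]) I) h1
  rw [map_zero, ← map_one (Ideal.Quotient.mk I),
    TensorProduct.quotTensorEquivQuotSMul_mk_tmul, one_smul] at h2
  exact (Submodule.Quotient.mk_eq_zero _).1 h2

end Quotient

/-! ### Divisibility of `(f - y)`-torsion and the upper bound for `H¹` of a fibre -/

section Torsion

universe u

variable {A : Type u} [CommRing A] [Algebra ℂ A]

theorem mem_relExact_iff {f : A} {ω : Ω[A⁄ℂ]} : ω ∈ relExact f ↔ ∃ a b : A,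
    ω = KaehlerDifferential.D ℂ A a + b • KaehlerDifferential.D ℂ A f := Iff.rfl

theorem D_pow_mul_sub (f : A) (y : ℂ) (k : ℕ) (e : A) : ∃ b : A,
    KaehlerDifferential.D ℂ A ((f - algebraMap ℂ A y) ^ k * e) =
      (f - algebraMap ℂ A y) ^ k • KaehlerDifferential.D ℂ A e +
        b • KaehlerDifferential.D ℂ A f := by
  refine ⟨e * (k * (f - algebraMap ℂ A y) ^ (k - 1)), ?_⟩
  rw [Derivation.leibniz, Derivation.leibniz_pow, D_sub_algebraMap, mul_smul, mul_smul,
    Nat.cast_smul_eq_nsmul]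

/-- A function that is locally constant on a reduced fibre is congruent to one whose
differential vanishes on the fibre to arbitrarily high order. -/
theorem exists_D_eq_pow_smul [Algebra.FiniteType ℂ A] {f : A} {y : ℂ}
    (hrad : (span {f - algebraMap ℂ A y}).IsRadical) {a b : A} {ω : Ω[A⁄ℂ]}
    (h : (f - algebraMap ℂ A y) • ω = KaehlerDifferential.D ℂ A a +
      b • KaehlerDifferential.D ℂ A f) {k : ℕ} (hk : 0 < k) :
    ∃ (c a' b' : A) (η : Ω[A⁄ℂ]), a = a' + (f - algebraMap ℂ A y) * c ∧
      KaehlerDifferential.D ℂ A a' = (f - algebraMap ℂ A y) ^ k • η +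
        b' • KaehlerDifferential.D ℂ A f := by
  set g := f - algebraMap ℂ A y with hg
  let B := A ⧸ span {g}
  have : IsReduced B := (isRadical_iff_quotient_reduced _).1 hrad
  have : Algebra.FiniteType ℂ B :=
    .of_surjective (Ideal.Quotient.mkₐ ℂ _) Ideal.Quotient.mk_surjective
  have hgB : algebraMap A B g = 0 :=
    Ideal.Quotient.eq_zero_iff_mem.2 (mem_span_singleton_self g)
  have hfB : KaehlerDifferential.map ℂ ℂ A B (KaehlerDifferential.D ℂ A f) = 0 := by
    rw [← D_sub_algebraMap f y, KaehlerDifferential.map_D, ← hg, hgB, map_zero]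
  have hD : KaehlerDifferential.D ℂ B (algebraMap A B a) = 0 := by
    have h1 := congrArg (KaehlerDifferential.map ℂ ℂ A B) h
    rw [map_smul, map_add, map_smul, hfB, smul_zero, add_zero, KaehlerDifferential.map_D,
      ← algebraMap_smul B g, hgB, zero_smul] at h1
    exact h1.symm
  obtain ⟨P, ⟨U, V, hUV⟩, hP⟩ := exists_separable_aeval_eq_zero hD
  have hPa : aeval a P ∈ span {g} := by
    rw [← Ideal.Quotient.eq_zero_iff_mem]
    rw [aeval_algebraMap_apply] at hP
    exact hP
  -- Modulo `g ^ k` the ideal `(g)` is nilpotent, so `a` is an approximate simple root of `P`, and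
  -- Newton's iteration corrects it to an exact root `a'`.
  let S := A ⧸ span {g ^ k}
  have hmk : ∀ u : A, algebraMap A S u = 0 ↔ ∃ e, u = g ^ k * e := by
    intro u
    rw [Ideal.Quotient.algebraMap_eq, Ideal.Quotient.eq_zero_iff_mem, mem_span_singleton]
    rfl
  have hnil : ∀ u ∈ span {g}, IsNilpotent (algebraMap A S u) := by
    intro u hu
    obtain ⟨e, rfl⟩ := mem_span_singleton.1 hu
    refine ⟨k, ?_⟩
    rw [← map_pow, hmk]
    exact ⟨e ^ k, mul_pow _ _ _⟩
  have hnilP : IsNilpotent (aeval (algebraMap A S a) P) := by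
    rw [aeval_algebraMap_apply]
    exact hnil _ hPa
  have hunit : IsUnit (aeval (algebraMap A S a) (derivative P)) := by
    have h1 := congrArg (aeval (algebraMap A S a)) hUV
    rw [map_add, map_mul, map_mul, map_one] at h1
    have h2 : IsUnit (aeval (algebraMap A S a) V * aeval (algebraMap A S a) (derivative P)) := by
      rw [eq_sub_of_add_eq' h1]
      exact ((Commute.all _ _).isNilpotent_mul_left hnilP).isUnit_one_sub
    exact isUnit_of_mul_isUnit_right h2
  obtain ⟨r, ⟨hr1, hr2⟩, -⟩ := existsUnique_nilpotent_sub_and_aeval_eq_zero hnilP hunit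
  obtain ⟨a', rfl⟩ := Ideal.Quotient.mk_surjective r
  rw [← Ideal.Quotient.algebraMap_eq] at hr1 hr2
  rw [aeval_algebraMap_apply] at hr2
  obtain ⟨e, he⟩ := (hmk _).1 hr2
  -- The iteration only gives that `a - a'` is nilpotent modulo `g ^ k`; reducedness of the fibre
  -- upgrades this to divisibility by `g`.
  have haa' : a - a' ∈ span {g} := by
    obtain ⟨j, hj⟩ := hr1
    rw [← map_sub, ← map_pow] at hj
    obtain ⟨e', he'⟩ := (hmk _).1 hj
    refine hrad ⟨j, ?_⟩
    rw [he']
    exact Ideal.mul_mem_right _ _ (Ideal.pow_mem_of_mem _ (mem_span_singleton_self g) k hk)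
  obtain ⟨c, hc⟩ := mem_span_singleton.1 haa'
  have hda : aeval a' (derivative P) • KaehlerDifferential.D ℂ A a' =
      KaehlerDifferential.D ℂ A (aeval a' P) := by
    rw [Derivation.map_aeval]
  have h1 := congrArg (aeval a') hUV
  rw [map_add, map_mul, map_mul, map_one, he] at h1
  obtain ⟨b', hb'⟩ := D_pow_mul_sub f y k e
  refine ⟨c, a', aeval a' V * b', (aeval a' U * e) • KaehlerDifferential.D ℂ A a' +
    aeval a' V • KaehlerDifferential.D ℂ A e, by rw [← hc]; ring, ?_⟩
  -- In `1 = U(a') P(a') + V(a') P'(a')` the first term is divisible by `g ^ k` since `P(a') = g ^ k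
  -- * e`, and `P'(a') da' = d(g ^ k * e)` is so modulo `df`.
  calc KaehlerDifferential.D ℂ A a' = (aeval a' U * (g ^ k * e) +
        aeval a' V * aeval a' (derivative P)) • KaehlerDifferential.D ℂ A a' := by
        rw [h1, one_smul]
    _ = _ := by
        rw [add_smul, mul_smul (aeval a' V), hda, he, hb', smul_add, smul_add, smul_smul,
          smul_smul, smul_smul, smul_smul, mul_left_comm, ← hg, mul_comm (g ^ k) (aeval a' V)]
        abel

/-- Write `(f - y) ω = da + b df` with `a = a' + (f - y) c` and `da'` divisible by `(f - y) ^ (k +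
1)` modulo `df`. Then `(f - y) (ω - (f - y) ^ k η - dc)` is a multiple of `df`, and the factor `f -
y` cancels. -/
theorem IsAffineSurface.exists_sub_mem_relExact (hA : IsAffineSurface A)
    (hlci : IsLocallyCompleteIntersection A 2) {f : A} (hf : IsDominant f) {y : ℂ}
    (hZ : (fiber f y ∩ sing f).Finite) {ω : Ω[A⁄ℂ]}
    (h : (f - algebraMap ℂ A y) • ω ∈ relExact f) (k : ℕ) :
    ∃ η, ω - (f - algebraMap ℂ A y) ^ k • η ∈ relExact f := by
  have := hA.finiteType
  obtain ⟨a, b, hab⟩ := h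
  obtain ⟨c, a', b', η, ha, ha'⟩ :=
    exists_D_eq_pow_smul (hA.isRadical_span hlci hf hZ) hab (Nat.succ_pos k)
  obtain ⟨b₁, hb₁⟩ := D_pow_mul_sub f y 1 c
  set g := f - algebraMap ℂ A y with hg
  rw [pow_one] at hb₁
  have h1 : g • (ω - g ^ k • η - KaehlerDifferential.D ℂ A c) =
      (b' + b₁ + b) • KaehlerDifferential.D ℂ A f := by
    rw [smul_sub, smul_sub, hab, ha, map_add, hb₁, ha', smul_smul, ← pow_succ', add_smul, add_smul]
    abel
  obtain ⟨b₂, hb₂⟩ := hA.exists_smul_D_eq hlci hf hZ h1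
  exact ⟨η, c, b₂, by rw [← hb₂]; abel⟩

theorem IsAffineSurface.exists_sub_mem_relExact_of_pow (hA : IsAffineSurface A)
    (hlci : IsLocallyCompleteIntersection A 2) {f : A} (hf : IsDominant f) {y : ℂ}
    (hZ : (fiber f y ∩ sing f).Finite) (j : ℕ) {ω : Ω[A⁄ℂ]}
    (h : (f - algebraMap ℂ A y) ^ j • ω ∈ relExact f) (k : ℕ) :
    ∃ η, ω - (f - algebraMap ℂ A y) ^ k • η ∈ relExact f := by
  induction j generalizing ω k with
  | zero => exact ⟨0, by simpa using h⟩
  | succ j ih =>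
    rw [pow_succ', mul_smul] at h
    -- Precision `j + k` leaves a factor `(f - y) ^ j` on the remainder, to which the induction
    -- hypothesis then applies.
    obtain ⟨η, hη⟩ := hA.exists_sub_mem_relExact hlci hf hZ h (j + k)
    rw [pow_add, mul_smul, ← smul_sub] at hη
    obtain ⟨η', hη'⟩ := ih hη k
    exact ⟨η + η', by rwa [smul_add, ← sub_sub]⟩

/-- The restriction of a form to a fibre, as a cohomology class. -/
noncomputable def restrictFiber (f : A) (y : ℂ) : Ω[A⁄ℂ] →ₗ[ℂ] H1 (FiberRing f y) :=
  (Submodule.mkQ _) ∘ₗ (KaehlerDifferential.map ℂ ℂ A (FiberRing f y)).restrictScalars ℂ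

theorem algebraMap_fiberRing (f : A) (y : ℂ) :
    algebraMap A (FiberRing f y) (f - algebraMap ℂ A y) = 0 :=
  Ideal.Quotient.eq_zero_iff_mem.2 (le_radical (mem_span_singleton_self _))

theorem restrictFiber_eq_zero_iff {f : A} {y : ℂ} {ω : Ω[A⁄ℂ]} : restrictFiber f y ω = 0 ↔
    ∃ a : A, KaehlerDifferential.map ℂ ℂ A (FiberRing f y) (ω - KaehlerDifferential.D ℂ A a) =
      0 := by
  rw [restrictFiber, LinearMap.comp_apply, Submodule.mkQ_apply, Submodule.Quotient.mk_eq_zero]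
  constructor
  · rintro ⟨b, hb⟩
    obtain ⟨a, rfl⟩ := Ideal.Quotient.mk_surjective b
    exact ⟨a, by rw [map_sub, sub_eq_zero, KaehlerDifferential.map_D]; exact hb.symm⟩
  · rintro ⟨a, ha⟩
    refine ⟨algebraMap A _ a, ?_⟩
    rw [map_sub, sub_eq_zero, KaehlerDifferential.map_D] at ha
    exact ha.symm

theorem restrictFiber_surjective (f : A) (y : ℂ) : Function.Surjective (restrictFiber f y) :=
  (Submodule.mkQ_surjective _).comp
    (KaehlerDifferential.map_surjective_of_surjective ℂ ℂ A (FiberRing f y)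
      Ideal.Quotient.mk_surjective)

theorem restrictFiber_of_mem_relExact {f : A} (y : ℂ) {ω : Ω[A⁄ℂ]} (h : ω ∈ relExact f) :
    restrictFiber f y ω = 0 := by
  obtain ⟨a, b, rfl⟩ := h
  refine restrictFiber_eq_zero_iff.2 ⟨a, ?_⟩
  rw [add_sub_cancel_left, map_smul, ← D_sub_algebraMap f y, KaehlerDifferential.map_D,
    algebraMap_fiberRing, map_zero, smul_zero]

theorem restrictFiber_sub_smul (f : A) (y : ℂ) (ω : Ω[A⁄ℂ]) :
    restrictFiber f y ((f - algebraMap ℂ A y) • ω) = 0 := by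
  refine restrictFiber_eq_zero_iff.2 ⟨0, ?_⟩
  rw [map_zero, sub_zero, map_smul, ← algebraMap_smul (FiberRing f y), algebraMap_fiberRing,
    zero_smul]

theorem restrictFiber_aeval_smul (f : A) (y : ℂ) (q : ℂ[X]) (ω : Ω[A⁄ℂ]) :
    restrictFiber f y (aeval f q • ω) = q.eval y • restrictFiber f y ω := by
  obtain ⟨q', hq'⟩ := X_sub_C_dvd_sub_C_eval (a := y) (p := q)
  have h1 : aeval f q = (f - algebraMap ℂ A y) * aeval f q' + algebraMap ℂ A (q.eval y) := by
    have := congrArg (aeval f) (sub_eq_iff_eq_add.1 hq')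
    simpa using this
  rw [h1, add_smul, mul_smul, map_add, restrictFiber_sub_smul, zero_add, algebraMap_smul, map_smul]

/-- A form whose restriction to a reduced fibre is exact. -/
theorem exists_sub_mem_relExact_of_restrictFiber_eq_zero {f : A} {y : ℂ}
    (hrad : (span {f - algebraMap ℂ A y}).IsRadical) {ω : Ω[A⁄ℂ]}
    (h : restrictFiber f y ω = 0) : ∃ η, ω - (f - algebraMap ℂ A y) • η ∈ relExact f := by
  obtain ⟨a, ha⟩ := restrictFiber_eq_zero_iff.1 h
  obtain ⟨i, hi, hi'⟩ := exists_sub_D_mem_smul_of_map_eq_zero _ ha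
  rw [hrad.radical] at hi hi'
  obtain ⟨c, rfl⟩ := mem_span_singleton.1 hi
  rw [Submodule.ideal_span_singleton_smul, Submodule.mem_smul_pointwise_iff_exists] at hi'
  obtain ⟨η, -, hη⟩ := hi'
  obtain ⟨b, hb⟩ := D_pow_mul_sub f y 1 c
  rw [pow_one] at hb
  refine ⟨η + KaehlerDifferential.D ℂ A c, a, b, ?_⟩
  rw [smul_add, hη, hb]
  abel

/-- A criterion for linear independence over the ring `ℂ[f]`. -/
theorem linearIndependent_adjoin {f : A} {M ι : Type*} [AddCommGroup M]
    [Module (Algebra.adjoin ℂ {f}) M] {v : ι → M}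
    (h : ∀ (s : Finset ι) (p : ι → ℂ[X]), ∑ i ∈ s, (⟨aeval f (p i),
      aeval_mem_adjoin_singleton ℂ f⟩ : Algebra.adjoin ℂ {f}) • v i = 0 → ∀ i ∈ s, p i = 0) :
    LinearIndependent (Algebra.adjoin ℂ {f}) v := by
  rw [linearIndependent_iff']
  intro s a ha i hi
  have hex : ∀ i, ∃ p : ℂ[X], aeval f p = (a i : A) := by
    intro i
    have : (a i : A) ∈ (aeval (R := ℂ) f).range := by
      rw [← Algebra.adjoin_singleton_eq_range_aeval]
      exact (a i).2
    exact this
  choose p hp using hex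
  have hap : ∀ i, a i = ⟨aeval f (p i), aeval_mem_adjoin_singleton ℂ f⟩ :=
    fun i => Subtype.ext (hp i).symm
  have := h s p (by simpa only [← hap] using ha) i hi
  rw [hap i]
  ext
  simp [this]

theorem sum_smul_mk_eq_zero_iff {f : A} {ι : Type*} (s : Finset ι) (p : ι → ℂ[X])
    (ω : ι → Ω[A⁄ℂ]) :
    ∑ i ∈ s, (⟨aeval f (p i), aeval_mem_adjoin_singleton ℂ f⟩ : Algebra.adjoin ℂ {f}) •
      (Submodule.Quotient.mk (ω i) : RelH1 f) = 0 ↔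
    ∑ i ∈ s, aeval f (p i) • ω i ∈ relExact f := by
  rw [← Submodule.Quotient.mk_eq_zero, ← Submodule.mkQ_apply, map_sum]
  rfl

/-- Classes that are independent on a fibre with finitely many singularities are independent over
`ℂ[f]`. -/
theorem IsAffineSurface.rank_H1_fiberRing_le (hA : IsAffineSurface A)
    (hlci : IsLocallyCompleteIntersection A 2) {f : A} (hf : IsDominant f) {y : ℂ}
    (hZ : (fiber f y ∩ sing f).Finite) :
    Module.rank ℂ (H1 (FiberRing f y)) ≤ Module.rank (Algebra.adjoin ℂ {f}) (RelH1 f) := by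
  have := hA.nontrivial
  let b := Module.Basis.ofVectorSpace ℂ (H1 (FiberRing f y))
  choose ω hω using fun i => restrictFiber_surjective f y (b i)
  rw [← b.mk_eq_rank'']
  refine LinearIndependent.cardinal_le_rank
    (v := fun i => (Submodule.Quotient.mk (ω i) : RelH1 f)) ?_
  refine linearIndependent_adjoin fun s p hp => ?_
  rw [sum_smul_mk_eq_zero_iff] at hp
  -- Torsion restricts to zero on the fibre, so after division by `(X - y) ^ n` the values of the
  -- quotients at `y` form a relation between basis vectors, and one more factor splits off.
  have hdvd : ∀ n : ℕ, ∀ i ∈ s, (X - C y) ^ n ∣ p i := by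
    intro n
    induction n with
    | zero => simp
    | succ n ih =>
      choose! q hq using ih
      have h1 : (f - algebraMap ℂ A y) ^ n • ∑ i ∈ s, aeval f (q i) • ω i ∈ relExact f := by
        rw [Finset.smul_sum]
        convert hp using 1
        refine Finset.sum_congr rfl fun i hi => ?_
        conv_rhs => rw [hq i hi]
        simp [smul_smul]
      obtain ⟨η, hη⟩ := hA.exists_sub_mem_relExact_of_pow hlci hf hZ n h1 1
      have h2 := restrictFiber_of_mem_relExact y hη
      rw [pow_one, map_sub, restrictFiber_sub_smul, sub_zero, map_sum] at h2
      simp only [restrictFiber_aeval_smul, hω] at h2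
      intro i hi
      have h3 := linearIndependent_iff'.1 b.linearIndependent s _ h2 i hi
      conv_rhs => rw [hq i hi]
      rw [pow_succ]
      exact mul_dvd_mul_left _ (dvd_iff_isRoot.2 h3)
  intro i hi
  by_contra h0
  have := natDegree_le_of_dvd (hdvd ((p i).natDegree + 1) i hi) h0
  rw [natDegree_pow, natDegree_X_sub_C] at this
  omega

end Torsion

end TruncatedDeRham

/-! ### Newton's identities and integrality through traces -/

namespace TruncatedDeRham

open Polynomial Module

section Newton

/-- Jacobi's formula: in the expansion of the determinant the product rule differentiates one entry
at a time, and only the diagonal entries `X - M i i` have a nonzero derivative. -/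
theorem derivative_charpoly {R : Type*} [CommRing R] {n : Type*} [Fintype n] [DecidableEq n]
    (M : Matrix n n R) :
    derivative M.charpoly = (Matrix.adjugate M.charmatrix).trace := by
  have hentry : ∀ i j, derivative (M.charmatrix i j) = if i = j then 1 else 0 := by
    intro i j
    by_cases h : i = j
    · subst h; simp [Matrix.charmatrix_apply_eq]
    · simp [h]
  have hadj : ∀ i, Matrix.adjugate M.charmatrix i i = ∑ σ : Equiv.Perm n,
      Equiv.Perm.sign σ • ((∏ j ∈ Finset.univ.erase i, M.charmatrix (σ j) j) *
        if σ i = i then 1 else 0) := by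
    intro i
    have h1 : Matrix.adjugate M.charmatrix i i =
        (M.charmatrix.updateCol i (Pi.single i 1)).det := by
      rw [← Matrix.transpose_apply (Matrix.adjugate _), Matrix.adjugate_transpose,
        Matrix.adjugate_apply, Matrix.updateRow_transpose, Matrix.det_transpose]
    rw [h1, Matrix.det_apply]
    refine Finset.sum_congr rfl fun σ _ => ?_
    rw [← Finset.prod_erase_mul _ _ (Finset.mem_univ i), Matrix.updateCol_self, Pi.single_apply]
    congr 2
    refine Finset.prod_congr rfl fun j hj => ?_
    rw [Matrix.updateCol_ne (Finset.ne_of_mem_erase hj)]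
  rw [Matrix.charpoly, Matrix.det_apply, derivative_sum, Matrix.trace]
  simp only [Matrix.diag_apply, hadj]
  rw [Finset.sum_comm]
  refine Finset.sum_congr rfl fun σ _ => ?_
  rw [← Finset.smul_sum, Units.smul_def, Units.smul_def, derivative_smul, derivative_prod_finset]
  simp only [hentry]

/-- Newton's identities: the coefficients of the characteristic polynomial are determined by the
traces of the powers. -/
theorem charpoly_coeff_mem {F : Type*} [Field F] [CharZero F] {n : ℕ}
    (M : Matrix (Fin n) (Fin n) F) (S : AddSubgroup F) (hmul : ∀ a ∈ S, ∀ b ∈ S, a * b ∈ S)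
    (hdiv : ∀ (j : ℕ), ∀ a ∈ S, a / j ∈ S)
    (h : ∀ m, 1 ≤ m → m ≤ n → (M ^ m).trace ∈ S) {j : ℕ} (hj : j < n) :
    M.charpoly.coeff j ∈ S := by
  -- Read as a polynomial with matrix coefficients, the adjugate satisfies `(X - M) Q = χ`.
  -- Comparing coefficients gives a recursion, and `tr Q = χ'` closes it.
  set Q := matPolyEquiv (Matrix.adjugate M.charmatrix) with hQ
  have hχ : (X - C M) * Q = M.charpoly.map (algebraMap F (Matrix (Fin n) (Fin n) F)) := by
    rw [← Matrix.matPolyEquiv_charmatrix, hQ, ← map_mul, Matrix.mul_adjugate, matPolyEquiv_smul_one]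
    rfl
  have hc : ∀ j, Q.coeff j = M * Q.coeff (j + 1) + algebraMap F _ (M.charpoly.coeff (j + 1)) := by
    intro j
    have := congrArg (fun p => p.coeff (j + 1)) hχ
    simp only [sub_mul, coeff_sub, coeff_X_mul, coeff_C_mul, coeff_map] at this
    rw [← this]
    abel
  have hc0 : algebraMap F _ (M.charpoly.coeff 0) = - (M * Q.coeff 0) := by
    have := congrArg (fun p => p.coeff 0) hχ
    simp only [sub_mul, coeff_sub, mul_coeff_zero, coeff_X_zero, zero_mul, coeff_C_zero,
      coeff_map] at this
    rw [← this]
    abel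
  have htr : ∀ j, (Q.coeff j).trace = (j + 1) * M.charpoly.coeff (j + 1) := by
    intro j
    have h1 : (Q.coeff j).trace = ((Matrix.adjugate M.charmatrix).trace).coeff j := by
      simp only [Matrix.trace, Matrix.diag_apply, finsetSum_coeff, hQ, matPolyEquiv_coeff_apply]
    rw [h1, ← derivative_charpoly, coeff_derivative, mul_comm]
  have hn : M.charpoly.natDegree = n := by
    rw [Matrix.charpoly_natDegree_eq_dim, Fintype.card_fin]
  have hlead : M.charpoly.coeff n = 1 := by
    have := (Matrix.charpoly_monic M).coeff_natDegree
    rwa [hn] at this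
  have hQ0 : ∀ j, n ≤ j → Q.coeff j = 0 := by
    have hind : ∀ i j, n ≤ j → Q.coeff j = M ^ i * Q.coeff (j + i) := by
      intro i
      induction i with
      | zero => simp
      | succ i ih =>
        intro j hj
        rw [ih j hj, hc (j + i), coeff_eq_zero_of_natDegree_lt (p := M.charpoly) (by omega), map_zero, add_zero,
          ← mul_assoc, ← pow_succ, add_assoc]
    intro j hj
    rw [hind (Q.natDegree + 1) j hj, coeff_eq_zero_of_natDegree_lt (by omega), mul_zero]
  have hrec : ∀ l j, (M ^ l * Q.coeff j).trace =
      (M ^ (l + 1) * Q.coeff (j + 1)).trace + M.charpoly.coeff (j + 1) * (M ^ l).trace := by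
    intro l j
    rw [hc j, mul_add, ← mul_assoc, ← pow_succ, Matrix.trace_add, Algebra.algebraMap_eq_smul_one,
      mul_smul_comm, mul_one, Matrix.trace_smul, smul_eq_mul]
  -- The two expressions for the trace of `Q.coeff j` differ by `n - (j + 1)` times the sought
  -- coefficient; this is where division by integers is used.
  have hstep : ∀ j, j + 1 < n → (M * Q.coeff (j + 1)).trace ∈ S → M.charpoly.coeff (j + 1) ∈ S := by
    intro j hj hm
    have h1 := hrec 0 j
    rw [pow_zero, one_mul, zero_add, pow_one, Matrix.trace_one, Fintype.card_fin, htr] at h1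
    have h2 : ((n - (j + 1) : ℕ) : F) ≠ 0 := Nat.cast_ne_zero.2 (by omega)
    have h3 : M.charpoly.coeff (j + 1) = - (M * Q.coeff (j + 1)).trace /
        ((n - (j + 1) : ℕ) : F) := by
      rw [eq_div_iff h2, Nat.cast_sub hj.le]
      push_cast
      linear_combination -h1
    rw [h3]
    exact hdiv _ _ (neg_mem hm)
  -- Descending induction on `j`, starting from `Q.coeff j = 0` for `n ≤ j`. The bound `l ≤ j + 1`
  -- guarantees that only traces of powers up to `n` enter.
  have hP : ∀ i j, n ≤ j + i → ∀ l, 1 ≤ l → l ≤ j + 1 → (M ^ l * Q.coeff j).trace ∈ S := by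
    intro i
    induction i with
    | zero =>
      intro j hj l _ _
      rw [hQ0 j (by omega), mul_zero, Matrix.trace_zero]
      exact zero_mem S
    | succ i ih =>
      intro j hj l hl hlj
      rcases le_or_gt n j with hnj | hnj
      · rw [hQ0 j hnj, mul_zero, Matrix.trace_zero]
        exact zero_mem S
      rw [hrec]
      refine add_mem (ih (j + 1) (by omega) (l + 1) (by omega) (by omega)) ?_
      have hMl := h l hl (by omega)
      rcases Nat.lt_or_ge (j + 1) n with hjn | hjn
      · refine hmul _ (hstep j hjn ?_) _ hMl
        have := ih (j + 1) (by omega) 1 le_rfl (by omega)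
        rwa [pow_one] at this
      · have : j + 1 = n := by omega
        rwa [this, hlead, one_mul]
  rcases j with _ | j
  · have h1 := hP n 0 (by omega) 1 le_rfl (by omega)
    rw [pow_one] at h1
    have h2 := congrArg Matrix.trace hc0
    rw [Matrix.trace_neg, Algebra.algebraMap_eq_smul_one, Matrix.trace_smul, Matrix.trace_one,
      Fintype.card_fin, smul_eq_mul] at h2
    have h3 : (n : F) ≠ 0 := Nat.cast_ne_zero.2 (by omega)
    rw [← mul_div_cancel_right₀ (M.charpoly.coeff 0) h3, h2]
    exact hdiv _ _ (neg_mem h1)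
  · refine hstep j hj ?_
    have := hP n (j + 1) (by omega) 1 le_rfl (by omega)
    rwa [pow_one] at this

/-- The trace of an integral element is integral. -/
theorem exists_algebraMap_eq_trace {O F E : Type*} [CommRing O] [IsIntegrallyClosed O]
    [Field F] [Algebra O F] [IsFractionRing O F] [CommRing E] [Algebra F E] [Algebra O E]
    [IsScalarTower O F E] {n : ℕ} (b : Basis (Fin n) F E) {w : E} (hw : IsIntegral O w) :
    ∃ o, algebraMap O F o = Algebra.trace F E w := by
  refine IsIntegrallyClosed.isIntegral_iff.1 ?_
  -- Over an algebraic closure the trace is the sum of the eigenvalues of multiplication by `w`, and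
  -- each eigenvalue is a root of the integral equation of `w`.
  let F' := AlgebraicClosure F
  rw [← isIntegral_algebraMap_iff (B := F') (algebraMap F F').injective]
  set M := Algebra.leftMulMatrix b w with hM
  have htr : algebraMap F F' (Algebra.trace F E w) = (M.map (algebraMap F F')).trace := by
    rw [Algebra.trace_eq_matrix_trace b]
    simp [Matrix.trace, hM]
  rw [htr, Matrix.trace_eq_sum_roots_charpoly]
  obtain ⟨P, hP, hPw⟩ := hw
  have hPM : aeval M (P.map (algebraMap O F)) = 0 := by
    rw [hM, aeval_algHom_apply, aeval_map_algebraMap, aeval_def, hPw, map_zero]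
  have hPM' : aeval (M.map (algebraMap F F')) ((P.map (algebraMap O F)).map (algebraMap F F')) =
      0 := by
    have := congrArg (AlgHom.mapMatrix (Algebra.ofId F F')) hPM
    rw [← aeval_algHom_apply, map_zero] at this
    rw [aeval_map_algebraMap]
    exact this
  refine IsIntegral.multiset_sum fun μ hμ => ?_
  have hμ' := Matrix.mem_spectrum_iff_isRoot_charpoly.2 (isRoot_of_mem_roots hμ)
  have h0 := spectrum.subset_polynomial_aeval (M.map (algebraMap F F'))
    ((P.map (algebraMap O F)).map (algebraMap F F')) ⟨μ, hμ', rfl⟩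
  rw [hPM'] at h0
  rcases subsingleton_or_nontrivial (Matrix (Fin n) (Fin n) F') with _ | _
  · rw [spectrum.of_subsingleton] at h0
    exact h0.elim
  · rw [spectrum.zero_eq, Set.mem_singleton_iff] at h0
    refine ⟨P, hP, ?_⟩
    rw [← h0, map_map, ← IsScalarTower.algebraMap_eq]
    exact (eval_map _ _).symm

/-- Newton's identities put the coefficients of the characteristic polynomial of multiplication by
`w` into `O`; by Cayley–Hamilton it is an integral equation for `w`. -/
theorem isIntegral_of_trace_pow {O F E : Type*} [CommRing O]
    [Field F] [CharZero F] [Algebra O F] [CommRing E] [Algebra F E] [Algebra O E]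
    [IsScalarTower O F E] {n : ℕ} (b : Basis (Fin n) F E) {w : E}
    (hS : ∀ j : ℕ, ∀ a ∈ (algebraMap O F).range, a / j ∈ (algebraMap O F).range)
    (hw : ∀ m, 1 ≤ m → m ≤ n → Algebra.trace F E (w ^ m) ∈ (algebraMap O F).range) :
    IsIntegral O w := by
  set M := Algebra.leftMulMatrix b w with hM
  have hcoeff : ∀ j, M.charpoly.coeff j ∈ (algebraMap O F).range := by
    intro j
    have hn : M.charpoly.natDegree = n := by
      rw [Matrix.charpoly_natDegree_eq_dim, Fintype.card_fin]
    rcases lt_trichotomy j n with h | h | h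
    · refine charpoly_coeff_mem M (algebraMap O F).range.toAddSubgroup
        (fun a ha b hb => (algebraMap O F).range.mul_mem ha hb) hS (fun m h1 h2 => ?_) h
      rw [hM, ← map_pow, ← Algebra.trace_eq_matrix_trace b]
      exact hw m h1 h2
    · have := (Matrix.charpoly_monic M).coeff_natDegree
      rw [hn] at this
      rw [h, this]
      exact one_mem _
    · rw [coeff_eq_zero_of_natDegree_lt (by omega)]
      exact zero_mem _
  have hlift : M.charpoly ∈ lifts (algebraMap O F) := by
    rw [lifts_iff_coeff_lifts]
    exact hcoeff
  obtain ⟨q, hq, -, hqm⟩ := lifts_and_natDegree_eq_and_monic hlift (Matrix.charpoly_monic M)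
  refine ⟨q, hqm, ?_⟩
  apply Algebra.leftMulMatrix_injective b
  rw [map_zero, ← aeval_def, ← aeval_map_algebraMap F, hq, ← aeval_algHom_apply]
  exact Matrix.aeval_self_charpoly M

theorem isIntegral_of_leftMulMatrix_mem {O F E : Type*} [CommRing O]
    [Field F] [Algebra O F] [CommRing E] [Algebra F E] [Algebra O E]
    [IsScalarTower O F E] {n : ℕ} (b : Basis (Fin n) F E) {w : E}
    (hw : ∀ i j, Algebra.leftMulMatrix b w i j ∈ (algebraMap O F).range) : IsIntegral O w := by
  choose N hN using hw
  have hNM : (Matrix.of N).map (algebraMap O F) = Algebra.leftMulMatrix b w := by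
    ext i j
    exact hN i j
  refine ⟨(Matrix.of N).charpoly, Matrix.charpoly_monic _, ?_⟩
  apply Algebra.leftMulMatrix_injective b
  rw [map_zero, ← aeval_def, ← aeval_map_algebraMap F, ← Matrix.charpoly_map, hNM,
    ← aeval_algHom_apply]
  exact Matrix.aeval_self_charpoly _

end Newton

end TruncatedDeRham

/-! ### Pole orders at infinity -/

namespace TruncatedDeRham

open Polynomial Module

open scoped TensorProduct

section Weight

variable {k : Type*} [Field k]

open Classical in
/-- The ring of rational functions that are regular at infinity. -/
noncomputable def inftyRing (k : Type*) [Field k] : ValuationSubring (RatFunc k) :=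
  (RatFunc.inftyValuation k).valuationSubring

open Classical in
theorem X_inv_pow_mul_mem_inftyRing_iff {j : ℕ} {p : k[X]} :
    (RatFunc.X : RatFunc k)⁻¹ ^ j * algebraMap k[X] (RatFunc k) p ∈ inftyRing k ↔
      p.natDegree ≤ j := by
  rw [inftyRing, Valuation.mem_valuationSubring_iff, map_mul, map_pow, map_inv₀,
    RatFunc.inftyValuation.X]
  by_cases hp : p = 0
  · simp [hp]
  · rw [RatFunc.inftyValuation_apply, RatFunc.inftyValuation.polynomial _ hp, inv_pow, ← WithZero.exp_nsmul, ← WithZero.exp_neg,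
      ← WithZero.exp_add, ← WithZero.exp_zero, WithZero.exp_le_exp]
    simp

open Classical in
theorem div_natCast_mem_inftyRing [CharZero k] (j : ℕ) {a : RatFunc k} (ha : a ∈ inftyRing k) :
    a / j ∈ inftyRing k := by
  rcases Nat.eq_zero_or_pos j with rfl | hj
  · simp
  · rw [div_eq_mul_inv]
    refine mul_mem ha ?_
    rw [inftyRing, Valuation.mem_valuationSubring_iff, map_inv₀]
    have : ((j : ℕ) : RatFunc k) = RatFunc.C (j : k) := by simp
    rw [this, RatFunc.inftyValuation.C _ (Nat.cast_ne_zero.2 hj.ne')]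
    simp

variable {B : Type*} [CommRing B] [Algebra k[X] B]

/-- `a` has a pole of order at most `ρ` at infinity. -/
def HasWeight (a : B) (ρ : ℕ) : Prop :=
  IsIntegral (inftyRing k) ((((RatFunc.X : RatFunc k)⁻¹ ^ ρ) ⊗ₜ[k[X]] a : RatFunc k ⊗[k[X]] B))

theorem HasWeight.mul {a b : B} {ρ σ : ℕ} (ha : HasWeight (k := k) a ρ)
    (hb : HasWeight (k := k) b σ) : HasWeight (k := k) (a * b) (ρ + σ) := by
  have := IsIntegral.mul ha hb
  rwa [Algebra.TensorProduct.tmul_mul_tmul, ← pow_add] at this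

theorem HasWeight.pow {a : B} {ρ : ℕ} (ha : HasWeight (k := k) a ρ) (m : ℕ) :
    HasWeight (k := k) (a ^ m) (m * ρ) := by
  have := IsIntegral.pow ha m
  rwa [Algebra.TensorProduct.tmul_pow, ← pow_mul, mul_comm] at this

theorem tmul_eq_smul_one_tmul (r : RatFunc k) (a : B) :
    (r ⊗ₜ[k[X]] a : RatFunc k ⊗[k[X]] B) = r • (1 ⊗ₜ[k[X]] a) := by
  rw [TensorProduct.smul_tmul', smul_eq_mul, mul_one]

variable {n : ℕ} (b : Basis (Fin n) k[X] B)

include b in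
theorem trace_one_tmul (a : B) :
    Algebra.trace (RatFunc k) (RatFunc k ⊗[k[X]] B) (1 ⊗ₜ a) =
      algebraMap k[X] (RatFunc k) (Algebra.trace k[X] B a) := by
  have := Module.Free.of_basis b
  have := Module.Finite.of_basis b
  rw [Algebra.trace_apply, Algebra.trace_apply, ← LinearMap.trace_baseChange]
  congr 1
  ext c
  simp

include b in
-- The trace of an integral element lies in the integrally closed ring `inftyRing k`, and membership
-- there is a degree bound.
theorem HasWeight.natDegree_trace_le {a : B} {ρ : ℕ} (ha : HasWeight (k := k) a ρ) :
    (Algebra.trace k[X] B a).natDegree ≤ ρ := by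
  obtain ⟨o, ho⟩ := exists_algebraMap_eq_trace (b.baseChange (RatFunc k)) ha
  rw [tmul_eq_smul_one_tmul, map_smul, trace_one_tmul b, smul_eq_mul] at ho
  rw [← X_inv_pow_mul_mem_inftyRing_iff, ← ho]
  exact o.2

include b in
-- The converse of the trace bound: the pole order is detected by the traces of the first `n`
-- powers. Characteristic zero is needed for the division in Newton's identities.
theorem hasWeight_of_natDegree_trace_pow_le [CharZero k] {a : B} {ρ : ℕ}
    (h : ∀ m, 1 ≤ m → m ≤ n → (Algebra.trace k[X] B (a ^ m)).natDegree ≤ m * ρ) :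
    HasWeight (k := k) a ρ := by
  have : CharZero (RatFunc k) := algebraRat.charZero _
  refine isIntegral_of_trace_pow (b.baseChange (RatFunc k)) ?_ fun m h1 h2 => ?_
  · rintro j _ ⟨o, rfl⟩
    exact ⟨⟨_, div_natCast_mem_inftyRing j o.2⟩, rfl⟩
  · rw [Algebra.TensorProduct.tmul_pow, ← pow_mul, mul_comm, tmul_eq_smul_one_tmul, map_smul,
      trace_one_tmul b, smul_eq_mul]
    exact ⟨⟨_, X_inv_pow_mul_mem_inftyRing_iff.2 (h m h1 h2)⟩, rfl⟩

/-- After scaling by `X⁻ᴸ`, multiplication by a basis element has a matrix with entries regular at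
infinity. -/
theorem hasWeight_basis {L : ℕ} (hL : ∀ i j l, (b.repr (b i * b j) l).natDegree ≤ L) (i : Fin n) :
    HasWeight (k := k) (b i) L := by
  refine isIntegral_of_leftMulMatrix_mem (b.baseChange (RatFunc k)) fun l j => ?_
  rw [Algebra.leftMulMatrix_eq_repr_mul, Basis.baseChange_apply,
    Algebra.TensorProduct.tmul_mul_tmul, mul_one, Basis.baseChange_repr_tmul, Algebra.smul_def,
    mul_comm]
  exact ⟨⟨_, X_inv_pow_mul_mem_inftyRing_iff.2 (hL i j l)⟩, rfl⟩

theorem hasWeight_of_natDegree_repr_le {L J : ℕ}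
    (hL : ∀ i j l, (b.repr (b i * b j) l).natDegree ≤ L) {a : B}
    (ha : ∀ i, (b.repr a i).natDegree ≤ J) : HasWeight (k := k) a (J + L) := by
  have h1 : ((RatFunc.X : RatFunc k)⁻¹ ^ (J + L)) ⊗ₜ[k[X]] a = ∑ i,
      ((RatFunc.X : RatFunc k)⁻¹ ^ J * algebraMap k[X] (RatFunc k) (b.repr a i)) •
        (((RatFunc.X : RatFunc k)⁻¹ ^ L) ⊗ₜ[k[X]] b i) := by
    conv_lhs => rw [← b.sum_repr a, TensorProduct.tmul_sum]
    refine Finset.sum_congr rfl fun i _ => ?_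
    rw [TensorProduct.smul_tmul', TensorProduct.tmul_smul, TensorProduct.smul_tmul',
      Algebra.smul_def, smul_eq_mul]
    congr 1
    ring
  rw [HasWeight, h1]
  refine IsIntegral.sum _ fun i _ => ?_
  have h2 := hasWeight_basis b hL i
  exact IsIntegral.smul (R := inftyRing k)
    (⟨_, X_inv_pow_mul_mem_inftyRing_iff.2 (ha i)⟩ : inftyRing k) h2

end Weight

/-! ### Derivations, traces and the degree of a primitive -/

section Derivation

variable {k : Type*} [Field k] {B : Type*} [CommRing B] [Algebra k B] [Algebra k[X] B]
  [IsScalarTower k k[X] B] {n : ℕ} (b : Basis (Fin n) k[X] B) {δ : Derivation k B B} {Δ : k[X]}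

theorem derivation_algebraMap (hδ : δ (algebraMap k[X] B X) = algebraMap k[X] B Δ) (p : k[X]) :
    δ (algebraMap k[X] B p) = algebraMap k[X] B (Δ * derivative p) := by
  have h : ∀ q : k[X], aeval (algebraMap k[X] B X) q = algebraMap k[X] B q := fun q => by
    rw [aeval_algebraMap_apply, aeval_X_left_apply]
  rw [← h p, Derivation.map_aeval, hδ, h, smul_eq_mul, ← map_mul, mul_comm]

theorem derivation_smul (hδ : δ (algebraMap k[X] B X) = algebraMap k[X] B Δ) (p : k[X]) (a : B) :
    δ (p • a) = p • δ a + (Δ * derivative p) • a := by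
  rw [Algebra.smul_def, Derivation.leibniz, derivation_algebraMap hδ, smul_eq_mul, smul_eq_mul,
    Algebra.smul_def, Algebra.smul_def, mul_comm a]

include b in
-- The matrix of multiplication by `δ a` is `Δ` times the derivative of the matrix for `a`, up to a
-- commutator with the matrix of `δ` on the basis, and commutators have trace zero.
theorem trace_derivation (hδ : δ (algebraMap k[X] B X) = algebraMap k[X] B Δ) (a : B) :
    Algebra.trace k[X] B (δ a) = Δ * derivative (Algebra.trace k[X] B a) := by
  have htr : ∀ c, Algebra.trace k[X] B c = ∑ j, b.repr (c * b j) j := fun c => by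
    rw [Algebra.trace_eq_matrix_trace b]
    simp [Matrix.trace, Algebra.leftMulMatrix_eq_repr_mul]
  have h1 : ∀ j, δ a * b j = δ (a * b j) - a * δ (b j) := fun j => by
    rw [Derivation.leibniz, smul_eq_mul, smul_eq_mul]
    ring
  have h2 : ∀ j, b.repr (δ (a * b j)) j =
      ∑ i, b.repr (a * b j) i * b.repr (δ (b i)) j + Δ * derivative (b.repr (a * b j) j) := by
    intro j
    conv_lhs => rw [← b.sum_repr (a * b j)]
    rw [map_sum]
    simp only [derivation_smul hδ, map_add, map_sum, map_smul, Finsupp.coe_add, Finsupp.coe_smul,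
      Pi.add_apply, Finset.sum_add_distrib, Finsupp.coe_finsetSum, Finset.sum_apply,
      Pi.smul_apply, smul_eq_mul, Basis.repr_self]
    congr 1
    rw [Finset.sum_eq_single j] <;> simp +contextual
  have h3 : ∀ j, b.repr (a * δ (b j)) j = ∑ i, b.repr (δ (b j)) i * b.repr (a * b i) j := by
    intro j
    conv_lhs => rw [← b.sum_repr (δ (b j)), Finset.mul_sum]
    simp only [mul_smul_comm, map_sum, map_smul, Finsupp.coe_finsetSum, Finset.sum_apply,
      Finsupp.coe_smul, Pi.smul_apply, smul_eq_mul]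
  rw [htr, htr]
  simp only [h1, map_sub, Finsupp.coe_sub, Pi.sub_apply, h2, h3, Finset.sum_sub_distrib,
    Finset.sum_add_distrib]
  rw [Finset.sum_comm (f := fun j i => b.repr (δ (b j)) i * b.repr (a * b i) j),
    derivative_sum, Finset.mul_sum]
  simp only [mul_comm (b.repr (δ _) _)]
  ring

/-- The degree of a primitive is bounded in terms of the degree of its derivative. -/
theorem natDegree_repr_le_of_derivation [CharZero k]
    (hδ : δ (algebraMap k[X] B X) = algebraMap k[X] B Δ) (hΔ : Δ ≠ 0) {L J J' : ℕ}
    (hL : ∀ i j l, (b.repr (b i * b j) l).natDegree ≤ L) {U : Matrix (Fin n) (Fin n) k[X]}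
    (hU : ∀ i j, (U i j).natDegree ≤ J') {d : k[X]} (hd : d ≠ 0)
    (hUd : U * Matrix.of (fun i j => Algebra.trace k[X] B (b i * b j)) = d • 1) {a : B}
    (ha : ∀ i, (b.repr (δ a) i).natDegree ≤ J) (i : Fin n) :
    (b.repr a i).natDegree ≤ J' + (n + J + 2 * L) := by
  classical
  have hv := hasWeight_of_natDegree_repr_le b hL ha
  have hex : ∃ ρ, HasWeight (k := k) a ρ := by
    refine ⟨Finset.univ.sup (fun i => (b.repr a i).natDegree) + L,
      hasWeight_of_natDegree_repr_le b hL fun i => ?_⟩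
    exact Finset.le_sup (f := fun i => (b.repr a i).natDegree) (Finset.mem_univ i)
  -- Let `σ + 1` be the least weight of `a`. As `σ` is not a weight, some `m ≤ n` has `deg tr(aᵐ) >
  -- m σ`. Comparing degrees in `m tr(aᵐ⁻¹ δ a) = Δ · (tr aᵐ)'` gives `m σ ≤ (m - 1) (σ + 1) + J +
  -- L`, that is, `σ ≤ m - 1 + J + L`.
  have hρ : Nat.find hex ≤ n + (J + L) := by
    have hspec := Nat.find_spec hex
    rcases h : Nat.find hex with _ | σ
    · omega
    have hσ : ¬ HasWeight (k := k) a σ := Nat.find_min hex (by omega)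
    rw [h] at hspec
    have h1 : ∃ m, 1 ≤ m ∧ m ≤ n ∧ m * σ < (Algebra.trace k[X] B (a ^ m)).natDegree := by
      by_contra! hcon
      exact hσ (hasWeight_of_natDegree_trace_pow_le b hcon)
    obtain ⟨m, hm1, hmn, hlt⟩ := h1
    have h2 := trace_derivation b hδ (a ^ m)
    have h3 : (Algebra.trace k[X] B (a ^ (m - 1) * δ a)).natDegree ≤
        (m - 1) * (σ + 1) + (J + L) :=
      ((hspec.pow (m - 1)).mul hv).natDegree_trace_le b
    rw [Derivation.leibniz_pow, map_nsmul, smul_eq_mul] at h2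
    have h4 : (Δ * derivative (Algebra.trace k[X] B (a ^ m))).natDegree =
        Δ.natDegree + ((Algebra.trace k[X] B (a ^ m)).natDegree - 1) := by
      rw [natDegree_mul hΔ, natDegree_derivative]
      intro h0
      have := derivative_eq_zero.1 h0
      omega
    have h5 := natDegree_smul_le m (Algebra.trace k[X] B (a ^ (m - 1) * δ a))
    rw [h2, h4] at h5
    have h6 : m * σ ≤ (m - 1) * (σ + 1) + (J + L) := by omega
    obtain ⟨m', rfl⟩ : ∃ m', m = m' + 1 := ⟨m - 1, by omega⟩
    rw [Nat.add_sub_cancel] at h6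
    have h7 : σ ≤ m' + (J + L) := by nlinarith
    omega
  have hdeg : ∀ j, (Algebra.trace k[X] B (a * b j)).natDegree ≤ n + J + 2 * L := by
    intro j
    have := ((Nat.find_spec hex).mul (hasWeight_basis b hL j)).natDegree_trace_le b
    omega
  have hsum : d * b.repr a i = ∑ j, U i j * Algebra.trace k[X] B (a * b j) := by
    have h1 : ∀ j, Algebra.trace k[X] B (a * b j) =
        ∑ l, Algebra.trace k[X] B (b j * b l) * b.repr a l := by
      intro j
      conv_lhs => rw [← b.sum_repr a, Finset.sum_mul, map_sum]
      refine Finset.sum_congr rfl fun l _ => ?_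
      rw [smul_mul_assoc, map_smul, smul_eq_mul, mul_comm, mul_comm (b l)]
    have h2 := congrFun (congrArg (fun M => M.mulVec (b.repr a)) hUd) i
    simp only [Matrix.smul_mulVec, Matrix.one_mulVec, Pi.smul_apply, smul_eq_mul,
      ← Matrix.mulVec_mulVec] at h2
    rw [← h2]
    simp only [h1]
    rfl
  have hle : (d * b.repr a i).natDegree ≤ J' + (n + J + 2 * L) := by
    rw [hsum]
    refine natDegree_sum_le_of_forall_le _ _ fun j _ => ?_
    exact natDegree_mul_le.trans (add_le_add (hU i j) (hdeg j))
  by_cases h0 : b.repr a i = 0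
  · simp [h0]
  · rw [natDegree_mul hd h0] at hle
    omega

/-- The trace form of a reduced algebra over a field of characteristic zero is nondegenerate. -/
theorem det_trace_ne_zero [CharZero k] [IsReduced B] :
    (Matrix.of (fun i j => Algebra.trace k[X] B (b i * b j))).det ≠ 0 := by
  intro h0
  obtain ⟨v, hv, hv0⟩ := Matrix.exists_mulVec_eq_zero_iff.2 h0
  set a := ∑ i, v i • b i with ha
  have htr : ∀ c, Algebra.trace k[X] B (c * a) = 0 := by
    intro c
    rw [← b.sum_repr c, Finset.sum_mul, map_sum]
    refine Finset.sum_eq_zero fun j _ => ?_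
    rw [smul_mul_assoc, map_smul, ha, Finset.mul_sum, map_sum]
    have := congrFun hv0 j
    simp only [Matrix.mulVec, dotProduct, Matrix.of_apply, Pi.zero_apply] at this
    simp only [mul_smul_comm, map_smul, smul_eq_mul, mul_comm (v _), this, mul_zero]
  -- All powers of `a` have trace zero, so Newton's identities with the zero subgroup give the
  -- characteristic polynomial `X ^ n`, and Cayley–Hamilton applies.
  have hnil : a ^ n = 0 := by
    let M := RingHom.mapMatrix (algebraMap k[X] (RatFunc k)) (Algebra.leftMulMatrix b a)
    have : CharZero (RatFunc k) := algebraRat.charZero _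
    have hM : M.charpoly = X ^ n := by
      ext j
      rw [coeff_X_pow]
      have hn : M.charpoly.natDegree = n := by
        rw [Matrix.charpoly_natDegree_eq_dim, Fintype.card_fin]
      rcases lt_trichotomy j n with h | h | h
      · rw [if_neg h.ne]
        have := charpoly_coeff_mem M ⊥ (by simp) (by simp) (fun m h1 _ => ?_) h
        · simpa using this
        · obtain ⟨m, rfl⟩ : ∃ m', m = m' + 1 := ⟨m - 1, by omega⟩
          have h2 : (M ^ (m + 1)).trace =
              algebraMap k[X] (RatFunc k) (Algebra.trace k[X] B (a ^ (m + 1))) := by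
            rw [Algebra.trace_eq_matrix_trace b, map_pow, ← map_pow (RingHom.mapMatrix _)]
            simp [Matrix.trace]
          rw [h2, pow_succ, htr, map_zero]
          simp
      · have := (Matrix.charpoly_monic M).coeff_natDegree
        rw [hn] at this
        rw [if_pos h, h, this]
      · rw [if_neg h.ne', coeff_eq_zero_of_natDegree_lt (by omega)]
    have h1 : M ^ n = 0 := by
      have := Matrix.aeval_self_charpoly M
      rwa [hM, map_pow, aeval_X] at this
    apply Algebra.leftMulMatrix_injective b
    rw [map_zero, map_pow]
    have hinj : Function.Injective
        (RingHom.mapMatrix (m := Fin n) (algebraMap k[X] (RatFunc k))) :=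
      Matrix.map_injective (IsFractionRing.injective k[X] (RatFunc k))
    apply hinj
    rw [map_pow, map_zero]
    exact h1
  have ha0 : a = 0 := IsReduced.eq_zero a ⟨n, hnil⟩
  apply hv
  ext i : 1
  exact Fintype.linearIndependent_iff.1 b.linearIndependent v ha0 i

end Derivation

end TruncatedDeRham

/-! ### Generic étaleness over the polynomial ring -/

namespace TruncatedDeRham

open Polynomial Module

open scoped TensorProduct KaehlerDifferential nonZeroDivisors

theorem exists_derivation_of_injective {k B E : Type*} [CommRing k] [CommRing B] [CommRing E]
    [Algebra k B] [Algebra k E] [Algebra B E] [IsScalarTower k B E]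
    (hinj : Function.Injective (algebraMap B E)) (d : Derivation k B E)
    (h : ∀ b, ∃ c, algebraMap B E c = d b) :
    ∃ δ : Derivation k B B, ∀ b, algebraMap B E (δ b) = d b := by
  choose δ hδ using h
  refine ⟨Derivation.mk' ⟨⟨δ, fun a b => hinj ?_⟩, fun r a => hinj ?_⟩ fun a b => hinj ?_, hδ⟩
  · rw [map_add, hδ, hδ, hδ, map_add]
  · change algebraMap B E (δ (r • a)) = algebraMap B E (r • δ a)
    rw [hδ, Derivation.map_smul, Algebra.smul_def r (δ a), map_mul, hδ, ← IsScalarTower.algebraMap_apply,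
      Algebra.smul_def]
  · change algebraMap B E (δ (a * b)) = algebraMap B E (a * δ b + b * δ a)
    rw [hδ, Derivation.leibniz, map_add, map_mul, map_mul, hδ, hδ, Algebra.smul_def,
      Algebra.smul_def]

/-- In the exact sequence `B ⊗ Ω[k[X]⁄k] → Ω[B⁄k] → Ω[B⁄k[X]]` the first module is generated by
`dX`. -/
theorem exists_eq_smul_D_X {k B : Type*} [CommRing k] [CommRing B] [Algebra k B]
    [Algebra k[X] B] [IsScalarTower k k[X] B] {ω : Ω[B⁄k]}
    (h : KaehlerDifferential.map k k[X] B B ω = 0) :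
    ∃ c : B, ω = c • KaehlerDifferential.D k B (algebraMap k[X] B X) := by
  obtain ⟨t, rfl⟩ := (KaehlerDifferential.exact_mapBaseChange_map k k[X] B _).1 h
  clear h
  induction t using TensorProduct.induction_on with
  | zero => exact ⟨0, by simp⟩
  | tmul c ν =>
    obtain ⟨p, rfl⟩ := (KaehlerDifferential.polynomialEquiv k).symm.surjective ν
    refine ⟨c * algebraMap k[X] B p, ?_⟩
    rw [KaehlerDifferential.polynomialEquiv_symm, KaehlerDifferential.mapBaseChange_tmul, map_smul,
      KaehlerDifferential.map_D, mul_smul, algebraMap_smul]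
  | add t₁ t₂ h1 h2 =>
    obtain ⟨c₁, hc₁⟩ := h1
    obtain ⟨c₂, hc₂⟩ := h2
    exact ⟨c₁ + c₂, by rw [map_add, hc₁, hc₂, add_smul]⟩

section Etale

variable {k : Type*} [Field k] [CharZero k] {B : Type*} [CommRing B] [Algebra k B]
  [Algebra k[X] B] [IsScalarTower k k[X] B] [IsReduced B]

/-- A reduced finite algebra over a field of characteristic zero is étale. -/
theorem formallyEtale_of_isReduced {F E : Type*} [Field F] [CharZero F] [CommRing E] [Algebra F E]
    [Module.Finite F E] [IsReduced E] : Algebra.FormallyEtale F E := by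
  have : IsArtinianRing E := .of_finite F E
  have (I : MaximalSpectrum E) : Algebra.FormallyEtale F (E ⧸ I.asIdeal) := by
    let := Ideal.Quotient.field I.asIdeal
    exact Algebra.FormallyEtale.of_isSeparable F (E ⧸ I.asIdeal)
  exact .of_equiv ((IsArtinianRing.equivPi E).restrictScalars F).symm

variable (k B) in
/-- The total ring of fractions of `B`. -/
abbrev GenericRing : Type _ := Localization (Algebra.algebraMapSubmonoid B (k[X])⁰)

variable (k B) in
theorem formallyEtale_genericRing_field [Module.Finite k[X] B] :
    Algebra.FormallyEtale (FractionRing k[X]) (GenericRing k B) := by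
  have : Module.Finite (FractionRing k[X]) (GenericRing k B) :=
    Module.Finite.of_isLocalization k[X] B (k[X])⁰
  have : CharZero (FractionRing k[X]) := algebraRat.charZero _
  exact formallyEtale_of_isReduced

variable (k B) in
theorem formallyEtale_genericRing [Module.Finite k[X] B] :
    Algebra.FormallyEtale k[X] (GenericRing k B) := by
  have := formallyEtale_genericRing_field k B
  have : Algebra.FormallyEtale k[X] (FractionRing k[X]) := .of_isLocalization (k[X])⁰
  exact .comp k[X] (FractionRing k[X]) _

variable (k B) in
-- By étaleness the differentials of the total ring of fractions are free on `dX`; `ψ` is the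
-- coordinate, that is, contraction with `d/dX`.
theorem exists_linearMap_D_X_eq_one [Module.Finite k[X] B] :
    ∃ ψ : Ω[GenericRing k B⁄k] →ₗ[GenericRing k B] GenericRing k B,
      ψ (KaehlerDifferential.D k _ (algebraMap k[X] _ X)) = 1 := by
  have := formallyEtale_genericRing k B
  let E := GenericRing k B
  let e := KaehlerDifferential.tensorKaehlerEquivOfFormallyEtale k k[X] E
  let ψ : E ⊗[k[X]] Ω[k[X]⁄k] →ₗ[E] E :=
    (TensorProduct.AlgebraTensorModule.rid k[X] E E).toLinearMap ∘ₗ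
      TensorProduct.AlgebraTensorModule.lTensor E E
        (KaehlerDifferential.polynomialEquiv k).toLinearMap
  refine ⟨ψ ∘ₗ e.symm.toLinearMap, ?_⟩
  have h1 : e.symm (KaehlerDifferential.D k _ (algebraMap k[X] E X)) =
      1 ⊗ₜ KaehlerDifferential.D k k[X] X := by
    rw [LinearEquiv.symm_apply_eq]
    simp [e]
  change ψ (e.symm _) = 1
  rw [h1]
  simp [ψ]

variable {n : ℕ} (b : Basis (Fin n) k[X] B)

include b in
theorem algebraMap_genericRing_injective :
    Function.Injective (algebraMap B (GenericRing k B)) := by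
  refine IsLocalization.injective (M := Algebra.algebraMapSubmonoid B (k[X])⁰) _ ?_
  rintro _ ⟨q, hq, rfl⟩
  have hq0 : q ≠ 0 := nonZeroDivisors.ne_zero hq
  have := Module.Free.of_basis b
  rw [mem_nonZeroDivisors_iff_right]
  intro a ha
  rw [mul_comm, ← Algebra.smul_def] at ha
  exact (smul_eq_zero_iff_right hq0).1 ha

include b in
/-- A derivation of `B` extending a multiple of `d / dx`. -/
theorem exists_derivation_X_ne_zero : ∃ (δ : Derivation k B B) (Δ : k[X]), Δ ≠ 0 ∧
    δ (algebraMap k[X] B X) = algebraMap k[X] B Δ := by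
  have := Module.Finite.of_basis b
  let E := GenericRing k B
  obtain ⟨ψ, hψ⟩ := exists_linearMap_D_X_eq_one k B
  have hinj := algebraMap_genericRing_injective b
  let dx : Derivation k B E := (ψ.compDer (KaehlerDifferential.D k E)).compAlgebraMap B
  have hX : dx (algebraMap k[X] B X) = 1 := by
    change ψ (KaehlerDifferential.D k E (algebraMap B E (algebraMap k[X] B X))) = 1
    rw [← IsScalarTower.algebraMap_apply k[X] B E, hψ]
  have hp : ∀ p : k[X], dx (algebraMap k[X] B p) =
      algebraMap B E (algebraMap k[X] B (derivative p)) := by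
    have h : ∀ q : k[X], aeval (algebraMap k[X] B X) q = algebraMap k[X] B q := fun q => by
      rw [aeval_algebraMap_apply, aeval_X_left_apply]
    intro p
    rw [← h p, Derivation.map_aeval, hX, h, Algebra.smul_def, mul_one]
  -- `Δ` is a common denominator for the values of `d/dX` on the basis, so that `Δ · d/dX` preserves
  -- `B`.
  obtain ⟨⟨_, Δ, hΔ, rfl⟩, hint⟩ := IsLocalization.exist_integer_multiples_of_finite
    (Algebra.algebraMapSubmonoid B (k[X])⁰) (fun i => dx (b i))
  obtain ⟨δ, hδ⟩ := exists_derivation_of_injective hinj (algebraMap k[X] B Δ • dx) (by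
    intro a
    have hr : (algebraMap k[X] B Δ • dx) a ∈ (algebraMap B E).range := by
      rw [← b.sum_repr a, map_sum]
      refine sum_mem fun i _ => ?_
      rw [Algebra.smul_def, Derivation.leibniz, Derivation.smul_apply, Derivation.smul_apply, hp]
      refine add_mem ?_ ?_
      · rw [Algebra.smul_def]
        exact mul_mem ⟨_, rfl⟩ (hint i)
      · rw [Algebra.smul_def, Algebra.smul_def, ← map_mul, ← map_mul]
        exact ⟨_, rfl⟩
    exact hr)
  refine ⟨δ, Δ, nonZeroDivisors.ne_zero hΔ, hinj ?_⟩
  rw [hδ, Derivation.smul_apply, hX, Algebra.smul_def, mul_one]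

include b in
-- The module `Ω[B⁄k[X]]` is finite over `k[X]` and vanishes generically by étaleness, so a single
-- polynomial kills it.
theorem exists_smul_eq_smul_D_X : ∃ q : k[X], q ≠ 0 ∧ ∀ ω : Ω[B⁄k], ∃ c : B,
    q • ω = c • KaehlerDifferential.D k B (algebraMap k[X] B X) := by
  have := Module.Finite.of_basis b
  let E := GenericRing k B
  have := formallyEtale_genericRing_field k B
  have : Module.Finite k[X] (Ω[B⁄k[X]]) := Module.Finite.trans B _
  have hloc : IsLocalizedModule (k[X])⁰
      ((KaehlerDifferential.map k[X] (FractionRing k[X]) B E).restrictScalars k[X]) := inferInstance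
  have hex : ∀ ν : Ω[B⁄k[X]], ∃ q : k[X], q ≠ 0 ∧ q • ν = 0 := by
    intro ν
    obtain ⟨q, hq⟩ := IsLocalizedModule.exists_of_eq (S := (k[X])⁰)
      (f := (KaehlerDifferential.map k[X] (FractionRing k[X]) B E).restrictScalars k[X])
      (x₁ := ν) (x₂ := 0) (Subsingleton.elim _ _)
    rw [smul_zero] at hq
    exact ⟨q, nonZeroDivisors.ne_zero q.2, hq⟩
  obtain ⟨m, g, hg⟩ := Module.Finite.exists_fin (R := k[X]) (M := Ω[B⁄k[X]])
  choose q hq0 hq using hex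
  refine ⟨∏ i, q (g i), Finset.prod_ne_zero_iff.2 fun i _ => hq0 _, fun ω => ?_⟩
  have hkill : ∀ ν : Ω[B⁄k[X]], (∏ i, q (g i)) • ν = 0 := by
    intro ν
    have hν : ν ∈ Submodule.span k[X] (Set.range g) := hg ▸ Submodule.mem_top
    refine Submodule.span_induction ?_ (smul_zero _) ?_ ?_ hν
    · rintro _ ⟨i, rfl⟩
      rw [← Finset.prod_erase_mul _ _ (Finset.mem_univ i), mul_smul, hq, smul_zero]
    · intro _ _ _ _ h1 h2
      rw [smul_add, h1, h2, add_zero]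
    · intro r _ _ h1
      rw [smul_comm, h1, smul_zero]
  have h0 : KaehlerDifferential.map k k[X] B B ((∏ i, q (g i)) • ω) = 0 := by
    rw [← algebraMap_smul B, map_smul, algebraMap_smul, hkill]
  exact exists_eq_smul_D_X h0

end Etale

end TruncatedDeRham

/-! ### Finite-dimensionality of `H¹` of a curve by a dimension count -/

namespace TruncatedDeRham

open Polynomial Module

open scoped KaehlerDifferential

section Growth

variable {k : Type*} [Field k] {B : Type*} [CommRing B] [Algebra k B] [Algebra k[X] B]
  [IsScalarTower k k[X] B] {n : ℕ} (b : Basis (Fin n) k[X] B)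

/-- The elements of `B` whose coordinates have degree at most `j`. -/
def degreeFiltration (j : ℕ) : Submodule k B where
  carrier := {a | ∀ i, (b.repr a i).natDegree ≤ j}
  zero_mem' := by simp
  add_mem' := fun {a c} ha hc i => by
    rw [map_add]
    exact (natDegree_add_le _ _).trans (max_le (ha i) (hc i))
  smul_mem' := fun r a ha i => by
    rw [← algebraMap_smul k[X] r a, map_smul, Finsupp.smul_apply, algebraMap_smul]
    exact (natDegree_smul_le r (b.repr a i)).trans (ha i)

theorem mem_degreeFiltration {j : ℕ} {a : B} :
    a ∈ degreeFiltration b j ↔ ∀ i, (b.repr a i).natDegree ≤ j := Iff.rfl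

theorem exists_mem_degreeFiltration (a : B) : ∃ j, a ∈ degreeFiltration b j :=
  ⟨Finset.univ.sup fun i => (b.repr a i).natDegree, fun i =>
    Finset.le_sup (f := fun i => (b.repr a i).natDegree) (Finset.mem_univ i)⟩

theorem degreeFiltration_mono : Monotone (degreeFiltration (k := k) b) :=
  fun _ _ h _ ha i => (ha i).trans h

/-- The filtration step is the space of `n`-tuples of polynomials of degree at most `j`. -/
noncomputable def degreeFiltrationEquiv (j : ℕ) :
    degreeFiltration (k := k) b j ≃ₗ[k] (Fin n → degreeLT k (j + 1)) where
  toFun a i := ⟨b.repr a i, mem_degreeLT.2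
    (lt_of_le_of_lt degree_le_natDegree (by exact_mod_cast Nat.lt_succ_of_le (a.2 i)))⟩
  map_add' a c := by
    ext i : 2
    simp
  map_smul' r a := by
    ext i : 2
    simp only [Submodule.coe_smul, RingHom.id_apply, Pi.smul_apply]
    rw [← algebraMap_smul k[X] r (a : B), map_smul, Finsupp.smul_apply, algebraMap_smul]
  invFun v := ⟨b.equivFun.symm fun i => (v i : k[X]), fun i => by
    have h1 : b.repr (b.equivFun.symm fun i => (v i : k[X])) i = v i := by
      rw [← Basis.equivFun_apply, LinearEquiv.apply_symm_apply]
    rw [h1]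
    have h2 := (degree_lt_iff_coeff_zero _ _).1 (mem_degreeLT.1 (v i).2)
    exact natDegree_le_iff_coeff_eq_zero.2 fun N hN => h2 N hN⟩
  left_inv a := by
    ext
    simp
  right_inv v := by
    ext i : 2
    change b.repr (b.equivFun.symm fun i => (v i : k[X])) i = v i
    rw [← Basis.equivFun_apply, LinearEquiv.apply_symm_apply]

theorem finrank_degreeFiltration (j : ℕ) :
    finrank k (degreeFiltration (k := k) b j) = n * (j + 1) := by
  rw [(degreeFiltrationEquiv b j).finrank_eq, finrank_pi_fintype]
  simp [(degreeLTEquiv k (j + 1)).finrank_eq]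

instance (j : ℕ) : Module.Finite k (degreeFiltration (k := k) b j) :=
  have : Module.Finite k (degreeLT k (j + 1)) := .equiv (degreeLTEquiv k (j + 1)).symm
  .equiv (degreeFiltrationEquiv b j).symm

variable {δ : Derivation k B B} {Δ : k[X]}

theorem exists_derivation_mem_degreeFiltration
    (hδ : δ (algebraMap k[X] B X) = algebraMap k[X] B Δ) :
    ∃ c, ∀ j, ∀ a ∈ degreeFiltration b j, δ a ∈ degreeFiltration b (j + c) := by
  choose c hc using fun i => exists_mem_degreeFiltration b (δ (b i))
  refine ⟨Finset.univ.sup c + Δ.natDegree, fun j a ha l => ?_⟩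
  rw [← b.sum_repr a, map_sum]
  simp only [derivation_smul hδ, map_sum, map_add, map_smul, Finsupp.coe_finsetSum,
    Finset.sum_apply, Finsupp.coe_add, Pi.add_apply, Finsupp.coe_smul, Pi.smul_apply, smul_eq_mul]
  refine natDegree_sum_le_of_forall_le _ _ fun i _ => ?_
  have hci : c i ≤ Finset.univ.sup c := Finset.le_sup (Finset.mem_univ i)
  refine (natDegree_add_le _ _).trans (max_le ?_ ?_)
  · refine natDegree_mul_le.trans ?_
    have := ha i
    have := hc i l
    omega
  · refine natDegree_mul_le.trans ?_
    have h1 : (b.repr (b i) l).natDegree = 0 := by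
      rw [b.repr_self, Finsupp.single_apply]
      split_ifs <;> simp
    have h2 : (Δ * derivative (b.repr a i)).natDegree ≤ Δ.natDegree + j := by
      refine natDegree_mul_le.trans ?_
      have := natDegree_derivative_le (b.repr a i)
      have := ha i
      omega
    omega

/-- The cokernel of a derivation with finite-dimensional kernel is finite-dimensional. -/
theorem finite_coker_derivation (hδ : δ (algebraMap k[X] B X) = algebraMap k[X] B Δ) {r : ℕ}
    (hker : ∀ a, δ a = 0 → a ∈ degreeFiltration b r) :
    Module.Finite k (B ⧸ LinearMap.range δ.toLinearMap) := by
  obtain ⟨c, hc⟩ := exists_derivation_mem_degreeFiltration b hδ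
  suffices h : Module.rank k (B ⧸ LinearMap.range δ.toLinearMap) ≤ (n * (c + r + 1) : ℕ) from
    Module.rank_lt_aleph0_iff.1 (h.trans_lt (Cardinal.natCast_lt_aleph0))
  -- A finite independent set in the cokernel lives in one step `j` of the filtration. Rank–nullity
  -- for `δ` from step `j` to step `j + c` bounds its size by `n (j + c + 1) - n (j + 1) + n (r +
  -- 1)`, which does not involve `j`.
  refine rank_le fun s hs => ?_
  choose w hw using fun v : s => Submodule.mkQ_surjective (LinearMap.range δ.toLinearMap) v.1
  choose m hm using fun v => exists_mem_degreeFiltration b (w v)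
  set j := Finset.univ.sup m with hj
  let δj : degreeFiltration b j →ₗ[k] degreeFiltration b (j + c) :=
    δ.toLinearMap.restrict (hc j)
  let Q := degreeFiltration b (j + c) ⧸ LinearMap.range δj
  let φ : Q →ₗ[k] B ⧸ LinearMap.range δ.toLinearMap :=
    Submodule.mapQ _ _ (Submodule.subtype _) (by
      rintro _ ⟨a, rfl⟩
      exact ⟨a, rfl⟩)
  let w' : s → Q := fun v => Submodule.Quotient.mk
    ⟨w v, degreeFiltration_mono b ((Finset.le_sup (Finset.mem_univ v)).trans
      (Nat.le_add_right _ _)) (hm v)⟩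
  have hw' : LinearIndependent k w' := by
    refine LinearIndependent.of_comp φ ?_
    have : φ ∘ w' = fun v : s => (v : B ⧸ LinearMap.range δ.toLinearMap) := by
      ext v
      exact hw v
    rwa [this]
  have h1 := hw'.fintype_card_le_finrank
  rw [Fintype.card_coe] at h1
  have h2 := LinearMap.finrank_range_add_finrank_ker δj
  have h3 := Submodule.finrank_quotient_add_finrank (LinearMap.range δj)
  have h4 : finrank k (LinearMap.ker δj) ≤ finrank k (degreeFiltration (k := k) b r) := by
    let ι : LinearMap.ker δj →ₗ[k] degreeFiltration b r :=
      LinearMap.codRestrict _ (Submodule.subtype _ ∘ₗ Submodule.subtype _) (fun a =>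
        hker _ (congrArg Subtype.val a.2))
    refine LinearMap.finrank_le_finrank_of_injective (f := ι) fun a c h => ?_
    have := congrArg Subtype.val h
    exact Subtype.ext (Subtype.ext this)
  simp only [finrank_degreeFiltration] at h2 h3 h4
  have h5 : n * (j + c + 1) + n * (r + 1) = n * (c + r + 1) + n * (j + 1) := by ring
  change finrank k Q + _ = _ at h3
  omega

theorem exists_natDegree_le {R : Type*} [Semiring R] {ι κ : Type*} [Fintype ι] [Fintype κ]
    (U : ι → κ → R[X]) : ∃ J, ∀ i j, (U i j).natDegree ≤ J :=
  ⟨Finset.univ.sup fun ij : ι × κ => (U ij.1 ij.2).natDegree, fun i j =>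
    Finset.le_sup (f := fun ij : ι × κ => (U ij.1 ij.2).natDegree) (Finset.mem_univ (i, j))⟩

/-- The case `J = 0` of the degree bound for primitives; the adjugate of the trace form serves as
its inverse up to the determinant. -/
theorem exists_ker_derivation_le [CharZero k] [IsReduced B]
    (hδ : δ (algebraMap k[X] B X) = algebraMap k[X] B Δ) (hΔ : Δ ≠ 0) :
    ∃ r, ∀ a, δ a = 0 → a ∈ degreeFiltration b r := by
  have hL : ∃ L, ∀ i j l, (b.repr (b i * b j) l).natDegree ≤ L := by
    choose L hL using fun ij : Fin n × Fin n => exists_mem_degreeFiltration b (b ij.1 * b ij.2)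
    exact ⟨Finset.univ.sup L, fun i j l =>
      (hL (i, j) l).trans (Finset.le_sup (f := L) (Finset.mem_univ _))⟩
  obtain ⟨L, hL⟩ := hL
  obtain ⟨J', hJ'⟩ := exists_natDegree_le
    (Matrix.adjugate (Matrix.of fun i j => Algebra.trace k[X] B (b i * b j)))
  refine ⟨J' + (n + 0 + 2 * L), fun a ha => (mem_degreeFiltration b).2 fun i => ?_⟩
  have ha' : ∀ i, (b.repr (δ a) i).natDegree ≤ 0 := fun i => by rw [ha]; simp
  exact natDegree_repr_le_of_derivation b hδ hΔ hL hJ' (det_trace_ne_zero b)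
    (Matrix.adjugate_mul _) ha' i

/-- A torsion module of finite type over `k[X]` is finite-dimensional. -/
theorem finite_of_smul_eq_zero {N : Type*} [AddCommGroup N] [Module k N] [Module k[X] N]
    [IsScalarTower k k[X] N] [Module.Finite k[X] N] {q : k[X]} (hq : q ≠ 0)
    (h : ∀ v : N, q • v = 0) : Module.Finite k N := by
  obtain ⟨m, g, hg⟩ := Module.Finite.exists_fin (R := k[X]) (M := N)
  have : Module.Finite k (degreeLT k q.natDegree) := .equiv (degreeLTEquiv k q.natDegree).symm
  let φ : (Fin m → degreeLT k q.natDegree) →ₗ[k] N :=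
    LinearMap.lsum k (fun _ => degreeLT k q.natDegree) k fun i =>
      ((LinearMap.toSpanSingleton k[X] N (g i)).restrictScalars k) ∘ₗ Submodule.subtype _
  refine Module.Finite.of_surjective φ fun v => ?_
  have hv : v ∈ Submodule.span k[X] (Set.range g) := hg ▸ Submodule.mem_top
  obtain ⟨p, rfl⟩ := (Submodule.mem_span_range_iff_exists_fun _).1 hv
  refine ⟨fun i => ⟨p i % q, mem_degreeLT.2 ?_⟩, ?_⟩
  · rw [← degree_eq_natDegree hq]
    exact EuclideanDomain.mod_lt _ hq
  · simp only [φ, LinearMap.lsum_apply, LinearMap.sum_apply, LinearMap.comp_apply,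
      LinearMap.proj_apply]
    refine Finset.sum_congr rfl fun i _ => ?_
    change (p i % q) • g i = p i • g i
    conv_rhs => rw [← EuclideanDomain.div_add_mod (p i) q]
    rw [add_smul, mul_smul, smul_comm, h, smul_zero, zero_add]

theorem finite_of_finite_ker {V W : Type*} [AddCommGroup V] [Module k V] [AddCommGroup W]
    [Module k W] [Module.Finite k W] (φ : V →ₗ[k] W) [Module.Finite k (LinearMap.ker φ)] :
    Module.Finite k V := by
  have : Module.Finite k (V ⧸ LinearMap.ker φ) :=
    Module.Finite.of_injective ((LinearMap.ker φ).liftQ φ le_rfl)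
      (LinearMap.ker_eq_bot.1 (Submodule.ker_liftQ_eq_bot _ _ _ le_rfl))
  exact Module.Finite.of_submodule_quotient (LinearMap.ker φ)

include b in
/-- The first truncated De Rham cohomology of a reduced affine curve over a field of
characteristic zero is finite-dimensional. -/
theorem finite_coker_D [CharZero k] [IsReduced B] :
    Module.Finite k (Ω[B⁄k] ⧸ LinearMap.range (KaehlerDifferential.D k B).toLinearMap) := by
  have := Module.Finite.of_basis b
  have := Module.Free.of_basis b
  obtain ⟨δ, Δ, hΔ, hδ⟩ := exists_derivation_X_ne_zero b
  obtain ⟨q, hq, hqω⟩ := exists_smul_eq_smul_D_X b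
  have : Algebra.FiniteType k B := .trans (S := k[X]) inferInstance inferInstance
  have : Module.Finite k[X] (Ω[B⁄k]) := Module.Finite.trans B _
  let δ' := δ.liftKaehlerDifferential
  -- The forms that contract to zero with `δ` are torsion: if `q v = c dX`, contraction gives `c Δ =
  -- 0`, so `c = 0` and `q v = 0`.
  let T : Submodule k[X] (Ω[B⁄k]) := (LinearMap.ker δ').restrictScalars k[X]
  have hT : Module.Finite k T := by
    refine finite_of_smul_eq_zero hq fun v => ?_
    obtain ⟨c, hc⟩ := hqω v
    have h1 := congrArg δ' hc
    have h2 : δ' (q • v.1) = 0 := by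
      rw [← algebraMap_smul B q, map_smul, (v.2 : δ' v.1 = 0), smul_zero]
    rw [h2, map_smul, Derivation.liftKaehlerDifferential_comp_D, hδ, smul_eq_mul, mul_comm,
      ← Algebra.smul_def] at h1
    have hc0 : c = 0 := (smul_eq_zero_iff_right hΔ).1 h1.symm
    ext
    rw [hc0, zero_smul] at hc
    exact hc
  have hcok : Module.Finite k (B ⧸ LinearMap.range δ.toLinearMap) := by
    obtain ⟨r, hr⟩ := exists_ker_derivation_le b hδ hΔ
    exact finite_coker_derivation b hδ hr
  let H := Ω[B⁄k] ⧸ LinearMap.range (KaehlerDifferential.D k B).toLinearMap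
  let φ : H →ₗ[k] B ⧸ LinearMap.range δ.toLinearMap :=
    Submodule.mapQ _ _ (δ'.restrictScalars k) (by
      rintro _ ⟨a, rfl⟩
      exact ⟨a, (Derivation.liftKaehlerDifferential_comp_D δ a).symm⟩)
  -- A form whose contraction is `δ a` differs from `da` by an element of `T`; so both the kernel
  -- and the target of `φ` are finite-dimensional.
  have hφ : LinearMap.ker φ ≤ (T.restrictScalars k).map (Submodule.mkQ _) := by
    intro v hv
    obtain ⟨ω, rfl⟩ := Submodule.mkQ_surjective _ v
    have h1 : (Submodule.Quotient.mk (δ' ω) : B ⧸ LinearMap.range δ.toLinearMap) = 0 := hv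
    rw [Submodule.Quotient.mk_eq_zero] at h1
    obtain ⟨a, ha⟩ := h1
    refine ⟨ω - KaehlerDifferential.D k B a, ?_, ?_⟩
    · change δ' (ω - KaehlerDifferential.D k B a) = 0
      rw [map_sub, Derivation.liftKaehlerDifferential_comp_D, sub_eq_zero]
      exact ha.symm
    · rw [map_sub, sub_eq_self, Submodule.mkQ_apply, Submodule.Quotient.mk_eq_zero]
      exact ⟨a, rfl⟩
  have hT' : Module.Finite k (T.restrictScalars k) := hT
  have : Module.Finite k (LinearMap.ker φ) := Submodule.finiteDimensional_of_le hφ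
  exact finite_of_finite_ker φ

end Growth

end TruncatedDeRham

/-! ### Dimension and Noether normalization of the generic fibre -/

namespace TruncatedDeRham

open Polynomial Module

open scoped nonZeroDivisors

section Integral

variable {S T : Type*} [CommRing S] [CommRing T] [Algebra S T] [Algebra.IsIntegral S T]

theorem ringKrullDim_le_of_isIntegral : ringKrullDim T ≤ ringKrullDim S := by
  refine Order.krullDim_le_of_strictMono (PrimeSpectrum.comap (algebraMap S T)) fun p q h => ?_
  exact Ideal.IsIntegral.comap_lt_comap (R := S) (I := p.asIdeal) (J := q.asIdeal) h

/-- Lying over and going up lift a chain of primes one step at a time. -/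
theorem ringKrullDim_le_of_isIntegral_of_injective (hinj : Function.Injective (algebraMap S T)) :
    ringKrullDim S ≤ ringKrullDim T := by
  have key : ∀ n : ℕ, ∀ l : LTSeries (PrimeSpectrum S), l.length = n →
      ∃ l' : LTSeries (PrimeSpectrum T), l'.length = n ∧
        Ideal.comap (algebraMap S T) l'.last.asIdeal = l.last.asIdeal := by
    intro n
    induction n with
    | zero =>
      intro l hl
      obtain ⟨Q, -, hQ, hQl⟩ := Ideal.exists_ideal_over_prime_of_isIntegral (S := T)
        l.last.asIdeal ⊥ (by
          rw [← RingHom.ker_eq_comap_bot, (RingHom.injective_iff_ker_eq_bot _).1 hinj]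
          exact bot_le)
      exact ⟨RelSeries.singleton _ ⟨Q, hQ⟩, rfl, hQl⟩
    | succ n ih =>
      intro l hl
      obtain ⟨l', hl', hlast⟩ := ih l.eraseLast (by simp [hl])
      have hlt : l.eraseLast.last < l.last := RelSeries.eraseLast_last_rel_last l (by omega)
      obtain ⟨Q, hQ1, hQ, hQl⟩ := Ideal.exists_ideal_over_prime_of_isIntegral (S := T)
        l.last.asIdeal l'.last.asIdeal (by rw [hlast]; exact hlt.le)
      have hlt' : l'.last < ⟨Q, hQ⟩ := by
        refine lt_of_le_of_ne hQ1 fun h => hlt.ne ?_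
        ext1
        rw [← hlast, ← hQl, h]
      exact ⟨l'.snoc ⟨Q, hQ⟩ hlt', by simp [hl'], by simpa using hQl⟩
  refine iSup_le fun l => ?_
  obtain ⟨l', hl', -⟩ := key _ l rfl
  rw [← hl']
  exact Order.LTSeries.length_le_krullDim l'

end Integral

section GenericCurve

universe u

variable {A : Type u} [CommRing A] [Algebra ℂ A] [Algebra ℂ[X] A] [IsScalarTower ℂ ℂ[X] A]

theorem sub_algebraMap_eq (y : ℂ) :
    algebraMap ℂ[X] A X - algebraMap ℂ A y = algebraMap ℂ[X] A (X - C y) := by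
  rw [map_sub, ← algebraMap_eq, ← IsScalarTower.algebraMap_apply]

/-- A maximal ideal is a point, and the base coordinate minus its value there vanishes at it. -/
theorem not_isMaximal_of_disjoint [Algebra.FiniteType ℂ A] {q : Ideal A}
    (h : ∀ p : ℂ[X], p ≠ 0 → algebraMap ℂ[X] A p ∉ q) : ¬ q.IsMaximal := by
  intro hm
  obtain ⟨x, rfl⟩ := exists_point_of_isMaximal q
  refine h _ (X_sub_C_ne_zero (x (algebraMap ℂ[X] A X))) ?_
  rw [← sub_algebraMap_eq]
  simp [RingHom.mem_ker]

theorem algebraMap_notMem_comap (P : Ideal (GenericRing ℂ A)) [hP : P.IsPrime] {p : ℂ[X]}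
    (hp : p ≠ 0) : algebraMap ℂ[X] A p ∉ P.comap (algebraMap A (GenericRing ℂ A)) := by
  intro h
  have hu := IsLocalization.map_units (GenericRing ℂ A)
    (⟨_, p, mem_nonZeroDivisors_of_ne_zero hp, rfl⟩ :
      Algebra.algebraMapSubmonoid A (ℂ[X])⁰)
  exact hP.ne_top (Ideal.eq_top_of_isUnit_mem _ h hu)

/-- A chain of primes of the generic fibre contracts to a chain in `A` whose last member is not
maximal, so it can be prolonged by one step. -/
theorem ringKrullDim_genericRing_le [Algebra.FiniteType ℂ A] {d : ℕ}
    (hdim : ringKrullDim A ≤ (d + 1 : ℕ)) : ringKrullDim (GenericRing ℂ A) ≤ d := by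
  let M := Algebra.algebraMapSubmonoid A (ℂ[X])⁰
  have hmono : StrictMono (PrimeSpectrum.comap (algebraMap A (GenericRing ℂ A))) := by
    refine Monotone.strictMono_of_injective (fun p q h => ?_)
      (PrimeSpectrum.localization_comap_injective _ M)
    exact Ideal.comap_mono h
  refine iSup_le fun l => ?_
  have hlast : ¬ (PrimeSpectrum.comap (algebraMap A (GenericRing ℂ A)) l.last).asIdeal.IsMaximal :=
    not_isMaximal_of_disjoint fun p hp => algebraMap_notMem_comap l.last.asIdeal hp
  obtain ⟨m, hm, hle⟩ := Ideal.exists_le_maximal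
    (PrimeSpectrum.comap (algebraMap A (GenericRing ℂ A)) l.last).asIdeal (Ideal.IsPrime.ne_top')
  have hlt : (l.map _ hmono).last < (⟨m, hm.isPrime⟩ : PrimeSpectrum A) := by
    rw [LTSeries.last_map]
    exact lt_of_le_of_ne hle fun h => hlast (by rw [h]; exact hm)
  have h1 := (Order.LTSeries.length_le_krullDim ((l.map _ hmono).snoc _ hlt)).trans hdim
  simp only [RelSeries.snoc_length, LTSeries.map_length] at h1
  have h2 : l.length + 1 ≤ d + 1 := by exact_mod_cast h1
  exact_mod_cast Nat.le_of_succ_le_succ h2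

theorem comap_mem_minimalPrimes {P : Ideal (GenericRing ℂ A)}
    (hP : P ∈ minimalPrimes (GenericRing ℂ A)) :
    P.comap (algebraMap A (GenericRing ℂ A)) ∈ minimalPrimes A := by
  have := IsLocalization.minimalPrimes_map (Algebra.algebraMapSubmonoid A (ℂ[X])⁰)
    (GenericRing ℂ A) (⊥ : Ideal A)
  rw [Ideal.map_bot] at this
  exact (Set.ext_iff.1 this P).1 hP

theorem ringKrullDim_le_one_of_isAlgebraic {D : Type u} [CommRing D] [IsDomain D] [Algebra ℂ D]
    [Algebra ℂ[X] D] [IsScalarTower ℂ ℂ[X] D] [Algebra.FiniteType ℂ D]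
    (hinj : Function.Injective (algebraMap ℂ[X] D)) [Algebra.IsAlgebraic ℂ[X] D] :
    ringKrullDim D ≤ 1 := by
  have : FaithfulSMul ℂ[X] D := (faithfulSMul_iff_algebraMap_injective _ _).2 hinj
  have htr : Algebra.trdeg ℂ D = 1 := by
    have h1 := lift_trdeg_add_eq ℂ ℂ[X] D
    rw [trdeg_eq_zero (R := ℂ[X]), Polynomial.trdeg_of_isDomain] at h1
    simpa using h1.symm
  obtain ⟨s, g, hg, hfin⟩ := exists_finite_inj_algHom_of_fg ℂ D
  have hs : s ≤ 1 := by
    have h1 : AlgebraicIndependent ℂ (fun i => g (MvPolynomial.X i)) := by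
      have : MvPolynomial.aeval (fun i => g (MvPolynomial.X i)) = g := by
        ext i
        simp
      rw [AlgebraicIndependent, this]
      exact hg
    have h2 := h1.lift_cardinalMk_le_trdeg
    rw [htr] at h2
    simpa using h2
  let _ : Algebra (MvPolynomial (Fin s) ℂ) D := g.toRingHom.toAlgebra
  have : Module.Finite (MvPolynomial (Fin s) ℂ) D := hfin
  refine (ringKrullDim_le_of_isIntegral (S := MvPolynomial (Fin s) ℂ)).trans ?_
  rw [MvPolynomial.ringKrullDim_of_isNoetherianRing, ringKrullDim_eq_zero_of_field, zero_add]
  simpa using hs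

/-- The components of the generic fibre are not finite over the base field. -/
theorem not_isIntegral_quotient [Algebra.FiniteType ℂ A]
    (hdim : ∀ p ∈ minimalPrimes A, ringKrullDim (A ⧸ p) = 2) {P : Ideal (GenericRing ℂ A)}
    (hP : P ∈ minimalPrimes (GenericRing ℂ A)) :
    ¬ Algebra.IsIntegral (FractionRing ℂ[X]) (GenericRing ℂ A ⧸ P) := by
  intro hint
  have hprime : P.IsPrime := hP.1.1
  set 𝔭 := P.comap (algebraMap A (GenericRing ℂ A)) with h𝔭
  have hinj : Function.Injective (algebraMap ℂ[X] (A ⧸ 𝔭)) := by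
    rw [injective_iff_map_eq_zero]
    intro p hp
    by_contra hp0
    rw [IsScalarTower.algebraMap_apply ℂ[X] A (A ⧸ 𝔭), Ideal.Quotient.algebraMap_eq,
      Ideal.Quotient.eq_zero_iff_mem] at hp
    exact algebraMap_notMem_comap P hp0 hp
  -- Integrality over the field makes the component `A / 𝔭` algebraic over `ℂ[X]`, hence of
  -- dimension at most `1`, whereas it has dimension `2`.
  have : Algebra.IsAlgebraic ℂ[X] (A ⧸ 𝔭) := by
    refine ⟨fun c => ?_⟩
    obtain ⟨c, rfl⟩ := Ideal.Quotient.mk_surjective c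
    have h1 : IsAlgebraic ℂ[X] (Ideal.Quotient.mk P (algebraMap A (GenericRing ℂ A) c)) :=
      (IsFractionRing.isAlgebraic_iff ℂ[X] (FractionRing ℂ[X]) _).2
        (hint.isIntegral _).isAlgebraic
    obtain ⟨q, hq, hq0⟩ := h1
    refine ⟨q, hq, ?_⟩
    have h2 : aeval c q ∈ 𝔭 := by
      rw [h𝔭, Ideal.mem_comap, ← aeval_algebraMap_apply, ← Ideal.Quotient.eq_zero_iff_mem]
      rw [← Ideal.Quotient.mkₐ_eq_mk ℂ[X], ← aeval_algHom_apply]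
      exact hq0
    rw [← Ideal.Quotient.mkₐ_eq_mk ℂ[X], aeval_algHom_apply, Ideal.Quotient.mkₐ_eq_mk,
      Ideal.Quotient.eq_zero_iff_mem]
    exact h2
  have h1 := ringKrullDim_le_one_of_isAlgebraic hinj
  rw [hdim 𝔭 (comap_mem_minimalPrimes hP)] at h1
  exact absurd h1 (by decide)

variable (A) in
theorem finiteType_genericRing [Algebra.FiniteType ℂ A] :
    Algebra.FiniteType (FractionRing ℂ[X]) (GenericRing ℂ A) := by
  classical
  have : Algebra.FiniteType ℂ[X] A := .of_restrictScalars_finiteType ℂ ℂ[X] A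
  obtain ⟨s, hs⟩ := this
  refine ⟨s.image (algebraMap A (GenericRing ℂ A)), top_unique fun c _ => ?_⟩
  obtain ⟨a, ⟨_, r, hr, rfl⟩, rfl⟩ := IsLocalization.exists_mk'_eq
    (Algebra.algebraMapSubmonoid A (ℂ[X])⁰) c
  set S := Algebra.adjoin (FractionRing ℂ[X])
    (s.image (algebraMap A (GenericRing ℂ A)) : Set (GenericRing ℂ A))
  have ha : algebraMap A (GenericRing ℂ A) a ∈ S := by
    have h1 : (⊤ : Subalgebra ℂ[X] A) ≤ (S.restrictScalars ℂ[X]).comap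
        (IsScalarTower.toAlgHom ℂ[X] A (GenericRing ℂ A)) := by
      rw [← hs, Algebra.adjoin_le_iff]
      intro b hb
      exact Algebra.subset_adjoin (by simpa using ⟨b, hb, rfl⟩)
    exact h1 (Algebra.mem_top (x := a))
  have h2 : IsLocalization.mk' (GenericRing ℂ A) a (⟨_, r, hr, rfl⟩ : Algebra.algebraMapSubmonoid A (ℂ[X])⁰) =
      (algebraMap ℂ[X] (FractionRing ℂ[X]) r)⁻¹ • algebraMap A (GenericRing ℂ A) a := by
    have hr0 : algebraMap ℂ[X] (FractionRing ℂ[X]) r ≠ 0 := by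
      simpa using nonZeroDivisors.ne_zero hr
    rw [eq_inv_smul_iff₀ hr0, algebraMap_smul, Algebra.smul_def,
      IsScalarTower.algebraMap_apply ℂ[X] A (GenericRing ℂ A)]
    exact IsLocalization.mk'_spec' (GenericRing ℂ A) a
      (⟨_, r, hr, rfl⟩ : Algebra.algebraMapSubmonoid A (ℂ[X])⁰)
  rw [h2]
  exact S.smul_mem ha _

/-- Noether normalization of the generic fibre. -/
theorem exists_aeval_finite (hA : IsAffineSurface A)
    (hdom : ∀ p : ℂ[X], p ≠ 0 → algebraMap ℂ[X] A p ∈ nonZeroDivisors A) :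
    ∃ x : A, (aeval (R := FractionRing ℂ[X]) (algebraMap A (GenericRing ℂ A) x)).Finite ∧
      ∀ p : (FractionRing ℂ[X])[X], p ≠ 0 → ∀ c : GenericRing ℂ A,
        aeval (algebraMap A (GenericRing ℂ A) x) p * c = 0 → c = 0 := by
  have := hA.finiteType
  have := hA.isReduced
  have := hA.nontrivial
  set K := FractionRing ℂ[X] with hK
  set E := GenericRing ℂ A with hE
  have hM : Algebra.algebraMapSubmonoid A (ℂ[X])⁰ ≤ nonZeroDivisors A := by
    rintro _ ⟨p, hp, rfl⟩
    exact hdom p (nonZeroDivisors.ne_zero hp)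
  have hnt : Nontrivial E := (IsLocalization.injective E hM).nontrivial
  have hft : Algebra.FiniteType K E := finiteType_genericRing A
  obtain ⟨s, g, hg, hfin⟩ := exists_finite_inj_algHom_of_fg K E
  obtain ⟨P, hP⟩ : (minimalPrimes E).Nonempty :=
    Set.nonempty_coe_sort.1 (Ideal.nonempty_minimalPrimes (I := (⊥ : Ideal E)) bot_ne_top)
  -- Exactly one normalizing variable is needed: the dimension is at most `1`, and with no variable
  -- the generic fibre would be finite over `K`.
  have hs1 : s ≤ 1 := by
    have h1 : ringKrullDim E ≤ (1 : ℕ) := ringKrullDim_genericRing_le hA.ringKrullDim_le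
    let _ : Algebra (MvPolynomial (Fin s) K) E := g.toRingHom.toAlgebra
    have : Module.Finite (MvPolynomial (Fin s) K) E := hfin
    have h2 := (ringKrullDim_le_of_isIntegral_of_injective (S := MvPolynomial (Fin s) K)
      (T := E) hg).trans h1
    rw [MvPolynomial.ringKrullDim_of_isNoetherianRing, ringKrullDim_eq_zero_of_field,
      zero_add] at h2
    simpa using h2
  have hs0 : s ≠ 0 := by
    rintro rfl
    refine not_isIntegral_quotient hA.equidimensional hP ?_
    have h1 : (g.comp (MvPolynomial.isEmptyAlgEquiv K (Fin 0)).symm.toAlgHom).Finite :=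
      hfin.comp (.of_surjective _ (MvPolynomial.isEmptyAlgEquiv K (Fin 0)).symm.surjective)
    have h2 : Module.Finite K E := by
      have h3 : (Algebra.ofId K E).Finite := by
        convert h1
        exact Subsingleton.elim _ _
      exact h3
    have := Algebra.IsIntegral.of_finite K E
    infer_instance
  obtain rfl : s = 1 := by omega
  obtain ⟨x₀, hx₀⟩ : ∃ x₀ : E, (aeval (R := K) x₀).Finite := by
    refine ⟨g (MvPolynomial.X 0), ?_⟩
    have h1 : (g.comp (MvPolynomial.uniqueAlgEquiv K (Fin 1)).symm.toAlgHom).Finite :=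
      hfin.comp (.of_surjective _ (MvPolynomial.uniqueAlgEquiv K (Fin 1)).symm.surjective)
    convert h1
    ext
    simp
  -- Multiplication by the denominator, a nonzero constant of `K`, moves the coordinate into `A` and
  -- merely rescales the variable.
  obtain ⟨x, hx⟩ : ∃ x : A, (aeval (R := K) (algebraMap A E x)).Finite := by
    obtain ⟨a, ⟨_, r, hr, rfl⟩, rfl⟩ := IsLocalization.exists_mk'_eq
      (Algebra.algebraMapSubmonoid A (ℂ[X])⁰) x₀
    have hr0 : algebraMap ℂ[X] K r ≠ 0 := by
      simpa [hK] using nonZeroDivisors.ne_zero hr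
    refine ⟨a, ?_⟩
    have h1 : Function.Surjective (aeval (R := K) (C (algebraMap ℂ[X] K r) * X : K[X])) := by
      intro p
      refine ⟨aeval (C (algebraMap ℂ[X] K r)⁻¹ * X) p, ?_⟩
      rw [← aeval_algHom_apply]
      have : aeval (R := K) (C (algebraMap ℂ[X] K r) * X : K[X])
          (C (algebraMap ℂ[X] K r)⁻¹ * X) = X := by
        rw [map_mul, aeval_C, aeval_X, algebraMap_eq, ← mul_assoc, ← C_mul, inv_mul_cancel₀ hr0,
          C_1, one_mul]
      rw [this, aeval_X_left_apply]
    have h2 := hx₀.comp (.of_surjective _ h1)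
    convert h2
    ext
    simp only [aeval_X, AlgHom.coe_comp, Function.comp_apply, map_mul, aeval_C]
    rw [← IsScalarTower.algebraMap_apply ℂ[X] K E, IsScalarTower.algebraMap_apply ℂ[X] A E]
    exact (IsLocalization.mk'_spec' _ _ _).symm
  refine ⟨x, hx, fun p hp c hpc => ?_⟩
  -- Were `p(x)` in a minimal prime `Q`, then `x` would be algebraic modulo `Q` and `E / Q` integral
  -- over `K`. In a reduced ring an element outside all minimal primes is a nonzerodivisor.
  have hmin : ∀ Q ∈ minimalPrimes E, aeval (algebraMap A E x) p ∉ Q := by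
    intro Q hQ hmem
    refine not_isIntegral_quotient hA.equidimensional hQ ⟨fun c => ?_⟩
    have hxi : IsIntegral K (Ideal.Quotient.mk Q (algebraMap A E x)) := by
      rw [← isAlgebraic_iff_isIntegral]
      refine ⟨p, hp, ?_⟩
      rw [← Ideal.Quotient.mkₐ_eq_mk K, aeval_algHom_apply, Ideal.Quotient.mkₐ_eq_mk,
        Ideal.Quotient.eq_zero_iff_mem]
      exact hmem
    let _ : Algebra K[X] E := (aeval (R := K) (algebraMap A E x)).toRingHom.toAlgebra
    have : Module.Finite K[X] E := hx
    let S := integralClosure K (E ⧸ Q)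
    let _ : Algebra K[X] S := (aeval (R := K) (⟨_, hxi⟩ : S)).toRingHom.toAlgebra
    have : IsScalarTower K[X] S (E ⧸ Q) := by
      refine .of_algebraMap_eq fun q => ?_
      change Ideal.Quotient.mkₐ K Q (aeval (algebraMap A E x) q) =
        S.val (aeval (R := K) (⟨_, hxi⟩ : S) q)
      rw [← aeval_algHom_apply, ← aeval_algHom_apply]
      rfl
    have h1 : IsIntegral K[X] c := Algebra.IsIntegral.isIntegral c
    exact isIntegral_trans (A := S) c h1.tower_top
  have h1 : c ∈ sInf (minimalPrimes E) := by
    rw [Submodule.mem_sInf]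
    intro Q hQ
    have h0 : aeval (algebraMap A E x) p * c ∈ Q := by rw [hpc]; exact Q.zero_mem
    exact (hQ.1.1.mem_or_mem h0).resolve_left (hmin Q hQ)
  have h2 : sInf (minimalPrimes E) = nilradical E := Ideal.sInf_minimalPrimes (I := ⊥)
  have : IsReduced E := inferInstance
  rw [h2, nilradical_eq_zero] at h1
  exact h1

end GenericCurve

end TruncatedDeRham

/-! ### Finiteness of the rank of `H¹(f)` -/

namespace TruncatedDeRham

open Polynomial Module

open scoped nonZeroDivisors KaehlerDifferential TensorProduct

/-- The cokernel of the universal derivation of `B` over `k`. -/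
abbrev CokerD (k B : Type*) [CommRing k] [CommRing B] [Algebra k B] : Type _ :=
  Ω[B⁄k] ⧸ LinearMap.range (KaehlerDifferential.D k B).toLinearMap

section Relative

universe u

variable {A : Type u} [CommRing A] [Algebra ℂ A] [Algebra ℂ[X] A] [IsScalarTower ℂ ℂ[X] A]

theorem aeval_algebraMap_X_eq (p : ℂ[X]) : aeval (algebraMap ℂ[X] A X) p = algebraMap ℂ[X] A p := by
  rw [aeval_algebraMap_apply, aeval_X_left_apply]

/-- Dividing `Ω[A⁄ℂ]` by `df` gives `Ω[A⁄ℂ[X]]` when `X` acts as `f`, so relative exactness is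
exactness over `ℂ[X]`. -/
theorem mem_relExact_iff_exists_map_eq {ω : Ω[A⁄ℂ]} :
    ω ∈ relExact (algebraMap ℂ[X] A X) ↔
      ∃ a : A, KaehlerDifferential.map ℂ ℂ[X] A A ω = KaehlerDifferential.D ℂ[X] A a := by
  rw [mem_relExact_iff]
  constructor
  · rintro ⟨a, b, rfl⟩
    refine ⟨a, ?_⟩
    rw [map_add, map_smul, KaehlerDifferential.map_D, KaehlerDifferential.map_D]
    simp
  · rintro ⟨a, ha⟩
    have h0 : KaehlerDifferential.map ℂ ℂ[X] A A (ω - KaehlerDifferential.D ℂ A a) = 0 := by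
      rw [map_sub, ha, KaehlerDifferential.map_D]
      simp
    obtain ⟨c, hc⟩ := exists_eq_smul_D_X h0
    exact ⟨a, c, by rw [← hc]; abel⟩

theorem map_algebraMap_smul (p : ℂ[X]) (ω : Ω[A⁄ℂ]) :
    KaehlerDifferential.map ℂ ℂ[X] A A (algebraMap ℂ[X] A p • ω) =
      p • KaehlerDifferential.map ℂ ℂ[X] A A ω := by
  rw [map_smul, algebraMap_smul]

theorem sum_smul_mk_map_eq_zero_iff {ι : Type*} (s : Finset ι) (p : ι → ℂ[X]) (ω : ι → Ω[A⁄ℂ]) :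
    ∑ i ∈ s, p i • (Submodule.Quotient.mk (KaehlerDifferential.map ℂ ℂ[X] A A (ω i)) :
      CokerD ℂ[X] A) = 0 ↔
    ∑ i ∈ s, (⟨aeval (algebraMap ℂ[X] A X) (p i), aeval_mem_adjoin_singleton ℂ _⟩ :
      Algebra.adjoin ℂ {algebraMap ℂ[X] A X}) •
        (Submodule.Quotient.mk (ω i) : RelH1 (algebraMap ℂ[X] A X)) = 0 := by
  rw [sum_smul_mk_eq_zero_iff, mem_relExact_iff_exists_map_eq]
  have h1 : ∑ i ∈ s, p i • (Submodule.Quotient.mk (KaehlerDifferential.map ℂ ℂ[X] A A (ω i)) :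
      CokerD ℂ[X] A) = Submodule.Quotient.mk
        (∑ i ∈ s, p i • KaehlerDifferential.map ℂ ℂ[X] A A (ω i)) := by
    rw [← Submodule.mkQ_apply, map_sum]
    rfl
  rw [h1, Submodule.Quotient.mk_eq_zero, map_sum]
  simp only [aeval_algebraMap_X_eq, map_algebraMap_smul]
  exact ⟨fun ⟨a, ha⟩ => ⟨a, ha.symm⟩, fun ⟨a, ha⟩ => ⟨a, ha.symm⟩⟩

theorem linearIndependent_map_of_adjoin (hinj : Function.Injective (algebraMap ℂ[X] A))
    {ι : Type*} {ω : ι → Ω[A⁄ℂ]}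
    (h : LinearIndependent (Algebra.adjoin ℂ {algebraMap ℂ[X] A X})
      fun i => (Submodule.Quotient.mk (ω i) : RelH1 (algebraMap ℂ[X] A X))) :
    LinearIndependent ℂ[X] fun i =>
      (Submodule.Quotient.mk (KaehlerDifferential.map ℂ ℂ[X] A A (ω i)) : CokerD ℂ[X] A) := by
  rw [linearIndependent_iff'] at h ⊢
  intro s p hp i hi
  have h1 := congrArg Subtype.val (h s _ ((sum_smul_mk_map_eq_zero_iff s p ω).1 hp) i hi)
  change aeval (algebraMap ℂ[X] A X) (p i) = 0 at h1
  rw [aeval_algebraMap_X_eq] at h1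
  exact (injective_iff_map_eq_zero _).1 hinj _ h1

/-- Linear independence is preserved by passing to the generic fibre. -/
theorem linearIndependent_genericRing {ι : Type*} {ν : ι → Ω[A⁄ℂ[X]]}
    (h : LinearIndependent ℂ[X] fun i => (Submodule.Quotient.mk (ν i) : CokerD ℂ[X] A)) :
    LinearIndependent (FractionRing ℂ[X]) fun i =>
      (Submodule.Quotient.mk (KaehlerDifferential.map ℂ[X] (FractionRing ℂ[X]) A (GenericRing ℂ A)
        (ν i)) : CokerD (FractionRing ℂ[X]) (GenericRing ℂ A)) := by
  set K := FractionRing ℂ[X]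
  set E := GenericRing ℂ A
  rw [← LinearIndependent.iff_fractionRing ℂ[X] K, linearIndependent_iff']
  rw [linearIndependent_iff'] at h
  intro s p hp
  let φ := (KaehlerDifferential.map ℂ[X] K A E).restrictScalars ℂ[X]
  have h1 : (Submodule.Quotient.mk (φ (∑ i ∈ s, p i • ν i)) : CokerD K E) = 0 := by
    rw [← hp, ← Submodule.mkQ_apply, map_sum, map_sum]
    refine Finset.sum_congr rfl fun i _ => ?_
    rw [map_smul, ← algebraMap_smul K, map_smul, algebraMap_smul]
    rfl
  rw [Submodule.Quotient.mk_eq_zero] at h1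
  obtain ⟨c, hc⟩ := h1
  change KaehlerDifferential.D K E c = _ at hc
  obtain ⟨a, ⟨_, r, hr, rfl⟩, rfl⟩ := IsLocalization.exists_mk'_eq
    (Algebra.algebraMapSubmonoid A (ℂ[X])⁰) c
  have h2 : r • IsLocalization.mk' E a
      (⟨_, r, hr, rfl⟩ : Algebra.algebraMapSubmonoid A (ℂ[X])⁰) = algebraMap A E a := by
    rw [Algebra.smul_def, IsScalarTower.algebraMap_apply ℂ[X] A E]
    exact IsLocalization.mk'_spec' E a
      (⟨_, r, hr, rfl⟩ : Algebra.algebraMapSubmonoid A (ℂ[X])⁰)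
  have h3 : φ (r • ∑ i ∈ s, p i • ν i) = φ (KaehlerDifferential.D ℂ[X] A a) := by
    rw [map_smul, ← hc, ← algebraMap_smul K, ← Derivation.map_smul, algebraMap_smul, h2]
    exact (KaehlerDifferential.map_D ℂ[X] K A E a).symm
  -- The equality on the generic fibre holds over `ℂ[X]` after multiplication by some `q ≠ 0`; the
  -- relation obtained has coefficients `q * r * p i`.
  obtain ⟨q, hq⟩ := IsLocalizedModule.exists_of_eq (S := (ℂ[X])⁰) (f := φ) h3
  have h4 : ∑ i ∈ s, ((q : ℂ[X]) * r * p i) • (Submodule.Quotient.mk (ν i) : CokerD ℂ[X] A) = 0 := by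
    have h5 : (Submodule.Quotient.mk (q • r • ∑ i ∈ s, p i • ν i) : CokerD ℂ[X] A) = 0 := by
      rw [hq, Submodule.Quotient.mk_eq_zero]
      exact ⟨(q : ℂ[X]) • a, Derivation.map_smul _ _ _⟩
    rw [← h5, ← Submodule.mkQ_apply, Submonoid.smul_def, map_smul, map_smul, map_sum,
      Finset.smul_sum, Finset.smul_sum]
    refine Finset.sum_congr rfl fun i _ => ?_
    rw [mul_smul, mul_smul, map_smul]
    rfl
  intro i hi
  have h5 := h s _ h4 i hi
  rw [mul_eq_zero, mul_eq_zero] at h5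
  exact h5.resolve_left fun h6 => h6.elim (nonZeroDivisors.ne_zero q.2) (nonZeroDivisors.ne_zero hr)

end Relative

section FiniteRank

universe u

variable {A : Type u} [CommRing A] [Algebra ℂ A] [Algebra ℂ[X] A] [IsScalarTower ℂ ℂ[X] A]

/-- A finite torsion-free module over the principal ideal domain `k[X]` is free. -/
theorem exists_basis_of_aeval_finite {k B : Type*} [Field k] [CommRing B] [Algebra k B] {x : B}
    (hx : (aeval (R := k) x).Finite)
    (hx' : ∀ p : k[X], p ≠ 0 → ∀ c : B, aeval x p * c = 0 → c = 0) :
    ∃ (_ : Algebra k[X] B) (_ : IsScalarTower k k[X] B) (n : ℕ) (_ : Basis (Fin n) k[X] B),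
      algebraMap k[X] B X = x := by
  let _ : Algebra k[X] B := (aeval (R := k) x).toRingHom.toAlgebra
  have : IsScalarTower k k[X] B := .of_algebraMap_eq fun c =>
    ((aeval (R := k) x).commutes c).symm
  have : Module.Finite k[X] B := hx
  have : Module.IsTorsionFree k[X] B := by
    refine .of_smul_eq_zero fun p c h => ?_
    by_contra! h0
    exact h0.2 (hx' p h0.1 c h)
  have : Module.Free k[X] B := Module.free_of_finite_type_torsion_free'
  exact ⟨inferInstance, inferInstance, _, Module.finBasis k[X] B, aeval_X (R := k) x⟩

/-- The generic fibre is free over a polynomial ring. -/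
theorem exists_basis_genericRing (hA : IsAffineSurface A)
    (hdom : ∀ p : ℂ[X], p ≠ 0 → algebraMap ℂ[X] A p ∈ nonZeroDivisors A) :
    ∃ (x : A) (_ : Algebra (FractionRing ℂ[X])[X] (GenericRing ℂ A))
      (_ : IsScalarTower (FractionRing ℂ[X]) (FractionRing ℂ[X])[X] (GenericRing ℂ A)) (n : ℕ)
      (_ : Basis (Fin n) (FractionRing ℂ[X])[X] (GenericRing ℂ A)),
      algebraMap (FractionRing ℂ[X])[X] (GenericRing ℂ A) X = algebraMap A (GenericRing ℂ A) x := by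
  obtain ⟨x, hx, hx'⟩ := exists_aeval_finite hA hdom
  exact ⟨x, exists_basis_of_aeval_finite hx hx'⟩

theorem finite_cokerD_genericRing (hA : IsAffineSurface A)
    (hdom : ∀ p : ℂ[X], p ≠ 0 → algebraMap ℂ[X] A p ∈ nonZeroDivisors A) :
    Module.Finite (FractionRing ℂ[X]) (CokerD (FractionRing ℂ[X]) (GenericRing ℂ A)) := by
  have := hA.isReduced
  have : CharZero (FractionRing ℂ[X]) := algebraRat.charZero _
  obtain ⟨x, _, _, n, b, -⟩ := exists_basis_genericRing hA hdom
  exact finite_coker_D b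

/-- Classes independent over `ℂ[f]` remain independent in `H¹` of the generic fibre, which is
finite-dimensional over `ℂ(t)`. -/
theorem rank_relH1_lt_aleph0 (hA : IsAffineSurface A)
    (hdom : ∀ p : ℂ[X], p ≠ 0 → algebraMap ℂ[X] A p ∈ nonZeroDivisors A) :
    Module.rank (Algebra.adjoin ℂ {algebraMap ℂ[X] A X}) (RelH1 (algebraMap ℂ[X] A X)) <
      Cardinal.aleph0 := by
  have := finite_cokerD_genericRing hA hdom
  have := hA.nontrivial
  refine lt_of_le_of_lt (rank_le (n := Module.finrank (FractionRing ℂ[X])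
    (CokerD (FractionRing ℂ[X]) (GenericRing ℂ A))) fun s hs => ?_) (Cardinal.natCast_lt_aleph0)
  choose ω hω using Submodule.Quotient.mk_surjective (relExact (algebraMap ℂ[X] A X))
  have h1 : LinearIndependent (Algebra.adjoin ℂ {algebraMap ℂ[X] A X})
      fun i : s => (Submodule.Quotient.mk (ω i) : RelH1 (algebraMap ℂ[X] A X)) := by
    simpa only [hω] using hs
  have hinj : Function.Injective (algebraMap ℂ[X] A) := by
    rw [injective_iff_map_eq_zero]
    intro p hp
    by_contra h0
    exact nonZeroDivisors.ne_zero (hdom p h0) hp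
  have h2 := (linearIndependent_genericRing
    (linearIndependent_map_of_adjoin hinj h1)).fintype_card_le_finrank
  simpa using h2

end FiniteRank

end TruncatedDeRham

/-! ### Spreading out the generic fibre: frames -/

namespace TruncatedDeRham

open Polynomial Module

open scoped nonZeroDivisors KaehlerDifferential

/-- The trace form of the algebra with structure constants `γ`. -/
def traceForm {S : Type*} [CommRing S] {n : ℕ} (γ : Fin n → Fin n → Fin n → S) :
    Matrix (Fin n) (Fin n) S :=
  Matrix.of fun i j => ∑ l, γ i j l * ∑ m, γ l m m

theorem trace_mul_eq_traceForm {S B : Type*} [CommRing S] [CommRing B] [Algebra S B] {n : ℕ}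
    (b : Basis (Fin n) S B) :
    Matrix.of (fun i j => Algebra.trace S B (b i * b j)) =
      traceForm fun i j l => b.repr (b i * b j) l := by
  classical
  ext i j
  have h1 : ∀ l, Algebra.trace S B (b l) = ∑ m, b.repr (b l * b m) m := fun l => by
    rw [Algebra.trace_eq_matrix_trace b, Matrix.trace]
    simp [Algebra.leftMulMatrix_eq_repr_mul]
  rw [Matrix.of_apply]
  conv_lhs => rw [← b.sum_repr (b i * b j), map_sum]
  simp only [map_smul, h1, smul_eq_mul]
  rfl

theorem traceForm_smul {S : Type*} [CommRing S] {n : ℕ} (c : S)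
    (γ : Fin n → Fin n → Fin n → S) :
    traceForm (fun i j l => c * γ i j l) = c ^ 2 • traceForm γ := by
  ext i j
  simp only [traceForm, Matrix.of_apply, Matrix.smul_apply, smul_eq_mul, Finset.mul_sum]
  exact Finset.sum_congr rfl fun l _ => Finset.sum_congr rfl fun m _ => by ring

theorem map_traceForm {S T : Type*} [CommRing S] [CommRing T] {n : ℕ} (φ : S →+* T)
    (γ : Fin n → Fin n → Fin n → S) :
    φ.mapMatrix (traceForm γ) = traceForm fun i j l => φ (γ i j l) := by
  ext i j
  simp [traceForm, map_sum]

/-- An `R`-algebra `A` that becomes free over `R[x]`, with a nondegenerate trace form and a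
derivation which is nonzero at `x`, after the inversion of an element `s` of `R`. -/
structure Frame (R A : Type*) [CommRing R] [CommRing A] [Algebra R A] where
  /-- the coordinate -/
  x : A
  /-- the rank -/
  n : ℕ
  /-- the basis -/
  e : Fin n → A
  /-- the denominator -/
  s : R
  /-- the structure constants, up to the factor `s` -/
  γ : Fin n → Fin n → Fin n → R[X]
  /-- the derivation -/
  δ : Derivation R A A
  /-- the value of the derivation at the coordinate -/
  Δ : R[X]
  s_ne_zero : s ≠ 0
  exists_pow_smul_eq : ∀ a, ∃ (k : ℕ) (P : Fin n → R[X]), s ^ k • a = ∑ i, aeval x (P i) * e i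
  eq_zero_of_sum_eq_zero : ∀ P : Fin n → R[X], ∑ i, aeval x (P i) * e i = 0 → P = 0
  smul_mul_eq : ∀ i j, s • (e i * e j) = ∑ l, aeval x (γ i j l) * e l
  det_traceForm_ne_zero : (traceForm γ).det ≠ 0
  δ_x : δ x = aeval x Δ
  Δ_ne_zero : Δ ≠ 0

section Generic

variable {R K A E : Type*} [CommRing R] [IsDomain R] [Field K] [Algebra R K] [IsFractionRing R K]
  [CommRing A] [Algebra R A] [CommRing E] [Algebra R E] [Algebra A E] [Algebra K E]
  [IsScalarTower R A E] [IsScalarTower R K E]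

theorem exists_map_eq_C_mul {ι : Type*} [Finite ι] (q : ι → K[X]) : ∃ r : R, r ≠ 0 ∧
    ∃ P : ι → R[X], ∀ i, (P i).map (algebraMap R K) = C (algebraMap R K r) * q i := by
  let _ : Algebra R[X] K[X] := Polynomial.algebra R K
  have := Polynomial.isLocalization R⁰ K
  obtain ⟨⟨_, r, hr, rfl⟩, h⟩ := IsLocalization.exist_integer_multiples_of_finite (R⁰.map C) q
  choose P hP using h
  refine ⟨r, nonZeroDivisors.ne_zero hr, P, fun i => ?_⟩
  have := hP i
  rw [Algebra.smul_def] at this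
  simpa [Polynomial.algebraMap_def] using this

variable [Algebra K[X] E] [IsScalarTower K K[X] E] {x : A}
  (hx : algebraMap K[X] E X = algebraMap A E x)

include hx in
theorem algebraMap_aeval_eq (P : R[X]) :
    algebraMap A E (aeval x P) = algebraMap K[X] E (P.map (algebraMap R K)) := by
  rw [← aeval_algebraMap_apply, ← hx, ← aeval_map_algebraMap K, aeval_algebraMap_apply,
    aeval_X_left_apply]

variable {n : ℕ} (b : Basis (Fin n) K[X] E) {e : Fin n → A} (hb : ∀ i, b i = algebraMap A E (e i))

include hx hb in
theorem algebraMap_sum_aeval_eq (P : Fin n → R[X]) :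
    algebraMap A E (∑ i, aeval x (P i) * e i) = ∑ i, (P i).map (algebraMap R K) • b i := by
  rw [map_sum]
  refine Finset.sum_congr rfl fun i _ => ?_
  rw [map_mul, algebraMap_aeval_eq hx, hb, Algebra.smul_def]

include hx hb in
theorem exists_smul_eq_sum_aeval (hinj : Function.Injective (algebraMap A E)) {ι : Type*} [Finite ι]
    (a : ι → A) : ∃ r : R, r ≠ 0 ∧ ∃ P : ι → Fin n → R[X], (∀ j, r • a j =
      ∑ i, aeval x (P j i) * e i) ∧ ∀ j i, (P j i).map (algebraMap R K) =
        C (algebraMap R K r) * b.repr (algebraMap A E (a j)) i := by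
  obtain ⟨r, hr, P, hP⟩ := exists_map_eq_C_mul (R := R) (K := K)
    fun t : ι × Fin n => b.repr (algebraMap A E (a t.1)) t.2
  refine ⟨r, hr, fun j i => P (j, i), fun j => hinj ?_, fun j i => hP (j, i)⟩
  rw [algebraMap_sum_aeval_eq hx b hb]
  simp only [hP, mul_smul]
  rw [← Finset.smul_sum, b.sum_repr, ← algebraMap_eq, algebraMap_smul, algebraMap_smul,
    Algebra.smul_def, Algebra.smul_def, map_mul, IsScalarTower.algebraMap_apply R A E]

include hx hb in
theorem eq_zero_of_sum_aeval_eq_zero (P : Fin n → R[X]) (h : ∑ i, aeval x (P i) * e i = 0) :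
    P = 0 := by
  have h1 := congrArg (algebraMap A E) h
  rw [algebraMap_sum_aeval_eq hx b hb, map_zero] at h1
  funext i
  have h2 := Fintype.linearIndependent_iff.1 b.linearIndependent _ h1 i
  exact (Polynomial.map_eq_zero_iff (IsFractionRing.injective R K)).1 h2

/-- Let `W` consist of the elements that become combinations of the `e i` over `R[x]` after
multiplication by a power of `s`. The elements that multiply `W` into itself form a subalgebra
containing the generators `T`, so it is all of `A`; and `1 ∈ W`. -/
theorem exists_pow_smul_eq_sum_aeval (e : Fin n → A) (x : A)
    {T : Finset A} (hT : Algebra.adjoin R (T : Set A) = ⊤) {s : R}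
    (h1 : ∃ P : Fin n → R[X], s • (1 : A) = ∑ i, aeval x (P i) * e i)
    (hs : ∀ t ∈ T, ∀ j, ∃ P : Fin n → R[X], s • (t * e j) = ∑ i, aeval x (P i) * e i) (a : A) :
    ∃ (k : ℕ) (P : Fin n → R[X]), s ^ k • a = ∑ i, aeval x (P i) * e i := by
  let W : Submodule R A :=
    { carrier := {a | ∃ (k : ℕ) (P : Fin n → R[X]), s ^ k • a = ∑ i, aeval x (P i) * e i}
      zero_mem' := ⟨0, 0, by simp⟩
      add_mem' := by
        rintro a a' ⟨k, P, h⟩ ⟨k', P', h'⟩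
        refine ⟨k + k', fun i => C (s ^ k') * P i + C (s ^ k) * P' i, ?_⟩
        simp only [map_add, map_mul, aeval_C, add_mul, Finset.sum_add_distrib, mul_assoc]
        rw [← Finset.mul_sum, ← Finset.mul_sum, ← h, ← h', ← Algebra.smul_def, ← Algebra.smul_def,
          smul_smul, smul_smul, smul_add, ← pow_add, ← pow_add, add_comm k' k]
      smul_mem' := by
        rintro r a ⟨k, P, h⟩
        refine ⟨k, fun i => C r * P i, ?_⟩
        simp only [map_mul, aeval_C, mul_assoc]
        rw [← Finset.mul_sum, ← h, smul_comm, Algebra.smul_def] }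
  have hx : ∀ (Q : R[X]) (a : A), a ∈ W → aeval x Q * a ∈ W := by
    rintro Q a ⟨k, P, h⟩
    refine ⟨k, fun i => Q * P i, ?_⟩
    simp only [map_mul, mul_assoc]
    rw [← Finset.mul_sum, ← h, mul_smul_comm]
  have hdiv : ∀ (k : ℕ) (a : A), s ^ k • a ∈ W → a ∈ W := by
    rintro k a ⟨l, P, h⟩
    exact ⟨l + k, P, by rw [pow_add, mul_smul, h]⟩
  let S : Subalgebra R A :=
    { carrier := {c | ∀ a ∈ W, c * a ∈ W}
      mul_mem' := fun {c c'} hc hc' a ha => by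
        rw [mul_assoc]
        exact hc _ (hc' a ha)
      add_mem' := fun {c c'} hc hc' a ha => by
        rw [add_mul]
        exact W.add_mem (hc a ha) (hc' a ha)
      algebraMap_mem' := fun r a ha => by
        rw [← Algebra.smul_def]
        exact W.smul_mem r ha }
  have hTS : (⊤ : Subalgebra R A) ≤ S := by
    rw [← hT, Algebra.adjoin_le_iff]
    rintro t ht a ⟨k, P, h⟩
    refine hdiv k _ ?_
    rw [← mul_smul_comm, h, Finset.mul_sum]
    refine W.sum_mem fun i _ => ?_
    rw [mul_left_comm]
    refine hx _ _ (hdiv 1 _ ?_)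
    obtain ⟨Q, hQ⟩ := hs t ht i
    exact ⟨0, Q, by rw [pow_zero, one_smul, pow_one, hQ]⟩
  have h1W : (1 : A) ∈ W := by
    obtain ⟨P, hP⟩ := h1
    exact ⟨1, P, by rw [pow_one, hP]⟩
  have := hTS (Algebra.mem_top (x := a)) 1 h1W
  rwa [mul_one] at this

include hx in
-- A derivation of the generic fibre preserves `A` once it is multiplied by a common denominator
-- `r₁` of its values on algebra generators; `r₂` clears the coefficients of `Δ`.
theorem exists_derivation_of_genericRing [CharZero K] [IsReduced E] [Algebra.FiniteType R A]
    [IsLocalization (Algebra.algebraMapSubmonoid A R⁰) E]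
    (hinj : Function.Injective (algebraMap A E)) (b : Basis (Fin n) K[X] E) :
    ∃ (δ : Derivation R A A) (Δ : R[X]), Δ ≠ 0 ∧ δ x = aeval x Δ := by
  obtain ⟨δ, Δ, hΔ, hδ⟩ := exists_derivation_X_ne_zero b
  obtain ⟨T, hT⟩ := ‹Algebra.FiniteType R A›
  let d : Derivation R A E := (δ.restrictScalars R).compAlgebraMap A
  obtain ⟨⟨_, r₁, hr₁, rfl⟩, h1⟩ := IsLocalization.exist_integer_multiples_of_finite
    (Algebra.algebraMapSubmonoid A R⁰) (fun t : T => d t)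
  obtain ⟨r₂, hr₂, P, hP⟩ := exists_map_eq_C_mul (R := R) (fun _ : Unit => Δ)
  have hmem : ∀ a, ∃ c, algebraMap A E c = (algebraMap R A (r₁ * r₂) • d) a := by
    let S : Subalgebra R A :=
      { carrier := {a | (algebraMap R A (r₁ * r₂) • d) a ∈ (algebraMap A E).range}
        mul_mem' := by
          rintro a a' ⟨c, hc⟩ ⟨c', hc'⟩
          refine ⟨a * c' + a' * c, ?_⟩
          rw [Derivation.leibniz, map_add, map_mul, map_mul, hc, hc', Algebra.smul_def,
            Algebra.smul_def]
        add_mem' := fun {a a'} h h' => by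
          change (algebraMap R A (r₁ * r₂) • d) (a + a') ∈ (algebraMap A E).range
          rw [map_add]
          exact add_mem h h'
        algebraMap_mem' := fun r => by
          change (algebraMap R A (r₁ * r₂) • d) (algebraMap R A r) ∈ (algebraMap A E).range
          rw [Derivation.map_algebraMap]
          exact zero_mem _ }
    have hTS : (⊤ : Subalgebra R A) ≤ S := by
      rw [← hT, Algebra.adjoin_le_iff]
      intro t ht
      obtain ⟨c, hc⟩ := h1 ⟨t, ht⟩
      refine ⟨algebraMap R A r₂ * c, ?_⟩
      rw [Derivation.smul_apply, map_mul, map_mul, hc, mul_comm (algebraMap R A r₁), mul_smul,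
        Algebra.smul_def (algebraMap R A r₂)]
    exact fun a => hTS (Algebra.mem_top (x := a))
  obtain ⟨δ', hδ'⟩ := exists_derivation_of_injective hinj _ hmem
  refine ⟨δ', C r₁ * P (), ?_, hinj ?_⟩
  · refine mul_ne_zero (C_ne_zero.2 (nonZeroDivisors.ne_zero hr₁)) fun h0 => ?_
    have := hP ()
    rw [h0, Polynomial.map_zero, eq_comm, mul_eq_zero, C_eq_zero,
      IsFractionRing.to_map_eq_zero_iff] at this
    exact this.elim hr₂ hΔ
  · have hdx : d x = algebraMap K[X] E Δ := by
      change δ (algebraMap A E x) = _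
      rw [← hx, hδ]
    have hC : algebraMap K[X] E (C (algebraMap R K (r₁ * r₂))) =
        algebraMap A E (algebraMap R A (r₁ * r₂)) := by
      rw [← algebraMap_eq, ← IsScalarTower.algebraMap_apply K K[X] E,
        ← IsScalarTower.algebraMap_apply R K E, ← IsScalarTower.algebraMap_apply R A E]
    rw [hδ', algebraMap_aeval_eq hx, Derivation.smul_apply, hdx, Polynomial.map_mul, hP,
      Polynomial.map_C, ← mul_assoc, ← C_mul, ← map_mul (algebraMap R K),
      map_mul (algebraMap K[X] E), hC, Algebra.smul_def]

variable (R A) in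
theorem exists_basis_eq_algebraMap [IsLocalization (Algebra.algebraMapSubmonoid A R⁰) E]
    (b : Basis (Fin n) K[X] E) :
    ∃ (b' : Basis (Fin n) K[X] E) (e : Fin n → A), ∀ i, b' i = algebraMap A E (e i) := by
  obtain ⟨⟨_, r, hr, rfl⟩, h1⟩ := IsLocalization.exist_integer_multiples_of_finite
    (Algebra.algebraMapSubmonoid A R⁰) b
  choose e he using h1
  have hu : IsUnit (C (algebraMap R K r)) := by
    rw [isUnit_C, isUnit_iff_ne_zero, ne_eq, IsFractionRing.to_map_eq_zero_iff]
    exact nonZeroDivisors.ne_zero hr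
  refine ⟨b.isUnitSMul fun _ => hu, e, fun i => ?_⟩
  rw [Basis.isUnitSMul_apply, he, ← algebraMap_eq, algebraMap_smul, algebraMap_smul,
    algebraMap_smul]

include hx in
/-- The generic fibre spreads out over a dense open subset of the base. -/
theorem nonempty_frame [CharZero K] [IsReduced E] [Algebra.FiniteType R A]
    [IsLocalization (Algebra.algebraMapSubmonoid A R⁰) E]
    (hinj : Function.Injective (algebraMap A E)) (b : Basis (Fin n) K[X] E) :
    Nonempty (Frame R A) := by
  obtain ⟨δ, Δ, hΔ, hδ⟩ := exists_derivation_of_genericRing (R := R) hx hinj b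
  obtain ⟨b, e, hb⟩ := exists_basis_eq_algebraMap R A b
  obtain ⟨T, hT⟩ := ‹Algebra.FiniteType R A›
  -- The unit, the products of generators with basis elements and the products of basis elements get
  -- one common denominator `s`.
  let a : (Unit ⊕ (T × Fin n)) ⊕ (Fin n × Fin n) → A :=
    Sum.elim (Sum.elim (fun _ => 1) fun t => t.1 * e t.2) fun t => e t.1 * e t.2
  obtain ⟨s, hs, P, hP, hP'⟩ := exists_smul_eq_sum_aeval (R := R) hx b hb hinj a
  refine ⟨⟨x, n, e, s, fun i j l => P (.inr (i, j)) l, δ, Δ, hs, ?_,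
    eq_zero_of_sum_aeval_eq_zero hx b hb, fun i j => hP (.inr (i, j)), ?_, hδ, hΔ⟩⟩
  · exact exists_pow_smul_eq_sum_aeval e x hT ⟨_, hP (.inl (.inl ()))⟩
      fun t ht j => ⟨_, hP (.inl (.inr (⟨t, ht⟩, j)))⟩
  · intro h0
    -- Over `K` the trace form of `γ` is `s ^ 2` times that of the basis, which is nondegenerate
    -- because the generic fibre is reduced.
    have h1 := congrArg (Polynomial.mapRingHom (algebraMap R K)) h0
    rw [map_zero, RingHom.map_det, map_traceForm] at h1
    have h2 : (fun i j l => Polynomial.mapRingHom (algebraMap R K) (P (.inr (i, j)) l)) =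
        fun i j l => C (algebraMap R K s) * b.repr (b i * b j) l := by
      funext i j l
      rw [coe_mapRingHom, hP', hb, hb, ← map_mul]
      rfl
    rw [h2, traceForm_smul, ← trace_mul_eq_traceForm, Matrix.det_smul, mul_eq_zero] at h1
    refine h1.elim (fun h3 => ?_) (det_trace_ne_zero b)
    have := eq_zero_of_pow_eq_zero (eq_zero_of_pow_eq_zero h3)
    rw [C_eq_zero, IsFractionRing.to_map_eq_zero_iff] at this
    exact hs this

end Generic

end TruncatedDeRham

/-! ### Fibres of a frame and the uniform degree bound -/

namespace TruncatedDeRham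

open Polynomial Module

open scoped nonZeroDivisors KaehlerDifferential Matrix

universe u

theorem exists_derivation_quotient {k B : Type*} [CommRing k] [CommRing B] [Algebra k B]
    (I : Ideal B) (d : Derivation k B B) (h : ∀ a ∈ I, d a ∈ I) :
    ∃ δ : Derivation k (B ⧸ I) (B ⧸ I), ∀ b : B,
      δ (Ideal.Quotient.mk I b) = Ideal.Quotient.mk I (d b) := by
  choose o ho using Ideal.Quotient.mk_surjective (I := I)
  have key : ∀ b : B, Ideal.Quotient.mk I (d (o (Ideal.Quotient.mk I b))) =
      Ideal.Quotient.mk I (d b) := by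
    intro b
    rw [Ideal.Quotient.mk_eq_mk_iff_sub_mem, ← map_sub]
    exact h _ ((Ideal.Quotient.mk_eq_mk_iff_sub_mem _ _).1 (ho _))
  refine ⟨Derivation.mk' ⟨⟨fun q => Ideal.Quotient.mk I (d (o q)), ?_⟩, ?_⟩ ?_, key⟩
  · intro a b
    conv_lhs => rw [← ho a, ← ho b, ← map_add, key, map_add, map_add]
  · intro r a
    change Ideal.Quotient.mk I (d (o (r • a))) = r • Ideal.Quotient.mk I (d (o a))
    conv_lhs => rw [← ho a, ← Ideal.Quotient.mkₐ_eq_mk k, ← map_smul, Ideal.Quotient.mkₐ_eq_mk, key,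
      Derivation.map_smul]
    rfl
  · intro a b
    change Ideal.Quotient.mk I (d (o (a * b))) =
      a * Ideal.Quotient.mk I (d (o b)) + b * Ideal.Quotient.mk I (d (o a))
    conv_lhs => rw [← ho a, ← ho b, ← map_mul, key, Derivation.leibniz, map_add, smul_eq_mul,
      smul_eq_mul, map_mul, map_mul, ho, ho]

/-- A nilpotent element has nilpotent, hence zero, trace pairings with the basis, so its coordinates
are killed by the trace form and therefore by `d`. -/
theorem isReduced_of_mul_traceForm_eq {S B : Type*} [CommRing S] [IsDomain S] [CommRing B]
    [Algebra S B] {n : ℕ} (b : Basis (Fin n) S B) {U : Matrix (Fin n) (Fin n) S} {d : S}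
    (hd : d ≠ 0)
    (hU : U * Matrix.of (fun i j => Algebra.trace S B (b i * b j)) = d • 1) : IsReduced B := by
  refine ⟨fun a ha => ?_⟩
  have htr : Matrix.of (fun i j => Algebra.trace S B (b i * b j)) *ᵥ (b.repr a) = 0 := by
    funext i
    have h1 : Algebra.trace S B (b i * a) = 0 := by
      have h2 : IsNilpotent (b i * a) := (Commute.all _ _).isNilpotent_mul_left ha
      exact (Algebra.isNilpotent_trace_of_isNilpotent h2).eq_zero
    rw [Pi.zero_apply, ← h1]
    conv_rhs => rw [← b.sum_repr a, Finset.mul_sum, map_sum]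
    rw [Matrix.mulVec, dotProduct]
    refine Finset.sum_congr rfl fun j _ => ?_
    rw [mul_smul_comm, map_smul, smul_eq_mul, mul_comm, Matrix.of_apply]
  have h1 : d • (b.repr a : Fin n → S) = 0 := by
    have := congrArg (fun M => M *ᵥ (b.repr a : Fin n → S)) hU
    simpa only [← Matrix.mulVec_mulVec, htr, Matrix.mulVec_zero, Matrix.smul_mulVec,
      Matrix.one_mulVec] using this.symm
  rw [← b.repr.map_eq_zero_iff]
  ext i
  have h2 := congrFun h1 i
  exact (mul_eq_zero.1 h2).resolve_left hd

section

variable {A : Type u} [CommRing A] [Algebra ℂ A] [Algebra ℂ[X] A] [IsScalarTower ℂ ℂ[X] A]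

theorem IsAffineSurface.nonempty_frame (hA : IsAffineSurface A)
    (hdom : ∀ p : ℂ[X], p ≠ 0 → algebraMap ℂ[X] A p ∈ nonZeroDivisors A) :
    Nonempty (Frame ℂ[X] A) := by
  have := hA.isReduced
  have := hA.finiteType
  have : Algebra.FiniteType ℂ[X] A := .of_restrictScalars_finiteType ℂ ℂ[X] A
  have : CharZero (FractionRing ℂ[X]) := algebraRat.charZero _
  have hM : Algebra.algebraMapSubmonoid A (ℂ[X])⁰ ≤ nonZeroDivisors A := by
    rintro _ ⟨p, hp, rfl⟩
    exact hdom p (nonZeroDivisors.ne_zero hp)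
  obtain ⟨x, _, _, n, b, hx⟩ := exists_basis_genericRing hA hdom
  exact TruncatedDeRham.nonempty_frame hx (IsLocalization.injective _ hM) b

namespace Frame

/-- The coordinate ring of the fibre over `y`. -/
def Fiber (_ : Frame ℂ[X] A) (y : ℂ) : Type u := A ⧸ Ideal.span {algebraMap ℂ[X] A (X - C y)}

variable (F : Frame ℂ[X] A) (y : ℂ)

noncomputable instance : CommRing (F.Fiber y) :=
  inferInstanceAs (CommRing (A ⧸ Ideal.span {algebraMap ℂ[X] A (X - C y)}))

noncomputable instance : Algebra ℂ (F.Fiber y) :=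
  inferInstanceAs (Algebra ℂ (A ⧸ Ideal.span {algebraMap ℂ[X] A (X - C y)}))

/-- The restriction of functions to the fibre over `y`. -/
noncomputable def res : A →ₐ[ℂ] F.Fiber y :=
  Ideal.Quotient.mkₐ ℂ (Ideal.span {algebraMap ℂ[X] A (X - C y)})

theorem res_surjective : Function.Surjective (F.res y) := Ideal.Quotient.mk_surjective

variable {y} in
theorem res_eq_zero_iff {a : A} : F.res y a = 0 ↔ ∃ c, a = (X - C y) • c := by
  change Ideal.Quotient.mk _ a = 0 ↔ _
  rw [Ideal.Quotient.eq_zero_iff_mem, Ideal.mem_span_singleton]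
  simp only [Algebra.smul_def]
  rfl

theorem res_smul (p : ℂ[X]) (a : A) : F.res y (p • a) = p.eval y • F.res y a := by
  obtain ⟨q, hq⟩ := X_sub_C_dvd_sub_C_eval (a := y) (p := p)
  have h0 : F.res y (p • a - (p.eval y) • a) = 0 := by
    rw [res_eq_zero_iff]
    refine ⟨q • a, ?_⟩
    rw [smul_smul, ← hq, sub_smul, ← algebraMap_eq, algebraMap_smul]
  rwa [map_sub, map_smul (F.res y) (p.eval y), sub_eq_zero] at h0

/-- Here `X` acts as the coordinate `F.x`, not through the structure of `A` over the base, for which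
`X` would act as the constant `y`. `Fiber` is a separate definition so that the two structures do
not meet. -/
noncomputable instance : Algebra ℂ[X] (F.Fiber y) :=
  (aeval (R := ℂ) (F.res y F.x)).toRingHom.toAlgebra

instance : IsScalarTower ℂ ℂ[X] (F.Fiber y) :=
  .of_algebraMap_eq fun c => ((aeval (R := ℂ) (F.res y F.x)).commutes c).symm

theorem algebraMap_X_eq : algebraMap ℂ[X] (F.Fiber y) X = F.res y F.x :=
  aeval_X (R := ℂ) (F.res y F.x)

theorem res_aeval (P : ℂ[X][X]) :
    F.res y (aeval F.x P) = algebraMap ℂ[X] (F.Fiber y) (P.map (evalRingHom y)) := by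
  have h : (F.res y).toRingHom.comp (aeval F.x).toRingHom =
      (algebraMap ℂ[X] (F.Fiber y)).comp (mapRingHom (evalRingHom y)) := by
    refine Polynomial.ringHom_ext (fun p => ?_) ?_
    · change F.res y (aeval F.x (C p)) = algebraMap ℂ[X] (F.Fiber y) ((C p).map (evalRingHom y))
      rw [aeval_C, Algebra.algebraMap_eq_smul_one, res_smul, map_one, Polynomial.map_C,
        ← algebraMap_eq, ← IsScalarTower.algebraMap_apply, Algebra.algebraMap_eq_smul_one]
      rfl
    · change F.res y (aeval F.x X) = algebraMap ℂ[X] (F.Fiber y) (X.map (evalRingHom y))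
      rw [aeval_X, Polynomial.map_X, algebraMap_X_eq]
  exact congrArg (fun φ => φ P) h

theorem res_sum_aeval (P : Fin F.n → ℂ[X][X]) :
    F.res y (∑ i, aeval F.x (P i) * F.e i) =
      ∑ i, (P i).map (evalRingHom y) • F.res y (F.e i) := by
  rw [map_sum]
  refine Finset.sum_congr rfl fun i _ => ?_
  rw [map_mul, res_aeval, Algebra.smul_def]

theorem map_map_C_evalRingHom (p : ℂ[X]) : (p.map C).map (evalRingHom y) = p := by
  rw [Polynomial.map_map]
  have : (evalRingHom y).comp C = RingHom.id ℂ := by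
    ext
    simp
  rw [this, Polynomial.map_id]

variable {y} (hs : F.s.eval y ≠ 0)

include hs in
-- A relation on the fibre lifts to `∑ g i e i = (X - y) c`. Multiplying by a power of `s` makes `c`
-- a combination of the `e i`; uniqueness of coordinates and evaluation at `y` leave `s(y) ^ k g i =
-- 0`.
theorem linearIndependent_res : LinearIndependent ℂ[X] fun i => F.res y (F.e i) := by
  rw [Fintype.linearIndependent_iff]
  intro g hg
  have h1 : F.res y (∑ i, aeval F.x ((g i).map C) * F.e i) = 0 := by
    rw [res_sum_aeval]
    simpa only [map_map_C_evalRingHom] using hg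
  obtain ⟨c, hc⟩ := F.res_eq_zero_iff.1 h1
  obtain ⟨k, P, hP⟩ := F.exists_pow_smul_eq c
  have h2 := F.eq_zero_of_sum_eq_zero
    (fun i => C (F.s ^ k) * (g i).map C - C (X - C y) * P i) (by
      simp only [map_sub, map_mul, aeval_C, sub_mul, Finset.sum_sub_distrib, mul_assoc]
      rw [← Finset.mul_sum, ← Finset.mul_sum, hc, ← hP, ← Algebra.smul_def, ← Algebra.smul_def,
        smul_comm, ← Finset.mul_sum, ← hP, ← Algebra.smul_def, sub_smul, sub_self])
  intro i
  have h3 := congrArg (Polynomial.map (evalRingHom y)) (congrFun h2 i)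
  simp only [Polynomial.map_sub, Polynomial.map_mul, map_map_C_evalRingHom, Polynomial.map_C,
    Pi.zero_apply, Polynomial.map_zero] at h3
  simp only [coe_evalRingHom, eval_sub, eval_X, eval_C, sub_self, C_0, zero_mul, sub_zero,
    eval_pow, mul_eq_zero, C_eq_zero] at h3
  exact h3.resolve_left (pow_ne_zero k hs)

include hs in
theorem span_res_eq_top : ⊤ ≤ Submodule.span ℂ[X] (Set.range fun i => F.res y (F.e i)) := by
  intro a _
  obtain ⟨a, rfl⟩ := F.res_surjective y a
  obtain ⟨k, P, hP⟩ := F.exists_pow_smul_eq a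
  have h1 := congrArg (F.res y) hP
  rw [res_smul, res_sum_aeval, eval_pow] at h1
  have h2 : F.res y a = C ((F.s.eval y ^ k)⁻¹) •
      ∑ i, (P i).map (evalRingHom y) • F.res y (F.e i) := by
    rw [← h1, ← algebraMap_eq, algebraMap_smul, inv_smul_smul₀ (pow_ne_zero k hs)]
  rw [h2]
  exact Submodule.smul_mem _ _ (Submodule.sum_mem _ fun i _ =>
    Submodule.smul_mem _ _ (Submodule.subset_span ⟨i, rfl⟩))

/-- The basis of a fibre over the polynomial ring in the coordinate. -/
noncomputable def basis : Basis (Fin F.n) ℂ[X] (F.Fiber y) :=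
  Basis.mk (F.linearIndependent_res hs) (F.span_res_eq_top hs)

theorem basis_apply (i : Fin F.n) : F.basis hs i = F.res y (F.e i) := by
  simp [basis]

theorem repr_res_eq {a : A} {k : ℕ} {P : Fin F.n → ℂ[X][X]}
    (h : F.s ^ k • a = ∑ i, aeval F.x (P i) * F.e i) (i : Fin F.n) :
    (F.basis hs).repr (F.res y a) i =
      C ((F.s.eval y ^ k)⁻¹) * (P i).map (evalRingHom y) := by
  have h1 := congrArg (F.res y) h
  rw [res_smul, res_sum_aeval, eval_pow] at h1
  have h2 : F.res y a = ∑ i, (C ((F.s.eval y ^ k)⁻¹) * (P i).map (evalRingHom y)) •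
      F.basis hs i := by
    simp only [mul_smul, basis_apply]
    rw [← Finset.smul_sum, ← h1, ← algebraMap_eq, algebraMap_smul,
      inv_smul_smul₀ (pow_ne_zero k hs)]
  rw [h2, Basis.repr_sum_self]

theorem natDegree_repr_res_le {a : A} {k : ℕ} {P : Fin F.n → ℂ[X][X]}
    (h : F.s ^ k • a = ∑ i, aeval F.x (P i) * F.e i) (i : Fin F.n) :
    ((F.basis hs).repr (F.res y a) i).natDegree ≤ (P i).natDegree := by
  rw [repr_res_eq F hs h]
  exact (natDegree_C_mul_le _ _).trans natDegree_map_le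

theorem repr_mul_eq (i j l : Fin F.n) :
    (F.basis hs).repr (F.basis hs i * F.basis hs j) l =
      C ((F.s.eval y ^ 1)⁻¹) * (F.γ i j l).map (evalRingHom y) := by
  rw [basis_apply, basis_apply, ← map_mul]
  exact F.repr_res_eq hs (by rw [pow_one]; exact F.smul_mul_eq i j) l

theorem natDegree_repr_mul_le (i j l : Fin F.n) :
    ((F.basis hs).repr (F.basis hs i * F.basis hs j) l).natDegree ≤ (F.γ i j l).natDegree := by
  rw [repr_mul_eq]
  exact (natDegree_C_mul_le _ _).trans natDegree_map_le

theorem adjugate_mul_trace :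
    (mapRingHom (evalRingHom y)).mapMatrix (traceForm F.γ).adjugate *
      Matrix.of (fun i j => Algebra.trace ℂ[X] (F.Fiber y) (F.basis hs i * F.basis hs j)) =
    (C ((F.s.eval y ^ 1)⁻¹) ^ 2 * (traceForm F.γ).det.map (evalRingHom y)) • 1 := by
  rw [trace_mul_eq_traceForm]
  simp only [repr_mul_eq]
  rw [traceForm_smul]
  have h := map_traceForm (mapRingHom (evalRingHom y)) F.γ
  simp only [coe_mapRingHom] at h
  rw [← h, Matrix.mul_smul, ← map_mul, Matrix.adjugate_mul, mul_smul]
  congr 1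
  ext i j
  by_cases hij : i = j
  · subst hij
    simp
  · simp [Matrix.one_apply_ne hij]

variable (y) in
theorem exists_derivation_fiber : ∃ δ : Derivation ℂ (F.Fiber y) (F.Fiber y),
    ∀ a, δ (F.res y a) = F.res y (F.δ a) := by
  refine exists_derivation_quotient (Ideal.span {algebraMap ℂ[X] A (X - C y)})
    (F.δ.restrictScalars ℂ) fun a ha => ?_
  obtain ⟨c, rfl⟩ := Ideal.mem_span_singleton.1 ha
  change F.δ _ ∈ _
  rw [← Algebra.smul_def, Derivation.map_smul, Algebra.smul_def]
  exact Ideal.mul_mem_right _ _ (Ideal.mem_span_singleton_self _)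

theorem exists_eval_ne_zero_imp (P : ℂ[X][X]) (hP : P ≠ 0) : ∃ q : ℂ[X], q ≠ 0 ∧
    ∀ y, q.eval y ≠ 0 → P.map (evalRingHom y) ≠ 0 := by
  refine ⟨P.leadingCoeff, leadingCoeff_ne_zero.2 hP, fun y hy h0 => hy ?_⟩
  have := congrArg (fun Q => coeff Q P.natDegree) h0
  simpa using this

/-- Outside a finite set, the fibres are reduced, and the functions on them with a given
derivative are of bounded degree. -/
theorem exists_degree_bound {ι : Type*} [Fintype ι] (u : ι → A) : ∃ q : ℂ[X], q ≠ 0 ∧ ∃ N : ℕ,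
    ∀ y : ℂ, q.eval y ≠ 0 → (Ideal.span {algebraMap ℂ[X] A (X - C y)}).IsRadical ∧
      ∀ (a : A) (c : ι → ℂ) (t : Finset ι) (v : A),
        F.δ a = ∑ i ∈ t, c i • u i + (X - C y) • v →
        ∃ w : Fin F.n → ℂ[X], (∀ i, (w i).natDegree ≤ N) ∧
          ∃ v' : A, a = ∑ i, aeval F.x ((w i).map C) * F.e i + (X - C y) • v' := by
  classical
  -- The excluded values are the zeros of `s` and of the leading coefficients of `Δ` and of the
  -- discriminant. Elsewhere these stay nonzero on the fibre, and specialization does not raise the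
  -- degrees that enter the bound.
  obtain ⟨q₁, hq₁, h1⟩ := exists_eval_ne_zero_imp F.Δ F.Δ_ne_zero
  obtain ⟨q₂, hq₂, h2⟩ := exists_eval_ne_zero_imp _ F.det_traceForm_ne_zero
  choose k P hP using fun i => F.exists_pow_smul_eq (u i)
  obtain ⟨J, hJ⟩ := exists_natDegree_le P
  obtain ⟨J', hJ'⟩ := exists_natDegree_le (traceForm F.γ).adjugate
  obtain ⟨L, hL⟩ := exists_natDegree_le fun (i : Fin F.n × Fin F.n) l => F.γ i.1 i.2 l
  refine ⟨F.s * q₁ * q₂, mul_ne_zero (mul_ne_zero F.s_ne_zero hq₁) hq₂,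
    J' + (F.n + J + 2 * L), fun y hy => ?_⟩
  simp only [eval_mul, ne_eq, mul_eq_zero, not_or] at hy
  obtain ⟨⟨hs, hy₁⟩, hy₂⟩ := hy
  have hd : C ((F.s.eval y ^ 1)⁻¹) ^ 2 * (traceForm F.γ).det.map (evalRingHom y) ≠ 0 :=
    mul_ne_zero (pow_ne_zero _ (C_ne_zero.2 (inv_ne_zero (pow_ne_zero _ hs)))) (h2 y hy₂)
  refine ⟨?_, fun a c t v hav => ?_⟩
  · have := isReduced_of_mul_traceForm_eq (F.basis hs) hd (F.adjugate_mul_trace hs)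
    exact (Ideal.isRadical_iff_quotient_reduced _).2 this
  · obtain ⟨δ, hδ⟩ := F.exists_derivation_fiber y
    have hδX : δ (algebraMap ℂ[X] (F.Fiber y) X) =
        algebraMap ℂ[X] (F.Fiber y) (F.Δ.map (evalRingHom y)) := by
      rw [algebraMap_X_eq, hδ, F.δ_x, res_aeval]
    have hδa : δ (F.res y a) = ∑ i ∈ t, c i • F.res y (u i) := by
      rw [hδ, hav, map_add, res_smul, map_sum]
      simp
    have hdeg : ∀ l, ((F.basis hs).repr (δ (F.res y a)) l).natDegree ≤ J := by
      intro l
      rw [hδa, map_sum, Finsupp.coe_finsetSum, Finset.sum_apply]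
      refine natDegree_sum_le_of_forall_le _ _ fun i _ => ?_
      rw [← algebraMap_smul ℂ[X] (c i), map_smul, Finsupp.smul_apply, smul_eq_mul, algebraMap_eq]
      exact (natDegree_C_mul_le _ _).trans
        ((F.natDegree_repr_res_le hs (hP i) l).trans (hJ i l))
    have hbound := natDegree_repr_le_of_derivation (F.basis hs) hδX (h1 y hy₁)
      (fun i j l => (F.natDegree_repr_mul_le hs i j l).trans (hL (i, j) l))
      (fun i j => natDegree_map_le.trans (hJ' i j)) hd (F.adjugate_mul_trace hs) hdeg
    refine ⟨fun i => (F.basis hs).repr (F.res y a) i, hbound, ?_⟩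
    have h0 : F.res y (a - ∑ i, aeval F.x (((F.basis hs).repr (F.res y a) i).map C) * F.e i) = 0 := by
      rw [map_sub, res_sum_aeval, sub_eq_zero]
      simp only [map_map_C_evalRingHom, ← basis_apply F hs]
      exact ((F.basis hs).sum_repr _).symm
    obtain ⟨v', hv'⟩ := F.res_eq_zero_iff.1 h0
    exact ⟨v', by rw [← hv']; abel⟩

end Frame

end

end TruncatedDeRham

/-! ### Bounded torsion: a weak generic freeness -/

namespace TruncatedDeRham

open Polynomial Module

section Saturation

variable (R : Type*) [CommRing R]

/-- For every finitely generated submodule `W` of `M`, the torsion of `M / W` is killed by the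
powers of a single nonzero element of `R`. -/
def BoundedTorsion (M : Type*) [AddCommGroup M] [Module R M] : Prop :=
  ∀ W : Submodule R M, W.FG → ∃ s : R, s ≠ 0 ∧
    ∀ (m : M) (r : R), r ≠ 0 → r • m ∈ W → ∃ k : ℕ, s ^ k • m ∈ W

variable {R} [IsDomain R] {M M' M'' : Type*} [AddCommGroup M] [Module R M] [AddCommGroup M']
  [Module R M'] [AddCommGroup M''] [Module R M'']

theorem BoundedTorsion.of_injective (h : BoundedTorsion R M') (f : M →ₗ[R] M')
    (hf : Function.Injective f) : BoundedTorsion R M := by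
  intro W hW
  obtain ⟨s, hs, h⟩ := h (W.map f) (hW.map f)
  refine ⟨s, hs, fun m r hr hm => ?_⟩
  obtain ⟨k, hk⟩ := h (f m) r hr (by rw [← map_smul]; exact Submodule.mem_map_of_mem hm)
  rw [← map_smul, Submodule.mem_map] at hk
  obtain ⟨w, hw, hwm⟩ := hk
  exact ⟨k, hf hwm ▸ hw⟩

/-- Torsion is cleared first in `M''` modulo the image of `W`, then in `M` modulo the preimage of
`W`, which is finitely generated because `R` is Noetherian. -/
theorem BoundedTorsion.of_exact [IsNoetherianRing R] (h : BoundedTorsion R M)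
    (h'' : BoundedTorsion R M'') (f : M →ₗ[R] M') (g : M' →ₗ[R] M'')
    (hf : Function.Injective f) (hfg : Function.Exact f g) : BoundedTorsion R M' := by
  intro W hW
  have hW' : (W.comap f).FG := by
    have : Module.Finite R W := Module.Finite.of_fg hW
    have := isNoetherian_of_isNoetherianRing_of_finite R W
    have hN : IsNoetherian R (W.comap f) :=
      isNoetherian_of_injective (f.restrict (p := W.comap f) (q := W) fun _ h => h)
        fun a b hab => Subtype.ext (hf (congrArg Subtype.val hab))
    exact Module.Finite.iff_fg.1 inferInstance
  obtain ⟨s₁, hs₁, h₁⟩ := h _ hW'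
  obtain ⟨s₂, hs₂, h₂⟩ := h'' _ (hW.map g)
  refine ⟨s₁ * s₂, mul_ne_zero hs₁ hs₂, fun m r hr hm => ?_⟩
  obtain ⟨k, hk⟩ := h₂ (g m) r hr (by rw [← map_smul]; exact Submodule.mem_map_of_mem hm)
  rw [← map_smul, Submodule.mem_map] at hk
  obtain ⟨w, hw, hwm⟩ := hk
  obtain ⟨m₁, hm₁⟩ := (hfg (s₂ ^ k • m - w)).1 (by rw [map_sub, hwm, sub_self])
  obtain ⟨l, hl⟩ := h₁ m₁ r hr (by
    rw [Submodule.mem_comap, map_smul, hm₁, smul_sub, smul_comm]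
    exact W.sub_mem (W.smul_mem _ hm) (W.smul_mem _ hw))
  rw [Submodule.mem_comap, map_smul, hm₁, smul_sub] at hl
  have h3 : s₁ ^ l • s₂ ^ k • m ∈ W := by
    have := W.add_mem hl (W.smul_mem (s₁ ^ l) hw)
    rwa [sub_add_cancel] at this
  refine ⟨k + l, ?_⟩
  have : (s₁ * s₂) ^ (k + l) = (s₁ ^ k * s₂ ^ l) * (s₁ ^ l * s₂ ^ k) := by ring
  rw [this, mul_smul, mul_smul (s₁ ^ l)]
  exact W.smul_mem _ h3

/-- The elements of `V` that are torsion modulo `W` form a finitely generated module, and the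
product of the scalars for its generators works for all of them. -/
theorem exists_smul_mem_of_fg [IsNoetherianRing R] {V W : Submodule R M} (hV : V.FG) :
    ∃ s : R, s ≠ 0 ∧ ∀ m ∈ V, ∀ r : R, r ≠ 0 → r • m ∈ W → s • m ∈ W := by
  let T : Submodule R M :=
    { carrier := {m | m ∈ V ∧ ∃ r : R, r ≠ 0 ∧ r • m ∈ W}
      zero_mem' := ⟨V.zero_mem, 1, one_ne_zero, by simp⟩
      add_mem' := by
        rintro a b ⟨ha, r, hr, hra⟩ ⟨hb, r', hr', hrb⟩
        refine ⟨V.add_mem ha hb, r * r', mul_ne_zero hr hr', ?_⟩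
        rw [smul_add, mul_comm, mul_smul, mul_comm, mul_smul]
        exact W.add_mem (W.smul_mem _ hra) (W.smul_mem _ hrb)
      smul_mem' := by
        rintro c a ⟨ha, r, hr, hra⟩
        refine ⟨V.smul_mem c ha, r, hr, ?_⟩
        rw [smul_comm]
        exact W.smul_mem _ hra }
  have hTV : T ≤ V := fun m hm => hm.1
  have : Module.Finite R V := Module.Finite.of_fg hV
  have := isNoetherian_of_isNoetherianRing_of_finite R V
  have hT : T.FG := by
    have : IsNoetherian R T := isNoetherian_of_le hTV
    exact Module.Finite.iff_fg.1 inferInstance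
  obtain ⟨n, g, hg⟩ := Submodule.fg_iff_exists_fin_generating_family.1 hT
  have hgT : ∀ i, g i ∈ T := fun i => hg ▸ Submodule.subset_span ⟨i, rfl⟩
  choose r hr hrg using fun i => (hgT i).2
  refine ⟨∏ i, r i, Finset.prod_ne_zero_iff.2 fun i _ => hr i, fun m hm c hc hcm => ?_⟩
  have hmT : m ∈ Submodule.span R (Set.range g) := hg ▸ (⟨hm, c, hc, hcm⟩ : m ∈ T)
  refine Submodule.span_induction ?_ (by simp) ?_ ?_ hmT
  · rintro _ ⟨i, rfl⟩
    rw [← Finset.prod_erase_mul _ _ (Finset.mem_univ i), mul_smul]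
    exact W.smul_mem _ (hrg i)
  · intro a b _ _ ha hb
    rw [smul_add]
    exact W.add_mem ha hb
  · intro a b _ hb
    rw [smul_comm]
    exact W.smul_mem _ hb

/-- It suffices to force the torsion modulo `W` into some finitely generated `V`: inside `V` one
scalar does the rest. -/
theorem BoundedTorsion.of_forall_exists_fg [IsNoetherianRing R]
    (h : ∀ W : Submodule R M, W.FG → ∃ V : Submodule R M, V.FG ∧ ∃ s : R, s ≠ 0 ∧
      ∀ (m : M) (r : R), r ≠ 0 → r • m ∈ W → ∃ k : ℕ, s ^ k • m ∈ V) : BoundedTorsion R M := by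
  intro W hW
  obtain ⟨V, hV, s, hs, h⟩ := h W hW
  obtain ⟨s', hs', h'⟩ := exists_smul_mem_of_fg (W := W) hV
  refine ⟨s' * s, mul_ne_zero hs' hs, fun m r hr hm => ?_⟩
  obtain ⟨k, hk⟩ := h m r hr hm
  have h1 := h' _ hk r hr (by rw [smul_comm]; exact W.smul_mem _ hm)
  refine ⟨k + 1, ?_⟩
  have : (s' * s) ^ (k + 1) = (s' ^ k * s) * (s' * s ^ k) := by ring
  rw [this, mul_smul, mul_smul s']
  exact W.smul_mem _ h1

/-- A nonzero constant does not change the degree of a polynomial, so torsion modulo `W` stays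
within the degrees that occur in `W`. -/
theorem boundedTorsion_polynomial [IsNoetherianRing R] : BoundedTorsion R R[X] := by
  refine .of_forall_exists_fg fun W hW => ?_
  obtain ⟨S, rfl⟩ := hW
  let d := S.sup natDegree
  have hle : Submodule.span R (S : Set R[X]) ≤ degreeLT R (d + 1) := by
    rw [Submodule.span_le]
    intro p hp
    rw [SetLike.mem_coe, mem_degreeLT]
    refine lt_of_le_of_lt degree_le_natDegree ?_
    exact_mod_cast Nat.lt_succ_of_le (Finset.le_sup (f := natDegree) hp)
  refine ⟨degreeLT R (d + 1), ?_, 1, one_ne_zero, fun m r hr hm => ⟨0, ?_⟩⟩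
  · have : Module.Finite R (degreeLT R (d + 1)) :=
      Module.Finite.equiv (degreeLTEquiv R (d + 1)).symm
    exact Module.Finite.iff_fg.1 this
  · have h1 := hle hm
    rw [mem_degreeLT, smul_eq_C_mul, degree_C_mul hr] at h1
    simpa [mem_degreeLT] using h1

/-- For a nonzero `g ∈ P`, its leading coefficient times `x` is integral over `R` and generates a
finite algebra `V`. Every element, torsion or not, enters `V` after multiplication by a power of
that coefficient. -/
theorem boundedTorsion_quotient [IsNoetherianRing R] (P : Ideal R[X]) :
    BoundedTorsion R (R[X] ⧸ P) := by
  by_cases hP : P = ⊥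
  · exact boundedTorsion_polynomial.of_injective
      ((Submodule.quotEquivOfEqBot P hP).restrictScalars R).toLinearMap
      (Submodule.quotEquivOfEqBot P hP).injective
  · obtain ⟨g, hgP, hg⟩ := Submodule.exists_mem_ne_zero_of_ne_bot hP
    refine .of_forall_exists_fg fun W hW => ?_
    let x := Ideal.Quotient.mk P X
    have hx : aeval x g = 0 := by
      change aeval (Ideal.Quotient.mkₐ R P X) g = 0
      rw [aeval_algHom_apply, aeval_X_left_apply]
      exact Ideal.Quotient.eq_zero_iff_mem.2 hgP
    let V := Algebra.adjoin R {g.leadingCoeff • x}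
    refine ⟨Subalgebra.toSubmodule V, (isIntegral_leadingCoeff_smul g x hx).fg_adjoin_singleton,
      g.leadingCoeff, leadingCoeff_ne_zero.2 hg, fun m _ _ hm => ?_⟩
    clear hm
    obtain ⟨p, rfl⟩ := Ideal.Quotient.mk_surjective m
    induction p using Polynomial.induction_on' with
    | add p q hp hq =>
      obtain ⟨k, hk⟩ := hp
      obtain ⟨l, hl⟩ := hq
      refine ⟨k + l, ?_⟩
      rw [map_add, smul_add]
      refine Submodule.add_mem _ ?_ ?_
      · rw [pow_add, mul_comm, mul_smul]
        exact Submodule.smul_mem _ _ hk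
      · rw [pow_add, mul_smul]
        exact Submodule.smul_mem _ _ hl
    | monomial n a =>
      refine ⟨n, ?_⟩
      have : g.leadingCoeff ^ n • Ideal.Quotient.mk P (monomial n a) =
          a • (g.leadingCoeff • x) ^ n := by
        rw [_root_.smul_pow, smul_comm a, ← map_pow, ← C_mul_X_pow_eq_monomial, ← smul_eq_C_mul]
        rfl
      rw [this]
      exact Submodule.smul_mem _ _ (pow_mem (Algebra.self_mem_adjoin_singleton R _) n)

/-- A weak form of generic freeness. -/
theorem boundedTorsion_of_finite_polynomial [IsNoetherianRing R] {N : Type*} [AddCommGroup N]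
    [Module R[X] N] (hN : Module.Finite R[X] N) [Module R N] [IsScalarTower R R[X] N] :
    BoundedTorsion R N := by
  have key := IsNoetherianRing.induction_on_isQuotientEquivQuotientPrime R[X] hN
    (motive := fun N _ _ _ => ∀ [Module R N] [IsScalarTower R R[X] N], BoundedTorsion R N)
    (fun N _ _ _ _ _ _ W _ => ⟨1, one_ne_zero, fun m _ _ _ =>
      ⟨0, by rw [Subsingleton.elim m 0, smul_zero]; exact W.zero_mem⟩⟩)
    (fun N _ _ _ p f _ _ => (boundedTorsion_quotient p.1).of_injective
      (f.restrictScalars R).toLinearMap f.injective)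
    (fun N₁ _ _ _ N₂ _ _ _ N₃ _ _ _ f g hf _ hfg h₁ h₃ _ _ => by
      let _ : Module R N₁ := Module.compHom N₁ (C : R →+* R[X])
      let _ : Module R N₃ := Module.compHom N₃ (C : R →+* R[X])
      have : IsScalarTower R R[X] N₁ := ⟨fun a b c => by
        rw [smul_eq_C_mul, mul_smul]; rfl⟩
      have : IsScalarTower R R[X] N₃ := ⟨fun a b c => by
        rw [smul_eq_C_mul, mul_smul]; rfl⟩
      exact h₁.of_exact h₃ (f.restrictScalars R) (g.restrictScalars R) hf hfg)
  exact key

/-- Generators of `W` are moved into `N₀` by a common power of `s`, torsion is cleared there by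
powers of `t`, and `t * s` does both at once. -/
theorem BoundedTorsion.of_pow_smul_mem {N₀ : Submodule R M} (h : BoundedTorsion R N₀) {s : R}
    (hs : s ≠ 0) (hN₀ : ∀ m, ∃ k : ℕ, s ^ k • m ∈ N₀) : BoundedTorsion R M := by
  intro W hW
  obtain ⟨n, g, rfl⟩ := Submodule.fg_iff_exists_fin_generating_family.1 hW
  choose k hk using hN₀
  let l := Finset.univ.sup fun i => k (g i)
  have hl : ∀ i, s ^ l • g i ∈ N₀ := fun i => by
    have : k (g i) ≤ l := Finset.le_sup (f := fun i => k (g i)) (Finset.mem_univ i)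
    rw [← Nat.sub_add_cancel this, pow_add, mul_smul]
    exact N₀.smul_mem _ (hk _)
  obtain ⟨t, ht, h⟩ := h (Submodule.span R (Set.range fun i => (⟨_, hl i⟩ : N₀)))
    (Submodule.fg_span (Set.finite_range _))
  refine ⟨t * s, mul_ne_zero ht hs, fun m r hr hm => ?_⟩
  have key : ∀ v ∈ Submodule.span R (Set.range g), ∀ w : N₀, (w : M) = s ^ l • v →
      w ∈ Submodule.span R (Set.range fun i => (⟨_, hl i⟩ : N₀)) := by
    intro v hv w hw
    have h1 : (s ^ l • v) ∈ (Submodule.span R (Set.range fun i => (⟨_, hl i⟩ : N₀))).map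
        N₀.subtype := by
      rw [Submodule.map_span, ← Set.range_comp]
      have h2 := Submodule.mem_map_of_mem (f := LinearMap.lsmul R M (s ^ l)) hv
      rw [Submodule.map_span, ← Set.range_comp] at h2
      exact h2
    rw [← hw] at h1
    obtain ⟨w', hw', hww'⟩ := h1
    rwa [← Subtype.ext hww']
  have hback : ∀ w ∈ Submodule.span R (Set.range fun i => (⟨_, hl i⟩ : N₀)),
      (w : M) ∈ Submodule.span R (Set.range g) := by
    intro w hw
    have h2 := Submodule.mem_map_of_mem (f := N₀.subtype) hw
    rw [Submodule.map_span, ← Set.range_comp] at h2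
    refine Submodule.span_le.2 ?_ h2
    rintro _ ⟨i, rfl⟩
    exact Submodule.smul_mem _ _ (Submodule.subset_span ⟨i, rfl⟩)
  let m₀ : N₀ := ⟨s ^ l • s ^ k m • m, N₀.smul_mem _ (hk m)⟩
  obtain ⟨j, hj⟩ := h m₀ r hr (key (s ^ k m • r • m) (Submodule.smul_mem _ _ hm) _ (by
    change r • s ^ l • s ^ k m • m = _
    rw [smul_comm r, smul_comm r]))
  have h3 := hback _ hj
  change t ^ j • s ^ l • s ^ k m • m ∈ _ at h3
  refine ⟨j + l + k m, ?_⟩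
  have : (t * s) ^ (j + l + k m) = (t ^ (l + k m) * s ^ j) * (t ^ j * (s ^ l * s ^ k m)) := by ring
  rw [this, mul_smul, mul_smul (t ^ j), mul_smul (s ^ l)]
  exact Submodule.smul_mem _ _ h3

/-- A weak form of generic freeness for algebras with a frame. -/
theorem Frame.boundedTorsion [IsNoetherianRing R] {A N : Type*} [CommRing A] [Algebra R A]
    (F : Frame R A) [AddCommGroup N] [Module A N] [Module R N] [IsScalarTower R A N]
    [Module.Finite A N] : BoundedTorsion R N := by
  obtain ⟨d, v, hv⟩ := Module.Finite.exists_fin (R := A) (M := N)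
  let _ : Module R[X] N := Module.compHom N (aeval F.x : R[X] →ₐ[R] A).toRingHom
  have hdef : ∀ (P : R[X]) (m : N), P • m = aeval F.x P • m := fun _ _ => rfl
  have : IsScalarTower R R[X] N := ⟨fun a P m => by
    rw [hdef, hdef, map_smul, smul_assoc]⟩
  let N₀ : Submodule R[X] N := Submodule.span R[X] (Set.range fun t : Fin F.n × Fin d => F.e t.1 • v t.2)
  have hfin : Module.Finite R[X] N₀ := Module.Finite.span_of_finite _ (Set.finite_range _)
  have h1 : BoundedTorsion R N₀ := boundedTorsion_of_finite_polynomial hfin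
  refine BoundedTorsion.of_pow_smul_mem (N₀ := N₀.restrictScalars R) h1 F.s_ne_zero fun m => ?_
  have hm : m ∈ Submodule.span A (Set.range v) := hv ▸ Submodule.mem_top
  rw [Submodule.mem_span_range_iff_exists_fun] at hm
  obtain ⟨c, rfl⟩ := hm
  choose k P hP using fun j => F.exists_pow_smul_eq (c j)
  refine ⟨∑ j, k j, ?_⟩
  rw [Finset.smul_sum]
  refine Submodule.sum_mem _ fun j _ => ?_
  rw [← Finset.sum_erase_add _ _ (Finset.mem_univ j), pow_add, mul_smul]
  refine Submodule.smul_mem _ _ ?_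
  rw [← smul_assoc, hP, Finset.sum_smul]
  refine Submodule.sum_mem _ fun i _ => ?_
  rw [mul_smul, ← hdef]
  exact N₀.smul_mem _ (Submodule.subset_span ⟨(i, j), rfl⟩)

end Saturation

end TruncatedDeRham

/-! ### Independence on almost all fibres and semicontinuity -/

namespace TruncatedDeRham

open Polynomial Module

open scoped nonZeroDivisors KaehlerDifferential

universe u

section

variable {A : Type u} [CommRing A] [Algebra ℂ A] [Algebra ℂ[X] A] [IsScalarTower ℂ ℂ[X] A]

theorem D_sum_aeval_mem_span {x : A} {n N : ℕ} (e : Fin n → A) {w : Fin n → ℂ[X]}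
    (hw : ∀ i, (w i).natDegree ≤ N) :
    KaehlerDifferential.D ℂ[X] A (∑ i, aeval x ((w i).map C) * e i) ∈ Submodule.span ℂ[X]
      (Set.range fun t : Fin (N + 1) × Fin n =>
        KaehlerDifferential.D ℂ[X] A (x ^ (t.1 : ℕ) * e t.2)) := by
  rw [map_sum]
  refine Submodule.sum_mem _ fun i _ => ?_
  rw [aeval_eq_sum_range' (Nat.lt_succ_of_le (natDegree_map_le.trans (hw i))), Finset.sum_mul,
    map_sum]
  refine Submodule.sum_mem _ fun j hj => ?_
  rw [smul_mul_assoc, Derivation.map_smul]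
  exact Submodule.smul_mem _ _ (Submodule.subset_span
    ⟨(⟨j, Finset.mem_range.1 hj⟩, i), rfl⟩)

/-- Classes that are independent over `ℂ[f]` remain independent on all but finitely many
fibres. -/
theorem exists_linearIndependent_restrictFiber (hA : IsAffineSurface A)
    (hdom : ∀ p : ℂ[X], p ≠ 0 → algebraMap ℂ[X] A p ∈ nonZeroDivisors A) {ι : Type*} [Fintype ι]
    {ω : ι → Ω[A⁄ℂ]}
    (hω : LinearIndependent (Algebra.adjoin ℂ {algebraMap ℂ[X] A X})
      fun i => (Submodule.Quotient.mk (ω i) : RelH1 (algebraMap ℂ[X] A X))) :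
    ∃ q : ℂ[X], q ≠ 0 ∧ ∀ y : ℂ, q.eval y ≠ 0 →
      LinearIndependent ℂ fun i => restrictFiber (algebraMap ℂ[X] A X) y (ω i) := by
  have := hA.nontrivial
  have := hA.finiteType
  have : Algebra.FiniteType ℂ[X] A := .of_restrictScalars_finiteType ℂ ℂ[X] A
  have hinj : Function.Injective (algebraMap ℂ[X] A) := by
    rw [injective_iff_map_eq_zero]
    intro p hp
    by_contra h0
    exact nonZeroDivisors.ne_zero (hdom p h0) hp
  obtain ⟨F⟩ := hA.nonempty_frame hdom
  set ν : ι → Ω[A⁄ℂ[X]] := fun i => KaehlerDifferential.map ℂ ℂ[X] A A (ω i) with hνdef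
  have hν := linearIndependent_map_of_adjoin hinj hω
  let δ' := F.δ.liftKaehlerDifferential
  obtain ⟨q₁, hq₁, N, hN⟩ := F.exists_degree_bound fun i => δ' (ν i)
  -- `W₁ ⊔ W₂` does not depend on `y`: `W₂` contains the differentials of all combinations of the
  -- `F.e i` whose coefficients have degree at most `N` in `F.x`. Thus one `s` serves all fibres.
  let W₁ := Submodule.span ℂ[X] (Set.range ν)
  let W₂ := Submodule.span ℂ[X] (Set.range fun t : Fin (N + 1) × Fin F.n =>
    KaehlerDifferential.D ℂ[X] A (F.x ^ (t.1 : ℕ) * F.e t.2))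
  have hW : (W₁ ⊔ W₂).FG := (Submodule.fg_span (Set.finite_range _)).sup
    (Submodule.fg_span (Set.finite_range _))
  obtain ⟨s, hs, hsW⟩ := F.boundedTorsion (N := Ω[A⁄ℂ[X]]) (W₁ ⊔ W₂) hW
  refine ⟨q₁ * s, mul_ne_zero hq₁ hs, fun y hy => ?_⟩
  rw [eval_mul, ne_eq, mul_eq_zero, not_or] at hy
  obtain ⟨hrad, hbound⟩ := hN y hy.1
  rw [← sub_algebraMap_eq] at hrad
  rw [Fintype.linearIndependent_iff]
  intro c hc
  have h0 : restrictFiber (algebraMap ℂ[X] A X) y (∑ i, c i • ω i) = 0 := by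
    rw [map_sum]
    simpa only [map_smul] using hc
  obtain ⟨η, hη⟩ := exists_sub_mem_relExact_of_restrictFiber_eq_zero hrad h0
  obtain ⟨a, ha⟩ := mem_relExact_iff_exists_map_eq.1 hη
  set η' := KaehlerDifferential.map ℂ ℂ[X] A A η
  have h1 : ∑ i, C (c i) • ν i = KaehlerDifferential.D ℂ[X] A a + (X - C y) • η' := by
    rw [← ha, map_sub, sub_algebraMap_eq, map_algebraMap_smul, map_sum, sub_add_cancel]
    refine Finset.sum_congr rfl fun i _ => ?_
    rw [hνdef, ← map_algebraMap_smul, ← algebraMap_eq, ← IsScalarTower.algebraMap_apply,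
      algebraMap_smul]
  have h2 : F.δ a = ∑ i, c i • δ' (ν i) + (X - C y) • (-(δ' η')) := by
    have h3 := congrArg δ' h1
    rw [map_add, Derivation.liftKaehlerDifferential_comp_D, map_sum,
      LinearMap.map_smul_of_tower] at h3
    rw [smul_neg, ← sub_eq_add_neg, eq_sub_iff_add_eq, ← h3]
    refine Finset.sum_congr rfl fun i _ => ?_
    rw [LinearMap.map_smul_of_tower, ← algebraMap_eq, algebraMap_smul]
  -- Modulo `X - y` the primitive `a` is replaced by a `z` of bounded degree; the difference is
  -- absorbed into the form multiplied by `X - y`.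
  obtain ⟨w, hw, v, hv⟩ := hbound a c Finset.univ _ h2
  set z := ∑ i, aeval F.x ((w i).map C) * F.e i with hz
  have hzW : KaehlerDifferential.D ℂ[X] A z ∈ W₂ := D_sum_aeval_mem_span F.e hw
  have h3 : (X - C y) • (η' + KaehlerDifferential.D ℂ[X] A v) =
      ∑ i, C (c i) • ν i - KaehlerDifferential.D ℂ[X] A z := by
    rw [h1, hv, map_add, Derivation.map_smul, smul_add]
    abel
  obtain ⟨k, hk⟩ := hsW (η' + KaehlerDifferential.D ℂ[X] A v) (X - C y) (X_sub_C_ne_zero y) (by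
    rw [h3]
    refine Submodule.sub_mem _ (Submodule.sum_mem _ fun i _ => Submodule.smul_mem _ _
      (Submodule.mem_sup_left (Submodule.subset_span ⟨i, rfl⟩))) (Submodule.mem_sup_right hzW))
  obtain ⟨m₁, hm₁, m₂, hm₂, hm⟩ := Submodule.mem_sup.1 hk
  obtain ⟨p, hp⟩ := (Submodule.mem_span_range_iff_exists_fun _).1 hm₁
  have hW₂ : W₂ ≤ LinearMap.range (KaehlerDifferential.D ℂ[X] A).toLinearMap := by
    rw [Submodule.span_le]
    rintro _ ⟨t, rfl⟩
    exact ⟨_, rfl⟩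
  -- A relation over `ℂ[X]` between the independent classes of the `ν i`; its coefficients vanish,
  -- and at `y` they equal `s(y) ^ k * c i`.
  have h4 : ∑ i, (s ^ k * C (c i) - (X - C y) * p i) •
      (Submodule.Quotient.mk (ν i) : CokerD ℂ[X] A) = 0 := by
    have h5 : ∑ i, (s ^ k * C (c i) - (X - C y) * p i) • ν i =
        s ^ k • KaehlerDifferential.D ℂ[X] A z + (X - C y) • m₂ := by
      generalize (X - C y : ℂ[X]) = r at h3 ⊢
      simp only [sub_smul, mul_smul, Finset.sum_sub_distrib, ← Finset.smul_sum]
      rw [hp, eq_sub_of_add_eq hm, smul_sub, smul_comm r, h3, smul_sub]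
      abel
    have h6 : (Submodule.Quotient.mk (∑ i, (s ^ k * C (c i) - (X - C y) * p i) • ν i) :
        CokerD ℂ[X] A) = 0 := by
      rw [h5, Submodule.Quotient.mk_eq_zero]
      exact Submodule.add_mem _ (Submodule.smul_mem _ _ (hW₂ hzW)) (Submodule.smul_mem _ _ (hW₂ hm₂))
    rw [← h6, ← Submodule.mkQ_apply, map_sum]
    rfl
  intro i
  have h5 := Fintype.linearIndependent_iff.1 hν _ h4 i
  have h6 := congrArg (eval y) h5
  simp only [eval_sub, eval_mul, eval_pow, eval_C, eval_X, sub_self, zero_mul, sub_zero,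
    eval_zero, mul_eq_zero] at h6
  exact h6.resolve_left (pow_ne_zero k hy.2)

theorem natCast_le_h1_of_linearIndependent {f : A} {y : ℂ} {ι : Type u} [Fintype ι] {ω : ι → Ω[A⁄ℂ]}
    (h : LinearIndependent ℂ fun i => restrictFiber f y (ω i)) : (Fintype.card ι : ℕ∞) ≤ h1 f y := by
  have h2 := h.cardinal_le_rank
  rw [Cardinal.mk_fintype] at h2
  have h3 := Cardinal.toENat.monotone' h2
  simpa [h1] using h3

theorem exists_rank_relH1_eq (hA : IsAffineSurface A)
    (hdom : ∀ p : ℂ[X], p ≠ 0 → algebraMap ℂ[X] A p ∈ nonZeroDivisors A) : ∃ h : ℕ,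
    Module.rank (Algebra.adjoin ℂ {algebraMap ℂ[X] A X}) (RelH1 (algebraMap ℂ[X] A X)) = h ∧
      ∃ q : ℂ[X], q ≠ 0 ∧ ∀ y : ℂ, q.eval y ≠ 0 → (h : ℕ∞) ≤ h1 (algebraMap ℂ[X] A X) y := by
  obtain ⟨h, hh⟩ := Cardinal.lt_aleph0.1 (rank_relH1_lt_aleph0 hA hdom)
  obtain ⟨t, ht, hli⟩ := exists_finset_linearIndependent_of_le_rank hh.ge
  choose ω hω using Submodule.Quotient.mk_surjective (relExact (algebraMap ℂ[X] A X))
  have hli' : LinearIndependent (Algebra.adjoin ℂ {algebraMap ℂ[X] A X})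
      fun i : t => (Submodule.Quotient.mk (ω i) : RelH1 (algebraMap ℂ[X] A X)) := by
    simp only [hω]
    exact hli
  obtain ⟨q, hq, hqy⟩ := exists_linearIndependent_restrictFiber hA hdom hli'
  refine ⟨h, hh, q, hq, fun y hy => ?_⟩
  have := natCast_le_h1_of_linearIndependent (hqy y hy)
  rwa [Fintype.card_coe, ht] at this

end

/-- The rank of `H¹(f)` is finite, and bounded by the dimension of `H¹` of almost all fibres. -/
theorem IsAffineSurface.exists_rank_relH1_eq {A : Type u} [CommRing A] [Algebra ℂ A]
    (hA : IsAffineSurface A) {f : A} (hf : IsDominant f) : ∃ h : ℕ,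
    Module.rank (Algebra.adjoin ℂ {f}) (RelH1 f) = h ∧
      ∃ q : ℂ[X], q ≠ 0 ∧ ∀ y : ℂ, q.eval y ≠ 0 → (h : ℕ∞) ≤ h1 f y := by
  have := hA.isReduced
  let _ : Algebra ℂ[X] A := (aeval (R := ℂ) f).toRingHom.toAlgebra
  have : IsScalarTower ℂ ℂ[X] A := .of_algebraMap_eq fun c =>
    ((aeval (R := ℂ) f).commutes c).symm
  have hX : algebraMap ℂ[X] A X = f := aeval_X (R := ℂ) f
  have h := TruncatedDeRham.exists_rank_relH1_eq hA fun p hp => aeval_mem_nonZeroDivisors hf hp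
  rwa [hX] at h

/-- The zeros of `q` are finite in number, so a punctured neighbourhood of `y₀` avoids them, and
there `u y₀ ≤ h ≤ u y`. -/
theorem lowerSemicontinuousAt_of_eval_ne_zero {u : ℂ → ℕ∞} {q : ℂ[X]} (hq : q ≠ 0) {h : ℕ∞}
    (hu : ∀ y, q.eval y ≠ 0 → h ≤ u y) {y₀ : ℂ} (hy₀ : u y₀ ≤ h) :
    LowerSemicontinuousAt u y₀ := by
  intro z hz
  have hfin : ((q.roots.toFinset : Set ℂ) \ {y₀})ᶜ ∈ nhds y₀ :=
    ((Finset.finite_toSet _).subset Set.sdiff_subset).isClosed.isOpen_compl.mem_nhds (by simp)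
  filter_upwards [hfin] with y hy
  by_cases hyy : y = y₀
  · rwa [hyy]
  · refine hz.trans_le (hy₀.trans (hu y fun h0 => hy ⟨?_, hyy⟩))
    simpa [hq] using h0

end TruncatedDeRham

theorem theorem2 {A : Type*} [CommRing A] [Algebra ℂ A]
    (hA : TruncatedDeRham.IsAffineSurface A)
    (hlci : TruncatedDeRham.IsLocallyCompleteIntersection A 2)
    (f : A) (hf : TruncatedDeRham.IsDominant f) :
    ∃ h_f : ℕ,
      Module.rank (Algebra.adjoin ℂ {f}) (TruncatedDeRham.RelH1 f) = h_f ∧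
      ∀ y : ℂ, (TruncatedDeRham.fiber f y ∩ TruncatedDeRham.sing f).Finite →
        Module.rank ℂ (TruncatedDeRham.H1 (TruncatedDeRham.FiberRing f y)) ≤ h_f ∧
        LowerSemicontinuousAt (TruncatedDeRham.h1 f) y := by
  obtain ⟨h, hh, q, hq, hle⟩ := hA.exists_rank_relH1_eq hf
  refine ⟨h, hh, fun y hy => ?_⟩
  have hy' := hA.rank_H1_fiberRing_le hlci hf hy
  rw [hh] at hy'
  refine ⟨hy', TruncatedDeRham.lowerSemicontinuousAt_of_eval_ne_zero hq hle ?_⟩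
  have := Cardinal.toENat.monotone' hy'
  simpa [TruncatedDeRham.h1] using this
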